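/- Let $\mu$ be a probability measure on $\mathbb{R}^d$ with finite second moment, let $X\sim\mu$, and put $I(s) := I(X;\sqrt{s}\,X+N)$ for $s\ge 0$, where $N\sim\mathsf{N}(0,\mathrm{I})$ is independent of $X$ and $I(X;Y)=D(\mathsf{Law}(X,Y)\,\|\,\mathsf{Law}(X)\otimes\mathsf{Law}(Y))$ is the mutual information in nats ($D$ is the Kullback–Leibler divergence). Let $T_n$ be a real sequence with $T_n\to\infty$ and $\frac1n\log T_n\to 0$, and let $\alpha_n=(T_n\log T_n)^{1/n}$. For each $n$ consider the time points $$t_k=\frac{\alpha_n^k-1}{\alpha_n^n-1}\,T_n,\qquad k=0,1,\dots,n$$ (read as $t_k=kT_n/n$ if $\alpha_n=1$), the step sizes $\delta_k=t_k-t_{k-1}$, and the two processes $$Y_0=0,\quad Y_k=Y_{k-1}+\delta_kX+\sqrt{\delta_k}\,N_k,\qquad Z_0=0,\quad Z_k=Z_{k-1}+\delta_kf_k(Z_{k-1})+\sqrt{\delta_k}\,\tilde N_k\qquad(1\le k\le n),$$ where $N_1,N_2,\dots$ are independent standard Gaussian vectors in $\mathbb{R}^d$ that are independent of $X$, $\tilde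 N_1,\tilde N_2,\dots$ are independent standard Gaussian vectors, and $f_k$ is the conditional mean estimator of $X$ given $Y_{k-1}$, i.e. $f_k$ is measurable and $f_k(Y_{k-1})=\mathbb{E}[X\mid Y_{k-1}]$ almost surely. Let $$\Delta_n=D\big(\mathsf{Law}(Y_1,\dots,Y_n)\,\|\,\mathsf{Law}(Z_1,\dots,Z_n)\big).$$ (The data are meaningful for all sufficiently large $n$, which is all that matters below.) Then $I(s)<\infty$ for every $s\ge0$ and, as $n\to\infty$, $$\Delta_n\le\frac{\log(T_n)\,I(T_n)}{n}\,(1+o(1))\qquad\text{and}\qquad \Delta_n\le\frac{d\,(\log T_n)^2}{2n}\,(1+o(1)).$$ -/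

import Mathlib

open MeasureTheory ProbabilityTheory InformationTheory Filter Topology
open scoped ENNReal

noncomputable section

/-- The mutual information `I(X; Y) = D(Law(X, Y) ‖ Law(X) ⊗ Law(Y))` (in nats). -/
def mutualInfo {Ω A B : Type*} [MeasurableSpace Ω] [MeasurableSpace A] [MeasurableSpace B]
    (P : Measure Ω) (X : Ω → A) (Y : Ω → B) : ℝ≥0∞ :=
  klDiv (P.map fun ω ↦ (X ω, Y ω)) ((P.map X).prod (P.map Y))

/-- The function `I(s) = I(X; √s X + N)`, where `X ∼ μ` and `N ∼ N(0, Id)` are independent,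
realized on the product space. -/
def gaussianChannelInfo {d : ℕ} (μ : Measure (EuclideanSpace ℝ (Fin d))) (s : ℝ) : ℝ≥0∞ :=
  mutualInfo (μ.prod (stdGaussian (EuclideanSpace ℝ (Fin d))))
    (fun p ↦ p.1) (fun p ↦ Real.sqrt s • p.1 + p.2)

/-- The time points `t_k = (α ^ k - 1) / (α ^ n - 1) * T`, understood as the uniform grid
`t_k = k T / n` for `α = 1`. -/
def gridTime (α T : ℝ) (n k : ℕ) : ℝ :=
  if α = 1 then (k : ℝ) / (n : ℝ) * T else (α ^ k - 1) / (α ^ n - 1) * T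

/-- The step sizes `δ_k = t_k - t_{k-1}`, for `k ≥ 1`. -/
def gridStep (α T : ℝ) (n k : ℕ) : ℝ :=
  gridTime α T n k - gridTime α T n (k - 1)

/-- The comparison process: `Y_0 = 0`, `Y_k = Y_{k-1} + δ_k X + √δ_k N_k`. -/
def comparisonProcess {Ω : Type*} {d : ℕ} (δ : ℕ → ℝ) (X : Ω → EuclideanSpace ℝ (Fin d))
    (N : ℕ → Ω → EuclideanSpace ℝ (Fin d)) : ℕ → Ω → EuclideanSpace ℝ (Fin d)
  | 0, _ => 0
  | k + 1, ω => comparisonProcess δ X N k ω + δ (k + 1) • X ω + Real.sqrt (δ (k + 1)) • N (k + 1) ω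

/-- The sampling process: `Z_0 = 0`, `Z_k = Z_{k-1} + δ_k f_k(Z_{k-1}) + √δ_k N_k`. -/
def samplingProcess {Ω : Type*} {d : ℕ} (δ : ℕ → ℝ)
    (f : ℕ → EuclideanSpace ℝ (Fin d) → EuclideanSpace ℝ (Fin d))
    (N : ℕ → Ω → EuclideanSpace ℝ (Fin d)) : ℕ → Ω → EuclideanSpace ℝ (Fin d)
  | 0, _ => 0
  | k + 1, ω => samplingProcess δ f N k ω + δ (k + 1) • f (k + 1) (samplingProcess δ f N k ω)
      + Real.sqrt (δ (k + 1)) • N (k + 1) ω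

/-- The law of `(V_1, …, V_n)` for a process `V`. -/
def pathLaw {Ω : Type*} [MeasurableSpace Ω] {d : ℕ} (P : Measure Ω)
    (V : ℕ → Ω → EuclideanSpace ℝ (Fin d)) (n : ℕ) :
    Measure (Fin n → EuclideanSpace ℝ (Fin d)) :=
  P.map fun ω i ↦ V (i.val + 1) ω

/-- `g` is a conditional mean estimator of `X` given `Y`: a measurable function with
`g(Y) = E[X | Y]` almost surely. -/
def IsCondMeanEstimator {Ω : Type*} [MeasurableSpace Ω] {d : ℕ} (P : Measure Ω)
    (X Y : Ω → EuclideanSpace ℝ (Fin d))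
    (g : EuclideanSpace ℝ (Fin d) → EuclideanSpace ℝ (Fin d)) : Prop :=
  Measurable g ∧
    (fun ω ↦ g (Y ω)) =ᵐ[P] P[X | MeasurableSpace.comap Y inferInstance]

end

/-! Let Y_t = tX + B_t with B Brownian, M = E‖X‖², let h(t) be the relative entropy of Y_t with
respect to N(0, t Id) (`mixEntropy`), and F(t) = E‖E[X | Y_t]‖² (`mixFisher`). The minimal mean
square error at time t is mmse(t) = M - F(t), and I(t) = tM/2 - h(t) (`gaussianChannelInfo_eq`).
Relative to the driftless Gaussian path, the comparison path has a density that depends on its end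
point only, while the sampling path has a product of one-step Cameron-Martin factors. Hence Δ_n =
h(T) - ∑ (δ_k/2) F(t_{k-1}) (`klDiv_pathLaw`): Δ_n is a left Riemann sum of mmse/2 minus I(T).

The I-MMSE relation h' = F/2 is needed only as the one-sided bounds (s/2) F(a) ≤ h(a+s) - h(a) ≤
(s/2) F(a+s) (`add_mul_mixFisher_le_mixEntropy`, `mixEntropy_le_add_mul_mixFisher`). For bounded X,
conditioning on Y_a reduces to a = 0 with the posterior as prior. There the lower bound is Gibbs'
inequality against the Gaussian shift with the same mean, and the upper bound is entropy ≤ χ², with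
an O(s²) error that disappears under subdivision because F is monotone. Truncation to balls removes
boundedness.

On a geometric grid δ_{k+1} = α δ_k, so (δ_{k+1}/2) mmse(t_k) ≤ α (I(t_k) - I(t_{k-1})). Summing,
Δ_n ≤ (α-1) I(T) + (δ_1/2) mmse(0) (`mixEntropy_gridTime_le`). For large n, α - 1 ∼ log T / n and
δ_1 = (α-1) T / (T log T - 1), so the last term is negligible: either mmse(0) = 0, or I(T) ≥ I(1) >
0. This gives the first bound. The second adds I(T) ≤ I(1) + (d/2) log T
(`toReal_gaussianChannelInfo_le`), a consequence of mmse(s) ≤ d/s. -/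

set_option linter.unusedSectionVars false

/-! ### Gaussian measures N(0, s Id) and the Cameron-Martin shift. -/

section ScaledGaussian

open scoped RealInnerProductSpace

/-- The Gaussian measure `N(0, s Id)` on a Euclidean space. -/
noncomputable def scaledGaussian (E : Type*) [NormedAddCommGroup E] [InnerProductSpace ℝ E]
    [FiniteDimensional ℝ E] [MeasurableSpace E] (s : ℝ) : Measure E :=
  (stdGaussian E).map (fun z ↦ √s • z)

variable {E : Type*} [NormedAddCommGroup E] [InnerProductSpace ℝ E]

/-- The density of `N(s x, s Id)` with respect to `N(0, s Id)`. -/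
noncomputable def shiftDensity (s : ℝ) (x y : E) : ℝ :=
  Real.exp (⟪x, y⟫ - s / 2 * ‖x‖ ^ 2)

lemma shiftDensity_pos (s : ℝ) (x y : E) : 0 < shiftDensity s x y := Real.exp_pos _

lemma continuous_shiftDensity (s : ℝ) : Continuous (fun p : E × E ↦ shiftDensity s p.1 p.2) := by
  unfold shiftDensity; fun_prop

variable [FiniteDimensional ℝ E] [MeasurableSpace E] [BorelSpace E]

instance (s : ℝ) : IsProbabilityMeasure (scaledGaussian E s) :=
  Measure.isProbabilityMeasure_map (by fun_prop)

@[fun_prop]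
lemma Measurable.shiftDensity {Ω : Type*} [MeasurableSpace Ω] {f g : Ω → E} (s : ℝ)
    (hf : Measurable f) (hg : Measurable g) : Measurable (fun ω ↦ shiftDensity s (f ω) (g ω)) :=
  (continuous_shiftDensity s).measurable.comp (hf.prodMk hg)

/-- Fernique's theorem gives a Gaussian exponential moment with some a > 0, and completing the
square yields c‖z‖ ≤ c²/(4a) + a‖z‖². -/
lemma integrable_exp_mul_norm_stdGaussian (c : ℝ) :
    Integrable (fun z ↦ Real.exp (c * ‖z‖)) (stdGaussian E) := by
  obtain ⟨a, ha, h⟩ := IsGaussian.exists_integrable_exp_sq (stdGaussian E)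
  refine (h.const_mul (Real.exp (c ^ 2 / (4 * a)))).mono' (by fun_prop) (.of_forall fun z ↦ ?_)
  rw [Real.norm_eq_abs, abs_of_pos (Real.exp_pos _), ← Real.exp_add]
  refine Real.exp_le_exp.2 ?_
  have : 0 ≤ (c / (2 * a) - ‖z‖) ^ 2 * a := by positivity
  have h2 : (c / (2 * a) - ‖z‖) ^ 2 * a = c ^ 2 / (4 * a) + a * ‖z‖ ^ 2 - c * ‖z‖ := by
    field_simp; ring
  linarith

lemma integrable_exp_mul_norm_scaledGaussian (c s : ℝ) :
    Integrable (fun z ↦ Real.exp (c * ‖z‖)) (scaledGaussian E s) := by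
  rw [scaledGaussian, integrable_map_measure (by fun_prop) (by fun_prop)]
  refine (integrable_exp_mul_norm_stdGaussian (c * √s)).congr (.of_forall fun z ↦ ?_)
  simp [norm_smul, mul_assoc, abs_of_nonneg (Real.sqrt_nonneg s)]

/-- In an orthonormal basis the integrand factorizes into one-dimensional complex moment generating
functions at ⟪x, b i⟫ + i⟪b i, t⟫. This single formula supplies both characteristic functions in the
Cameron-Martin theorem. -/
lemma integral_cexp_stdGaussian (x t : E) :
    ∫ y, Complex.exp (⟪x, y⟫ + ⟪y, t⟫ * Complex.I) ∂(stdGaussian E)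
      = Complex.exp (‖x‖ ^ 2 / 2 - ‖t‖ ^ 2 / 2 + ⟪x, t⟫ * Complex.I) := by
  rw [stdGaussian, integral_map (Measurable.aemeasurable (by fun_prop))
    (Measurable.aestronglyMeasurable (by fun_prop))]
  set b := stdOrthonormalBasis ℝ E
  have key (u : Fin (Module.finrank ℝ E) → ℝ) :
      Complex.exp (⟪x, ∑ i, u i • b i⟫ + ⟪∑ i, u i • b i, t⟫ * Complex.I)
      = ∏ i, Complex.exp (((⟪x, b i⟫ : ℂ) + ⟪b i, t⟫ * Complex.I) * (u i : ℝ)) := by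
    rw [← Complex.exp_sum]
    congr 1
    simp_rw [sum_inner, inner_sum, inner_smul_left, inner_smul_right]
    push_cast
    rw [Finset.sum_mul, ← Finset.sum_add_distrib]
    refine Finset.sum_congr rfl fun i _ ↦ ?_
    simp; ring
  simp_rw [key]
  rw [integral_fintype_prod_eq_prod
    (f := fun i (v : ℝ) ↦ Complex.exp (((⟪x, b i⟫ : ℂ) + ⟪b i, t⟫ * Complex.I) * v))]
  have h1 (z : ℂ) : ∫ v : ℝ, Complex.exp (z * v) ∂(gaussianReal 0 1) = Complex.exp (z ^ 2 / 2) := by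
    have := complexMGF_id_gaussianReal (μ := 0) (v := 1) z
    simpa [complexMGF] using this
  simp_rw [h1]
  rw [← Complex.exp_sum]
  congr 1
  have e1 : (‖x‖ : ℂ) ^ 2 = ∑ i, (⟪x, b i⟫ : ℂ) ^ 2 := by
    have := b.sum_sq_inner_left x
    exact_mod_cast this.symm
  have e2 : (‖t‖ : ℂ) ^ 2 = ∑ i, (⟪b i, t⟫ : ℂ) ^ 2 := by
    have := b.sum_sq_inner_right t
    exact_mod_cast this.symm
  have e3 : (⟪x, t⟫ : ℂ) = ∑ i, (⟪x, b i⟫ : ℂ) * ⟪b i, t⟫ := by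
    have := b.sum_inner_mul_inner x t
    exact_mod_cast this.symm
  rw [e1, e2, e3, Finset.sum_div, Finset.sum_div, Finset.sum_mul, ← Finset.sum_sub_distrib,
    ← Finset.sum_add_distrib]
  refine Finset.sum_congr rfl fun i _ ↦ ?_
  linear_combination (⟪b i, t⟫ : ℂ) ^ 2 / 2 * Complex.I_sq

lemma integrable_exp_inner_stdGaussian (x : E) :
    Integrable (fun y ↦ Real.exp ⟪x, y⟫) (stdGaussian E) :=
  (integrable_exp_mul_norm_stdGaussian ‖x‖).mono' (by fun_prop) (.of_forall fun y ↦ by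
    rw [Real.norm_eq_abs, abs_of_pos (Real.exp_pos _)]
    exact Real.exp_le_exp.2 (real_inner_le_norm x y))

/-- The Cameron-Martin formula for the standard Gaussian measure. -/
lemma stdGaussian_map_add_eq_withDensity (x : E) :
    (stdGaussian E).map (fun y ↦ x + y)
      = (stdGaussian E).withDensity (fun y ↦ ENNReal.ofReal (shiftDensity 1 x y)) := by
  have hint : Integrable (fun y ↦ shiftDensity 1 x y) (stdGaussian E) := by
    simp_rw [shiftDensity, Real.exp_sub]
    exact (integrable_exp_inner_stdGaussian x).div_const _
  have := isFiniteMeasure_withDensity_ofReal hint.2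
  have : IsProbabilityMeasure ((stdGaussian E).map (fun y ↦ x + y)) :=
    Measure.isProbabilityMeasure_map (by fun_prop)
  refine Measure.ext_of_charFun (funext fun t ↦ ?_)
  rw [charFun_apply, charFun_apply, integral_map (by fun_prop)
    (Measurable.aestronglyMeasurable (by fun_prop)),
    integral_withDensity_eq_integral_toReal_smul (by fun_prop) (by simp)]
  -- The shifted side needs the formula at 0, the tilted side needs it at `x`.
  have h0 := integral_cexp_stdGaussian (0 : E) t
  have h1 := integral_cexp_stdGaussian x t
  have l : ∫ y, Complex.exp (⟪x + y, t⟫ * Complex.I) ∂(stdGaussian E)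
      = Complex.exp (⟪x, t⟫ * Complex.I) * Complex.exp (- ‖t‖ ^ 2 / 2) := by
    have : Complex.exp (- ‖t‖ ^ 2 / 2)
      = ∫ y, Complex.exp (⟪(0 : E), y⟫ + ⟪y, t⟫ * Complex.I) ∂(stdGaussian E) := by
      rw [h0]; congr 1; simp; ring
    rw [this, ← integral_const_mul]
    congr 1; ext y
    rw [← Complex.exp_add, inner_add_left]; congr 1; simp; ring
  rw [l]
  have r (y : E) : (ENNReal.ofReal (shiftDensity 1 x y)).toReal • Complex.exp (⟪y, t⟫ * Complex.I)
      = Complex.exp (- ‖x‖ ^ 2 / 2) * Complex.exp (⟪x, y⟫ + ⟪y, t⟫ * Complex.I) := by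
    rw [ENNReal.toReal_ofReal (shiftDensity_pos _ _ _).le, shiftDensity, Complex.real_smul]
    push_cast
    rw [← Complex.exp_add, ← Complex.exp_add]; congr 1; ring
  simp_rw [r]
  rw [integral_const_mul, h1, ← Complex.exp_add, ← Complex.exp_add]
  congr 1; ring

lemma lintegral_stdGaussian_mul_shiftDensity {F : E → ℝ≥0∞} (hF : Measurable F) (x : E) :
    ∫⁻ y, F y * ENNReal.ofReal (shiftDensity 1 x y) ∂(stdGaussian E)
      = ∫⁻ y, F (x + y) ∂(stdGaussian E) := by
  rw [← lintegral_map hF (by fun_prop : Measurable fun y ↦ x + y),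
    stdGaussian_map_add_eq_withDensity, lintegral_withDensity_eq_lintegral_mul _ (by fun_prop) hF]
  simp [mul_comm]

/-- Cameron-Martin for the shift `√s • x`, rescaled by √s. The degenerate case s = 0 is covered,
both sides then being `F 0`. -/
lemma lintegral_stdGaussian_mul_shiftDensity_sqrt {s : ℝ} (hs : 0 ≤ s) {F : E → ℝ≥0∞}
    (hF : Measurable F) (x : E) :
    ∫⁻ z, F (√s • z) * ENNReal.ofReal (shiftDensity s x (√s • z)) ∂(stdGaussian E)
      = ∫⁻ z, F (s • x + √s • z) ∂(stdGaussian E) := by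
  have h := lintegral_stdGaussian_mul_shiftDensity
    (F := fun z ↦ F (√s • z)) (by fun_prop) (√s • x)
  simp only [smul_add, smul_smul, Real.mul_self_sqrt hs] at h
  rw [← h]
  have (z : E) : shiftDensity s x (√s • z) = shiftDensity 1 (√s • x) z := by
    simp only [inner_smul_left, inner_smul_right, norm_smul, mul_pow, Real.norm_eq_abs, sq_abs,
      Real.sq_sqrt hs, RCLike.conj_to_real, shiftDensity]
    ring_nf
  simp_rw [this]

lemma lintegral_scaledGaussian_mul_shiftDensity {s : ℝ} (hs : 0 ≤ s) {F : E → ℝ≥0∞}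
    (hF : Measurable F) (x : E) :
    ∫⁻ y, F y * ENNReal.ofReal (shiftDensity s x y) ∂(scaledGaussian E s)
      = ∫⁻ y, F (s • x + y) ∂(scaledGaussian E s) := by
  rw [scaledGaussian, lintegral_map (by fun_prop) (by fun_prop),
    lintegral_map (by fun_prop) (by fun_prop), lintegral_stdGaussian_mul_shiftDensity_sqrt hs hF]

lemma scaledGaussian_map_add_eq_withDensity {s : ℝ} (hs : 0 ≤ s) (x : E) :
    (scaledGaussian E s).map (fun y ↦ s • x + y)
      = (scaledGaussian E s).withDensity (fun y ↦ ENNReal.ofReal (shiftDensity s x y)) := by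
  ext A hA
  rw [withDensity_apply _ hA, ← lintegral_indicator_one hA, lintegral_map
    (measurable_one.indicator hA) (by fun_prop),
    ← lintegral_scaledGaussian_mul_shiftDensity hs (measurable_one.indicator hA),
    ← lintegral_indicator hA]
  congr 1; ext y; by_cases h : y ∈ A <;> simp [h]

lemma integral_scaledGaussian_shiftDensity_smul {s : ℝ} (hs : 0 ≤ s) {G : Type*}
    [NormedAddCommGroup G] [NormedSpace ℝ G] {F : E → G}
    (hF : StronglyMeasurable F) (x : E) :
    ∫ y, shiftDensity s x y • F y ∂(scaledGaussian E s)
      = ∫ y, F (s • x + y) ∂(scaledGaussian E s) := by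
  rw [← integral_map (by fun_prop) hF.aestronglyMeasurable (φ := fun y ↦ s • x + y),
    scaledGaussian_map_add_eq_withDensity hs,
    integral_withDensity_eq_integral_toReal_smul (by fun_prop) (by simp)]
  simp_rw [ENNReal.toReal_ofReal (shiftDensity_pos _ _ _).le]

lemma integrable_scaledGaussian_shiftDensity_smul {s : ℝ} (hs : 0 ≤ s) {G : Type*}
    [NormedAddCommGroup G] [NormedSpace ℝ G] {F : E → G}
    (hF : StronglyMeasurable F) (x : E) :
    Integrable (fun y ↦ shiftDensity s x y • F y) (scaledGaussian E s)
      ↔ Integrable (fun y ↦ F (s • x + y)) (scaledGaussian E s) := by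
  rw [← Function.comp_def, ← integrable_map_measure hF.aestronglyMeasurable (by fun_prop),
    scaledGaussian_map_add_eq_withDensity hs,
    integrable_withDensity_iff_integrable_smul₀' (by fun_prop) (by simp)]
  simp_rw [ENNReal.toReal_ofReal (shiftDensity_pos _ _ _).le]

lemma charFun_scaledGaussian {s : ℝ} (hs : 0 ≤ s) (t : E) :
    charFun (scaledGaussian E s) t = Complex.exp (- (s * ‖t‖ ^ 2) / 2) := by
  rw [scaledGaussian, charFun_map_smul, charFun_stdGaussian, norm_smul, Real.norm_eq_abs]
  congr 2
  push_cast
  rw [mul_pow]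
  congr 2
  have : |√s| ^ 2 = s := by rw [sq_abs, Real.sq_sqrt hs]
  exact_mod_cast this

/-- Brownian increments: this splits observation up to time a + b into an earlier and an independent
later part. -/
lemma scaledGaussian_conv {a b : ℝ} (ha : 0 ≤ a) (hb : 0 ≤ b) :
    (scaledGaussian E a) ∗ (scaledGaussian E b) = scaledGaussian E (a + b) := by
  refine Measure.ext_of_charFun (funext fun t ↦ ?_)
  rw [charFun_conv, charFun_scaledGaussian ha, charFun_scaledGaussian hb,
    charFun_scaledGaussian (add_nonneg ha hb), ← Complex.exp_add]
  congr 1; push_cast; ring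

@[simp]
lemma scaledGaussian_zero : scaledGaussian E 0 = Measure.dirac 0 := by
  simp [scaledGaussian, Measure.map_const]

lemma memLp_two_id_scaledGaussian (s : ℝ) : MemLp id 2 (scaledGaussian E s) := by
  rw [scaledGaussian, memLp_map_measure_iff (by fun_prop) (by fun_prop)]
  exact (IsGaussian.memLp_two_id (μ := stdGaussian E)).const_smul (√s)

lemma integrable_id_scaledGaussian (s : ℝ) : Integrable (fun y ↦ y) (scaledGaussian E s) :=
  (memLp_two_id_scaledGaussian s).integrable (by norm_num)

lemma integrable_norm_sq_scaledGaussian (s : ℝ) :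
    Integrable (fun y ↦ ‖y‖ ^ 2) (scaledGaussian E s) :=
  (memLp_two_iff_integrable_sq_norm (by fun_prop)).1 (memLp_two_id_scaledGaussian s)

@[simp]
lemma integral_id_scaledGaussian (s : ℝ) : ∫ y, y ∂(scaledGaussian E s) = 0 := by
  rw [scaledGaussian, integral_map (by fun_prop) (by fun_prop), integral_smul,
    integral_id_stdGaussian, smul_zero]

lemma integral_norm_sq_stdGaussian :
    ∫ y, ‖y‖ ^ 2 ∂(stdGaussian E) = Module.finrank ℝ E := by
  set b := stdOrthonormalBasis ℝ E
  simp_rw [← b.sum_sq_inner_right]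
  have h (i) : ∫ y, ⟪b i, y⟫ ^ 2 ∂(stdGaussian E) = 1 := by
    have h1 := variance_dual_stdGaussian (innerSL ℝ (b i))
    rw [variance_of_integral_eq_zero (by fun_prop) (integral_strongDual_stdGaussian _)] at h1
    simpa using h1
  rw [integral_finsetSum]
  · simp [h]
  · intro i _
    refine (IsGaussian.memLp_two_id (μ := stdGaussian E)).norm.integrable_sq.mono' (by fun_prop)
      (.of_forall fun y ↦ ?_)
    have := abs_real_inner_le_norm (b i) y
    simp only [b.norm_eq_one, one_mul] at this
    simpa using pow_le_pow_left₀ (abs_nonneg _) this 2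

lemma integral_norm_sq_scaledGaussian {s : ℝ} (hs : 0 ≤ s) :
    ∫ y, ‖y‖ ^ 2 ∂(scaledGaussian E s) = s * Module.finrank ℝ E := by
  rw [scaledGaussian, integral_map (by fun_prop) (by fun_prop)]
  simp_rw [norm_smul, mul_pow, Real.norm_eq_abs, sq_abs, Real.sq_sqrt hs]
  rw [integral_const_mul, integral_norm_sq_stdGaussian]

end ScaledGaussian

/-! ### Density, entropy and Fisher information of Gaussian mixtures. -/

section GaussianMixture

open scoped RealInnerProductSpace

variable {E : Type*} [NormedAddCommGroup E] [InnerProductSpace ℝ E]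

/-- The exponent is additive in time and in the increment, so successive observations of the same x
combine into one. Both the Markov property of posteriors and the end-point form of the path density
rest on this. -/
lemma shiftDensity_mul_shiftDensity (a b : ℝ) (x y w : E) :
    shiftDensity a x y * shiftDensity b x w = shiftDensity (a + b) x (y + w) := by
  rw [shiftDensity, shiftDensity, shiftDensity, ← Real.exp_add, inner_add_right]
  congr 1; ring

/-- Completing the square: the dependence on w is again a Cameron-Martin density, so it integrates
to one and leaves the exponential of s⟪x - u, x' - u⟫. This makes the χ² computation explicit. -/
lemma shiftDensity_mul_div (s : ℝ) (x x' u w : E) :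
    shiftDensity s x w * shiftDensity s x' w / shiftDensity s u w
      = Real.exp (s * ⟪x - u, x' - u⟫) * shiftDensity s (x + x' - u) w := by
  simp only [shiftDensity]
  rw [← Real.exp_add, ← Real.exp_sub, ← Real.exp_add]
  congr 1
  simp only [← real_inner_self_eq_norm_sq, inner_add_left, inner_add_right, inner_sub_left,
    inner_sub_right, real_inner_comm x x', real_inner_comm x u, real_inner_comm x' u]
  ring

lemma shiftDensity_le_exp {s : ℝ} (hs : 0 ≤ s) {R : ℝ} {x : E} (hx : ‖x‖ ≤ R) (y : E) :
    shiftDensity s x y ≤ Real.exp (R * ‖y‖) := by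
  refine Real.exp_le_exp.2 ?_
  have h1 := real_inner_le_norm x y
  have h2 := mul_le_mul_of_nonneg_right hx (norm_nonneg y)
  have h3 : 0 ≤ s / 2 * ‖x‖ ^ 2 := by positivity
  linarith

lemma exp_le_shiftDensity {s : ℝ} (hs : 0 ≤ s) {R : ℝ} {x : E} (hx : ‖x‖ ≤ R) (y : E) :
    Real.exp (-(R * ‖y‖ + s / 2 * R ^ 2)) ≤ shiftDensity s x y := by
  refine Real.exp_le_exp.2 ?_
  have h1 := neg_le_of_abs_le (abs_real_inner_le_norm x y)
  have h2 := mul_le_mul_of_nonneg_right hx (norm_nonneg y)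
  have h3 : s / 2 * ‖x‖ ^ 2 ≤ s / 2 * R ^ 2 := by gcongr
  linarith

variable [MeasurableSpace E]

/-- The density of the law of `s X + √s N` with respect to `N(0, s Id)`, where `X ∼ μ` is
independent of the standard Gaussian `N`. -/
noncomputable def mixDensity (μ : Measure E) (s : ℝ) (y : E) : ℝ :=
  ∫ x, shiftDensity s x y ∂μ

/-- The gradient of `mixDensity μ s`. -/
noncomputable def mixGradient (μ : Measure E) (s : ℝ) (y : E) : E :=
  ∫ x, shiftDensity s x y • x ∂μ

variable [FiniteDimensional ℝ E] [BorelSpace E]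

/-- The relative entropy of the law of `s X + √s N` with respect to `N(0, s Id)`. -/
noncomputable def mixEntropy (μ : Measure E) (s : ℝ) : ℝ :=
  ∫ y, mixDensity μ s y * Real.log (mixDensity μ s y) ∂(scaledGaussian E s)

/-- The relative Fisher information of the law of `s X + √s N` with respect to `N(0, s Id)`. -/
noncomputable def mixFisher (μ : Measure E) (s : ℝ) : ℝ :=
  ∫ y, ‖mixGradient μ s y‖ ^ 2 / mixDensity μ s y ∂(scaledGaussian E s)

lemma measurable_mixDensity (μ : Measure E) [SFinite μ] (s : ℝ) :
    Measurable (mixDensity μ s) :=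
  (StronglyMeasurable.integral_prod_left (f := fun x y ↦ shiftDensity s x y)
    (by exact (continuous_shiftDensity s).measurable.stronglyMeasurable)).measurable

lemma stronglyMeasurable_mixGradient (μ : Measure E) [SFinite μ] (s : ℝ) :
    StronglyMeasurable (mixGradient μ s) :=
  StronglyMeasurable.integral_prod_left (f := fun x y ↦ shiftDensity s x y • x)
    (by exact ((continuous_shiftDensity s).smul continuous_fst).measurable.stronglyMeasurable)

lemma measurable_mixGradient (μ : Measure E) [SFinite μ] (s : ℝ) :
    Measurable (mixGradient μ s) :=
  (stronglyMeasurable_mixGradient μ s).measurable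

lemma integrable_shiftDensity_prod (μ : Measure E) [IsFiniteMeasure μ] {s : ℝ} (hs : 0 ≤ s) :
    Integrable (fun p : E × E ↦ shiftDensity s p.1 p.2) (μ.prod (scaledGaussian E s)) := by
  have h (x : E) : Integrable (fun y ↦ shiftDensity s x y • (1 : ℝ)) (scaledGaussian E s) :=
    (integrable_scaledGaussian_shiftDensity_smul hs stronglyMeasurable_const x).2
      (integrable_const _)
  have h1 (x : E) : ∫ y, ‖shiftDensity s x y‖ ∂(scaledGaussian E s) = 1 := by
    have := integral_scaledGaussian_shiftDensity_smul hs
      (stronglyMeasurable_const (b := (1 : ℝ))) x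
    simpa [abs_of_pos (shiftDensity_pos s x _)] using this
  refine (integrable_prod_iff (by fun_prop)).2 ⟨.of_forall fun x ↦ by simpa using h x, ?_⟩
  simp_rw [h1]
  exact integrable_const _

/-- Bayes' formula: integrating against the joint law of `X` and `s X + √s N`. -/
lemma integrable_prod_shiftDensity_smul_iff (μ : Measure E) [IsFiniteMeasure μ] {s : ℝ}
    (hs : 0 ≤ s) {G : Type*} [NormedAddCommGroup G] [NormedSpace ℝ G] {F : E × E → G}
    (hF : StronglyMeasurable F) :
    Integrable (fun p ↦ shiftDensity s p.1 p.2 • F p) (μ.prod (scaledGaussian E s))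
      ↔ Integrable (fun p ↦ F (p.1, s • p.1 + p.2)) (μ.prod (scaledGaussian E s)) := by
  have m1 : StronglyMeasurable (fun p : E × E ↦ shiftDensity s p.1 p.2 • F p) :=
    (continuous_shiftDensity s).stronglyMeasurable.smul hF
  have m2 : StronglyMeasurable (fun p : E × E ↦ F (p.1, s • p.1 + p.2)) :=
    hF.comp_measurable (by fun_prop)
  rw [integrable_prod_iff m1.aestronglyMeasurable, integrable_prod_iff m2.aestronglyMeasurable]
  have hx (x : E) : StronglyMeasurable (fun y ↦ F (x, y)) := hF.comp_measurable (by fun_prop)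
  simp_rw [fun x ↦ integrable_scaledGaussian_shiftDensity_smul hs (hx x) x]
  have h2 (x : E) := integral_scaledGaussian_shiftDensity_smul hs (hx x).norm x
  simp_rw [norm_smul, Real.norm_eq_abs, abs_of_pos (shiftDensity_pos s _ _)]
  simp_rw [smul_eq_mul] at h2
  simp_rw [h2]

lemma integral_prod_shiftDensity_smul (μ : Measure E) [IsFiniteMeasure μ] {s : ℝ}
    (hs : 0 ≤ s) {G : Type*} [NormedAddCommGroup G] [NormedSpace ℝ G]
    {F : E × E → G} (hF : StronglyMeasurable F)
    (h : Integrable (fun p ↦ F (p.1, s • p.1 + p.2)) (μ.prod (scaledGaussian E s))) :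
    ∫ p, shiftDensity s p.1 p.2 • F p ∂(μ.prod (scaledGaussian E s))
      = ∫ p, F (p.1, s • p.1 + p.2) ∂(μ.prod (scaledGaussian E s)) := by
  rw [integral_prod _ ((integrable_prod_shiftDensity_smul_iff μ hs hF).2 h), integral_prod _ h]
  congr 1; ext x
  exact integral_scaledGaussian_shiftDensity_smul hs (hF.comp_measurable (by fun_prop)) x

lemma integrable_mixDensity (μ : Measure E) [IsFiniteMeasure μ] {s : ℝ} (hs : 0 ≤ s) :
    Integrable (mixDensity μ s) (scaledGaussian E s) :=
  (integrable_shiftDensity_prod μ hs).integral_prod_right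

lemma integral_mixDensity (μ : Measure E) [IsFiniteMeasure μ] {s : ℝ} (hs : 0 ≤ s) :
    ∫ y, mixDensity μ s y ∂(scaledGaussian E s) = μ.real Set.univ := by
  unfold mixDensity
  rw [← integral_prod_symm _ (integrable_shiftDensity_prod μ hs)]
  have := integral_prod_shiftDensity_smul μ hs (F := fun _ ↦ (1 : ℝ)) stronglyMeasurable_const
    (integrable_const _)
  simpa [← Set.univ_prod_univ, measureReal_prod_prod] using this

/-- The integrals of the gradient of the density against a vector field. -/
lemma integrable_mixGradient (μ : Measure E) [IsFiniteMeasure μ] {s : ℝ} (hs : 0 ≤ s)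
    (hμ : Integrable (fun x ↦ x) μ) :
    Integrable (fun p : E × E ↦ shiftDensity s p.1 p.2 • p.1) (μ.prod (scaledGaussian E s)) :=
  (integrable_prod_shiftDensity_smul_iff μ hs (F := fun p ↦ p.1)
    measurable_fst.stronglyMeasurable).2 (hμ.comp_fst _)

lemma integral_mixGradient (μ : Measure E) [IsFiniteMeasure μ] {s : ℝ} (hs : 0 ≤ s)
    (hμ : Integrable (fun x ↦ x) μ) :
    ∫ y, mixGradient μ s y ∂(scaledGaussian E s) = ∫ x, x ∂μ := by
  unfold mixGradient
  rw [← integral_prod_symm _ (integrable_mixGradient μ hs hμ)]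
  rw [integral_prod_shiftDensity_smul μ hs (F := fun p ↦ p.1)
    measurable_fst.stronglyMeasurable (hμ.comp_fst _)]
  exact (integral_fun_fst (fun x ↦ x)).trans (by simp)

lemma integrable_shiftDensity_mul_inner (μ : Measure E) [IsFiniteMeasure μ] {s : ℝ} (hs : 0 ≤ s)
    (hμ : Integrable (fun x ↦ x) μ) (u : E) :
    Integrable (fun p : E × E ↦ shiftDensity s p.1 p.2 • ⟪u, p.2⟫)
      (μ.prod (scaledGaussian E s)) := by
  refine (integrable_prod_shiftDensity_smul_iff μ hs (F := fun p ↦ ⟪u, p.2⟫)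
    (by fun_prop)).2 ?_
  exact (((hμ.comp_fst _).smul s).add ((integrable_id_scaledGaussian s).comp_snd _)).const_inner u

/-- Under the mixture, y is s x plus centred noise, so only s times the mean survives. -/
lemma integral_inner_mul_mixDensity (μ : Measure E) [IsFiniteMeasure μ] {s : ℝ} (hs : 0 ≤ s)
    (hμ : Integrable (fun x ↦ x) μ) (u : E) :
    ∫ y, mixDensity μ s y * ⟪u, y⟫ ∂(scaledGaussian E s) = s * ⟪u, ∫ x, x ∂μ⟫ := by
  have hi := ((hμ.comp_fst (scaledGaussian E s)).smul s).add
    ((integrable_id_scaledGaussian s).comp_snd μ)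
  have h := integral_prod_shiftDensity_smul μ hs (F := fun p ↦ ⟪u, p.2⟫) (by fun_prop)
    (hi.const_inner u)
  rw [integral_prod_symm _ (integrable_shiftDensity_mul_inner μ hs hμ u)] at h
  simp_rw [smul_eq_mul, integral_mul_const] at h
  unfold mixDensity
  rw [h]
  have := integral_inner (𝕜 := ℝ) hi u
  simp only [Pi.add_apply, Pi.smul_apply] at this
  have hsum : ∫ p : E × E, s • p.1 + p.2 ∂(μ.prod (scaledGaussian E s)) = s • ∫ x, x ∂μ := by
    rw [integral_add (f := fun p : E × E ↦ s • p.1) ((hμ.comp_fst _).smul s)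
      ((integrable_id_scaledGaussian s).comp_snd _), integral_smul,
      integral_fun_snd (fun y ↦ y), integral_fun_fst (fun x ↦ x)]
    simp
  rw [this, hsum, inner_smul_right]

lemma integrable_inner_mul_mixDensity (μ : Measure E) [IsFiniteMeasure μ] {s : ℝ} (hs : 0 ≤ s)
    (hμ : Integrable (fun x ↦ x) μ) (u : E) :
    Integrable (fun y ↦ mixDensity μ s y * ⟪u, y⟫) (scaledGaussian E s) := by
  have h := (integrable_shiftDensity_mul_inner μ hs hμ u).integral_prod_right
  simp_rw [smul_eq_mul, integral_mul_const] at h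
  exact h

end GaussianMixture

/-! ### Bounded signals: pointwise bounds and the χ² estimate. -/

section BoundedMixture

open scoped RealInnerProductSpace

variable {E : Type*} [NormedAddCommGroup E] [InnerProductSpace ℝ E] [FiniteDimensional ℝ E]
  [MeasurableSpace E] [BorelSpace E]

lemma integrable_shiftDensity_of_bounded (μ : Measure E) [IsFiniteMeasure μ] {R : ℝ}
    (hR : ∀ᵐ x ∂μ, ‖x‖ ≤ R) {s : ℝ} (hs : 0 ≤ s) (y : E) :
    Integrable (fun x ↦ shiftDensity s x y) μ :=
  (integrable_const (Real.exp (R * ‖y‖))).mono' (by fun_prop) <| hR.mono fun x hx ↦ by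
    rw [Real.norm_eq_abs, abs_of_pos (shiftDensity_pos _ _ _)]
    exact shiftDensity_le_exp hs hx y

lemma mixDensity_le_of_bounded (μ : Measure E) [IsFiniteMeasure μ] {R : ℝ}
    (hR : ∀ᵐ x ∂μ, ‖x‖ ≤ R) {s : ℝ} (hs : 0 ≤ s) (y : E) :
    mixDensity μ s y ≤ μ.real Set.univ * Real.exp (R * ‖y‖) := by
  have := integral_mono_ae (integrable_shiftDensity_of_bounded μ hR hs y)
    (integrable_const (Real.exp (R * ‖y‖))) (hR.mono fun x hx ↦ shiftDensity_le_exp hs hx y)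
  simpa [mixDensity] using this

lemma le_mixDensity_of_bounded (μ : Measure E) [IsFiniteMeasure μ] {R : ℝ}
    (hR : ∀ᵐ x ∂μ, ‖x‖ ≤ R) {s : ℝ} (hs : 0 ≤ s) (y : E) :
    μ.real Set.univ * Real.exp (-(R * ‖y‖ + s / 2 * R ^ 2)) ≤ mixDensity μ s y := by
  have := integral_mono_ae (integrable_const (Real.exp (-(R * ‖y‖ + s / 2 * R ^ 2))))
    (integrable_shiftDensity_of_bounded μ hR hs y) (hR.mono fun x hx ↦ exp_le_shiftDensity hs hx y)
  simpa [mixDensity] using this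

lemma norm_mixGradient_le_of_bounded (μ : Measure E) [IsFiniteMeasure μ] {R : ℝ}
    (hR : ∀ᵐ x ∂μ, ‖x‖ ≤ R) {s : ℝ} (hs : 0 ≤ s) (y : E) :
    ‖mixGradient μ s y‖ ≤ R * mixDensity μ s y := by
  rw [mixDensity, ← integral_const_mul]
  refine norm_integral_le_of_norm_le
    ((integrable_shiftDensity_of_bounded μ hR hs y).const_mul _) (hR.mono fun x hx ↦ ?_)
  rw [norm_smul, Real.norm_eq_abs, abs_of_pos (shiftDensity_pos _ _ _), mul_comm]
  exact mul_le_mul_of_nonneg_right hx (shiftDensity_pos _ _ _).le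

lemma integrable_id_of_bounded (μ : Measure E) [IsFiniteMeasure μ] {R : ℝ}
    (hR : ∀ᵐ x ∂μ, ‖x‖ ≤ R) : Integrable (fun x ↦ x) μ :=
  (integrable_const R).mono' (by fun_prop) hR

lemma measureReal_univ_pos (μ : Measure E) [IsFiniteMeasure μ] [NeZero μ] :
    0 < μ.real Set.univ := by
  simp [measureReal_def, ENNReal.toReal_pos_iff, NeZero.ne μ]

lemma mixDensity_pos_of_bounded (μ : Measure E) [IsFiniteMeasure μ] [NeZero μ] {R : ℝ}
    (hR : ∀ᵐ x ∂μ, ‖x‖ ≤ R) {s : ℝ} (hs : 0 ≤ s) (y : E) : 0 < mixDensity μ s y :=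
  lt_of_lt_of_le (mul_pos (measureReal_univ_pos μ) (Real.exp_pos _))
    (le_mixDensity_of_bounded μ hR hs y)

/-- Two-sided exponential bounds on the density make its logarithm at most linear in ‖y‖. The linear
factor is absorbed into a second exp(R‖y‖), whence the rate 2R. -/
lemma abs_mixDensity_mul_log_le_of_bounded (μ : Measure E) [IsFiniteMeasure μ] [NeZero μ] {R : ℝ}
    (hR : ∀ᵐ x ∂μ, ‖x‖ ≤ R) {s : ℝ} (hs : 0 ≤ s) (y : E) :
    |mixDensity μ s y * Real.log (mixDensity μ s y)| ≤
      μ.real Set.univ * (|Real.log (μ.real Set.univ)| + s / 2 * R ^ 2 + 1)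
        * Real.exp ((2 * R) * ‖y‖) := by
  have hc := measureReal_univ_pos μ
  have hL := mixDensity_pos_of_bounded μ hR hs y
  have hR0 : 0 ≤ R := by
    obtain ⟨x, hx⟩ := hR.exists
    exact (norm_nonneg x).trans hx
  have h0 : 0 ≤ R * ‖y‖ := by positivity
  have h1 := mixDensity_le_of_bounded μ hR hs y
  have h2 := le_mixDensity_of_bounded μ hR hs y
  have l1 := Real.log_le_log hL h1
  have l2 := Real.log_le_log (by positivity) h2
  rw [Real.log_mul hc.ne' (Real.exp_pos _).ne', Real.log_exp] at l1 l2
  have h3 : 0 ≤ s / 2 * R ^ 2 := by positivity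
  have h4 : |Real.log (mixDensity μ s y)| ≤
      |Real.log (μ.real Set.univ)| + s / 2 * R ^ 2 + R * ‖y‖ := by
    rw [abs_le]
    constructor <;>
      linarith [neg_abs_le (Real.log (μ.real Set.univ)), le_abs_self (Real.log (μ.real Set.univ))]
  have h5 := Real.add_one_le_exp (R * ‖y‖)
  have h6 : |Real.log (μ.real Set.univ)| + s / 2 * R ^ 2 + R * ‖y‖
      ≤ (|Real.log (μ.real Set.univ)| + s / 2 * R ^ 2 + 1) * Real.exp (R * ‖y‖) := by
    have : 0 ≤ |Real.log (μ.real Set.univ)| + s / 2 * R ^ 2 := by positivity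
    nlinarith
  rw [abs_mul, abs_of_pos hL]
  calc _ ≤ (μ.real Set.univ * Real.exp (R * ‖y‖)) *
        ((|Real.log (μ.real Set.univ)| + s / 2 * R ^ 2 + 1) * Real.exp (R * ‖y‖)) := by
        gcongr; exact h4.trans h6
    _ = _ := by
      rw [mul_mul_mul_comm, ← Real.exp_add]; ring_nf

lemma integrable_mixDensity_mul_log_of_bounded (μ : Measure E) [IsFiniteMeasure μ] [NeZero μ]
    {R : ℝ} (hR : ∀ᵐ x ∂μ, ‖x‖ ≤ R) {s t : ℝ} (hs : 0 ≤ s) :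
    Integrable (fun y ↦ mixDensity μ s y * Real.log (mixDensity μ s y)) (scaledGaussian E t) :=
  ((integrable_exp_mul_norm_scaledGaussian (2 * R) t).const_mul _).mono'
    ((measurable_mixDensity μ s).mul (measurable_mixDensity μ s).log).aestronglyMeasurable
    (.of_forall fun y ↦ abs_mixDensity_mul_log_le_of_bounded μ hR hs y)

lemma norm_sq_mixGradient_div_le_of_bounded (μ : Measure E) [IsFiniteMeasure μ] [NeZero μ] {R : ℝ}
    (hR : ∀ᵐ x ∂μ, ‖x‖ ≤ R) {s : ℝ} (hs : 0 ≤ s) (y : E) :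
    ‖mixGradient μ s y‖ ^ 2 / mixDensity μ s y ≤ R ^ 2 * μ.real Set.univ * Real.exp (R * ‖y‖) := by
  have hL := mixDensity_pos_of_bounded μ hR hs y
  have h1 := mixDensity_le_of_bounded μ hR hs y
  have h2 := norm_mixGradient_le_of_bounded μ hR hs y
  rw [div_le_iff₀ hL]
  calc ‖mixGradient μ s y‖ ^ 2 ≤ (R * mixDensity μ s y) ^ 2 := by gcongr
    _ = R ^ 2 * mixDensity μ s y * mixDensity μ s y := by ring
    _ ≤ R ^ 2 * (μ.real Set.univ * Real.exp (R * ‖y‖)) * mixDensity μ s y := by gcongr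
    _ = _ := by ring

lemma measurable_norm_sq_mixGradient_div (μ : Measure E) [SFinite μ] (s : ℝ) :
    Measurable (fun y ↦ ‖mixGradient μ s y‖ ^ 2 / mixDensity μ s y) :=
  ((measurable_mixGradient μ s).norm.pow_const 2).div (measurable_mixDensity μ s)

lemma integrable_norm_sq_mixGradient_div_of_bounded (μ : Measure E) [IsFiniteMeasure μ] [NeZero μ]
    {R : ℝ} (hR : ∀ᵐ x ∂μ, ‖x‖ ≤ R) {s t : ℝ} (hs : 0 ≤ s) :
    Integrable (fun y ↦ ‖mixGradient μ s y‖ ^ 2 / mixDensity μ s y) (scaledGaussian E t) :=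
  ((integrable_exp_mul_norm_scaledGaussian R t).const_mul _).mono'
    (measurable_norm_sq_mixGradient_div μ s).aestronglyMeasurable
    (.of_forall fun y ↦ by
      rw [Real.norm_eq_abs, abs_of_nonneg
        (div_nonneg (by positivity) (mixDensity_pos_of_bounded μ hR hs y).le)]
      exact norm_sq_mixGradient_div_le_of_bounded μ hR hs y)

lemma integral_sub_mean_eq_zero (μ : Measure E) [IsFiniteMeasure μ] [NeZero μ]
    (hμ : Integrable (fun x ↦ x) μ) {u : E} (hu : ∫ x, x ∂μ = μ.real Set.univ • u) :
    ∫ x, (x - u) ∂μ = 0 := by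
  rw [integral_sub hμ (integrable_const _), hu]; simp

/-- The second moment of the likelihood ratio between the mixture and the Gaussian with the same
mean parameter. -/
lemma integral_exp_inner_le_of_bounded (μ : Measure E) [IsFiniteMeasure μ] [NeZero μ] {R : ℝ}
    (hR : ∀ᵐ x ∂μ, ‖x‖ ≤ R) {s : ℝ} (hs : 0 ≤ s) (hsR : 4 * R ^ 2 * s ≤ 1) {u : E}
    (hu : ∫ x, x ∂μ = μ.real Set.univ • u) (huR : ‖u‖ ≤ R) :
    ∫ p : E × E, Real.exp (s * ⟪p.1 - u, p.2 - u⟫) ∂(μ.prod μ)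
      ≤ μ.real Set.univ ^ 2 * (1 + 16 * R ^ 4 * s ^ 2) := by
  have hμ := integrable_id_of_bounded μ hR
  have h0 := integral_sub_mean_eq_zero μ hμ hu
  have hp : ∀ᵐ p ∂(μ.prod μ), |s * ⟪p.1 - u, p.2 - u⟫| ≤ 4 * R ^ 2 * s := by
    have h1 : ∀ᵐ p ∂(μ.prod μ), ‖p.1‖ ≤ R := Measure.quasiMeasurePreserving_fst.ae hR
    have h2 : ∀ᵐ p ∂(μ.prod μ), ‖p.2‖ ≤ R := Measure.quasiMeasurePreserving_snd.ae hR
    filter_upwards [h1, h2] with p hp1 hp2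
    rw [abs_mul, abs_of_nonneg hs]
    have a1 : ‖p.1 - u‖ ≤ 2 * R := (norm_sub_le _ _).trans (by linarith)
    have a2 : ‖p.2 - u‖ ≤ 2 * R := (norm_sub_le _ _).trans (by linarith)
    have := (abs_real_inner_le_norm (p.1 - u) (p.2 - u)).trans
      (mul_le_mul a1 a2 (norm_nonneg _) ((norm_nonneg _).trans a1))
    nlinarith
  have m1 : AEStronglyMeasurable (fun p : E × E ↦ s * ⟪p.1 - u, p.2 - u⟫) (μ.prod μ) :=
    Measurable.aestronglyMeasurable (by fun_prop)
  have i1 : Integrable (fun p : E × E ↦ s * ⟪p.1 - u, p.2 - u⟫) (μ.prod μ) :=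
    (integrable_const _).mono' m1 hp
  have i2 : Integrable (fun p : E × E ↦ Real.exp (s * ⟪p.1 - u, p.2 - u⟫)) (μ.prod μ) := by
    refine (integrable_const (Real.exp (4 * R ^ 2 * s))).mono'
      (Real.continuous_exp.comp_aestronglyMeasurable m1) (hp.mono fun p hp ↦ ?_)
    rw [Real.norm_eq_abs, abs_of_pos (Real.exp_pos _)]
    exact Real.exp_le_exp.2 ((le_abs_self _).trans hp)
  -- exp v ≤ 1 + v + v² for |v| ≤ 1. Both differences have norm at most 2R, so |v| ≤ 4R²s, and `hsR`
  -- makes this at most 1.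
  have key : ∀ᵐ p ∂(μ.prod μ), Real.exp (s * ⟪p.1 - u, p.2 - u⟫) ≤
      s * ⟪p.1 - u, p.2 - u⟫ + (1 + 16 * R ^ 4 * s ^ 2) := by
    refine hp.mono fun p hp ↦ ?_
    have h3 := (abs_le.1 (Real.abs_exp_sub_one_sub_id_le (hp.trans hsR))).2
    have h4 : (s * ⟪p.1 - u, p.2 - u⟫) ^ 2 ≤ (4 * R ^ 2 * s) ^ 2 := by
      rw [← sq_abs]; gcongr
    nlinarith
  -- The first-order term vanishes because `u` is the normalized mean; what remains is quadratic in
  -- s.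
  have hz : ∫ p : E × E, s * ⟪p.1 - u, p.2 - u⟫ ∂(μ.prod μ) = 0 := by
    rw [integral_prod _ i1]
    have (x : E) : ∫ y, s * ⟪x - u, y - u⟫ ∂μ = 0 := by
      rw [integral_const_mul, integral_inner (𝕜 := ℝ) (f := fun y ↦ y - u) (hμ.sub (integrable_const u)) (x - u), h0]
      simp
    simp [this]
  have := integral_mono_ae i2 (i1.add (integrable_const _)) key
  simp only [Pi.add_apply] at this
  rw [integral_add i1 (integrable_const _), hz, integral_const, ← Set.univ_prod_univ,
    measureReal_prod_prod] at this
  simpa [sq] using this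

/-- The square of an integral is a double integral over two independent copies of the signal. -/
lemma mixDensity_sq_div_shiftDensity (μ : Measure E) [IsFiniteMeasure μ] (s : ℝ) (u w : E) :
    mixDensity μ s w ^ 2 / shiftDensity s u w =
      ∫ p : E × E, Real.exp (s * ⟪p.1 - u, p.2 - u⟫) * shiftDensity s (p.1 + p.2 - u) w
        ∂(μ.prod μ) := by
  rw [sq, mixDensity, ← integral_prod_mul, ← integral_div]
  simp_rw [shiftDensity_mul_div]

lemma integrable_exp_inner_mul_shiftDensity (μ : Measure E) [IsFiniteMeasure μ] [NeZero μ] {R : ℝ}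
    (hR : ∀ᵐ x ∂μ, ‖x‖ ≤ R) {s : ℝ} (hs : 0 ≤ s) (hsR : 4 * R ^ 2 * s ≤ 1) {u : E}
    (huR : ‖u‖ ≤ R) :
    Integrable (fun q : (E × E) × E ↦ Real.exp (s * ⟪q.1.1 - u, q.1.2 - u⟫) *
      shiftDensity s (q.1.1 + q.1.2 - u) q.2) ((μ.prod μ).prod (scaledGaussian E s)) := by
  have h1 : ∀ᵐ q ∂((μ.prod μ).prod (scaledGaussian E s)), ‖q.1.1‖ ≤ R ∧ ‖q.1.2‖ ≤ R := by
    refine Measure.quasiMeasurePreserving_fst.ae (p := fun p : E × E ↦ ‖p.1‖ ≤ R ∧ ‖p.2‖ ≤ R) ?_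
    filter_upwards [Measure.quasiMeasurePreserving_fst.ae hR,
      Measure.quasiMeasurePreserving_snd.ae hR] with p h1 h2 using ⟨h1, h2⟩
  refine (((integrable_exp_mul_norm_scaledGaussian (3 * R) s).comp_snd
    (μ.prod μ)).const_mul (Real.exp 1)).mono' (Measurable.aestronglyMeasurable (by fun_prop))
    (h1.mono fun q ⟨hq1, hq2⟩ ↦ ?_)
  rw [Real.norm_eq_abs, abs_of_pos (mul_pos (Real.exp_pos _) (shiftDensity_pos _ _ _))]
  have a1 : ‖q.1.1 - u‖ ≤ 2 * R := (norm_sub_le _ _).trans (by linarith)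
  have a2 : ‖q.1.2 - u‖ ≤ 2 * R := (norm_sub_le _ _).trans (by linarith)
  have a3 : ‖q.1.1 + q.1.2 - u‖ ≤ 3 * R := by
    have := norm_sub_le (q.1.1 + q.1.2) u
    have := norm_add_le q.1.1 q.1.2
    linarith
  have := (real_inner_le_norm (q.1.1 - u) (q.1.2 - u)).trans
    (mul_le_mul a1 a2 (norm_nonneg _) ((norm_nonneg _).trans a1))
  refine mul_le_mul (Real.exp_le_exp.2 ?_) (shiftDensity_le_exp hs a3 _)
    (shiftDensity_pos _ _ _).le (Real.exp_pos _).le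
  nlinarith

lemma integral_shiftDensity {s : ℝ} (hs : 0 ≤ s) (x : E) :
    ∫ y, shiftDensity s x y ∂(scaledGaussian E s) = 1 := by
  simpa using integral_scaledGaussian_shiftDensity_smul hs
    (stronglyMeasurable_const (b := (1 : ℝ))) x

lemma integrable_shiftDensity {s : ℝ} (hs : 0 ≤ s) (x : E) :
    Integrable (fun y ↦ shiftDensity s x y) (scaledGaussian E s) := by
  simpa using (integrable_scaledGaussian_shiftDensity_smul hs
    (stronglyMeasurable_const (b := (1 : ℝ))) x).2 (integrable_const _)

lemma integrable_mixDensity_sq_div (μ : Measure E) [IsFiniteMeasure μ] [NeZero μ] {R : ℝ}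
    (hR : ∀ᵐ x ∂μ, ‖x‖ ≤ R) {s : ℝ} (hs : 0 ≤ s) (hsR : 4 * R ^ 2 * s ≤ 1) {u : E}
    (huR : ‖u‖ ≤ R) :
    Integrable (fun w ↦ mixDensity μ s w ^ 2 / shiftDensity s u w) (scaledGaussian E s) := by
  simp_rw [mixDensity_sq_div_shiftDensity]
  exact (integrable_exp_inner_mul_shiftDensity μ hR hs hsR huR).integral_prod_right

lemma integral_mixDensity_sq_div_le (μ : Measure E) [IsFiniteMeasure μ] [NeZero μ] {R : ℝ}
    (hR : ∀ᵐ x ∂μ, ‖x‖ ≤ R) {s : ℝ} (hs : 0 ≤ s) (hsR : 4 * R ^ 2 * s ≤ 1) {u : E}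
    (hu : ∫ x, x ∂μ = μ.real Set.univ • u) (huR : ‖u‖ ≤ R) :
    ∫ w, mixDensity μ s w ^ 2 / shiftDensity s u w ∂(scaledGaussian E s)
      ≤ μ.real Set.univ ^ 2 * (1 + 16 * R ^ 4 * s ^ 2) := by
  refine le_trans (le_of_eq ?_) (integral_exp_inner_le_of_bounded μ hR hs hsR hu huR)
  simp_rw [mixDensity_sq_div_shiftDensity]
  have hi := integrable_exp_inner_mul_shiftDensity μ hR hs hsR huR
  rw [← integral_prod_symm _ hi, integral_prod _ hi]
  simp_rw [integral_const_mul, integral_shiftDensity hs, mul_one]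

end BoundedMixture

/-! ### Bounded signals: one-sided I-MMSE inequalities. -/

section BoundedMixtureEntropy

open scoped RealInnerProductSpace

variable {E : Type*} [NormedAddCommGroup E] [InnerProductSpace ℝ E] [FiniteDimensional ℝ E]
  [MeasurableSpace E] [BorelSpace E]

lemma norm_mean_le_of_bounded (μ : Measure E) [IsFiniteMeasure μ] [NeZero μ] {R : ℝ}
    (hR : ∀ᵐ x ∂μ, ‖x‖ ≤ R) : ‖(μ.real Set.univ)⁻¹ • ∫ x, x ∂μ‖ ≤ R := by
  have hc := measureReal_univ_pos μ
  have := norm_integral_le_of_norm_le (integrable_const R) hR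
  rw [norm_smul, norm_inv, Real.norm_of_nonneg hc.le, inv_mul_le_iff₀ hc]
  simpa using this

/-- log t ≤ t - 1 at t = a/b; integrated, it says that relative entropy is at most χ². -/
lemma mul_log_sub_mul_log_le {a b : ℝ} (ha : 0 < a) (hb : 0 < b) :
    a * Real.log a ≤ a * Real.log b + (a ^ 2 / b - a) := by
  have h := Real.log_le_sub_one_of_pos (div_pos ha hb)
  rw [Real.log_div ha.ne' hb.ne'] at h
  have := mul_le_mul_of_nonneg_left h ha.le
  have e : a * (a / b - 1) = a ^ 2 / b - a := by ring
  linarith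

/-- log t ≤ t - 1 at t = b/a; integrated, it is Gibbs' inequality. -/
lemma le_mul_log_sub_mul_log {a b : ℝ} (ha : 0 < a) (hb : 0 < b) :
    a * Real.log b + (a - b) ≤ a * Real.log a := by
  have h := Real.log_le_sub_one_of_pos (div_pos hb ha)
  rw [Real.log_div hb.ne' ha.ne'] at h
  have := mul_le_mul_of_nonneg_left h ha.le
  have e : a * (b / a - 1) = b - a := by field_simp
  linarith

/-- The logarithm of the Gaussian reference is affine in w, so only the mass and the mean of `μ`
enter. -/
lemma integral_mixDensity_mul_log_gaussian (μ : Measure E) [IsFiniteMeasure μ] [NeZero μ]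
    (hμ : Integrable (fun x ↦ x) μ) {s : ℝ} (hs : 0 ≤ s) {u : E}
    (hu : u = (μ.real Set.univ)⁻¹ • ∫ x, x ∂μ) :
    Integrable (fun w ↦ mixDensity μ s w * Real.log (μ.real Set.univ * shiftDensity s u w))
        (scaledGaussian E s) ∧
      ∫ w, mixDensity μ s w * Real.log (μ.real Set.univ * shiftDensity s u w) ∂(scaledGaussian E s)
        = μ.real Set.univ * Real.log (μ.real Set.univ)
          + s / 2 * (‖∫ x, x ∂μ‖ ^ 2 / μ.real Set.univ) := by
  have hc := measureReal_univ_pos μ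
  have e (w : E) : mixDensity μ s w * Real.log (μ.real Set.univ * shiftDensity s u w)
      = mixDensity μ s w * (Real.log (μ.real Set.univ) - s / 2 * ‖u‖ ^ 2)
        + mixDensity μ s w * ⟪u, w⟫ := by
    rw [Real.log_mul hc.ne' (shiftDensity_pos _ _ _).ne', shiftDensity, Real.log_exp]; ring
  simp_rw [e]
  have i1 := (integrable_mixDensity μ hs).mul_const
    (Real.log (μ.real Set.univ) - s / 2 * ‖u‖ ^ 2)
  have i2 := integrable_inner_mul_mixDensity μ hs hμ u
  refine ⟨i1.add i2, ?_⟩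
  rw [integral_add i1 i2, integral_mul_const, integral_mixDensity μ hs,
    integral_inner_mul_mixDensity μ hs hμ]
  have h1 : ∫ x, x ∂μ = μ.real Set.univ • u := by rw [hu, smul_smul, mul_inv_cancel₀ hc.ne', one_smul]
  rw [h1, inner_smul_right, real_inner_self_eq_norm_sq, norm_smul, Real.norm_of_nonneg hc.le]
  field_simp; ring

/-- Gibbs' inequality against the Gaussian shift with the mass and mean parameter of `μ`; equal
masses cancel the correction term. -/
lemma le_mixEntropy_of_bounded (μ : Measure E) [IsFiniteMeasure μ] [NeZero μ] {R : ℝ}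
    (hR : ∀ᵐ x ∂μ, ‖x‖ ≤ R) {s : ℝ} (hs : 0 ≤ s) :
    μ.real Set.univ * Real.log (μ.real Set.univ) + s / 2 * (‖∫ x, x ∂μ‖ ^ 2 / μ.real Set.univ)
      ≤ mixEntropy μ s := by
  have hc := measureReal_univ_pos μ
  obtain ⟨i1, e1⟩ := integral_mixDensity_mul_log_gaussian μ (integrable_id_of_bounded μ hR) hs rfl
  set u := (μ.real Set.univ)⁻¹ • ∫ x, x ∂μ
  have i2 := (integrable_mixDensity μ hs)
  have i3 := (integrable_shiftDensity hs u).const_mul (μ.real Set.univ)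
  have := integral_mono (i1.add (i2.sub i3))
    (integrable_mixDensity_mul_log_of_bounded μ hR hs)
    (fun w ↦ le_mul_log_sub_mul_log (mixDensity_pos_of_bounded μ hR hs w)
      (mul_pos hc (shiftDensity_pos s u w)))
  rw [integral_add' i1 (i2.sub i3), integral_sub' i2 i3, integral_const_mul, e1,
    integral_mixDensity μ hs, integral_shiftDensity hs] at this
  unfold mixEntropy
  linarith

/-- The same reference, now with entropy ≤ χ². Matching the mean makes χ² quadratic in s, so the
lower bound is sharp to first order. -/
lemma mixEntropy_le_of_bounded (μ : Measure E) [IsFiniteMeasure μ] [NeZero μ] {R : ℝ}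
    (hR : ∀ᵐ x ∂μ, ‖x‖ ≤ R) {s : ℝ} (hs : 0 ≤ s) (hsR : 4 * R ^ 2 * s ≤ 1) :
    mixEntropy μ s ≤ μ.real Set.univ * Real.log (μ.real Set.univ)
      + s / 2 * (‖∫ x, x ∂μ‖ ^ 2 / μ.real Set.univ) + μ.real Set.univ * (16 * R ^ 4 * s ^ 2) := by
  have hc := measureReal_univ_pos μ
  obtain ⟨i1, e1⟩ := integral_mixDensity_mul_log_gaussian μ (integrable_id_of_bounded μ hR) hs rfl
  have huR := norm_mean_le_of_bounded μ hR
  have hu : ∫ x, x ∂μ = μ.real Set.univ • ((μ.real Set.univ)⁻¹ • ∫ x, x ∂μ) := by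
    rw [smul_smul, mul_inv_cancel₀ hc.ne', one_smul]
  set u := (μ.real Set.univ)⁻¹ • ∫ x, x ∂μ
  have i2 := (integrable_mixDensity μ hs)
  have i3 := (integrable_mixDensity_sq_div μ hR hs hsR huR).const_mul (μ.real Set.univ)⁻¹
  have h3 := integral_mixDensity_sq_div_le μ hR hs hsR hu huR
  have := integral_mono (integrable_mixDensity_mul_log_of_bounded μ hR hs) (i1.add (i3.sub i2))
    (fun w ↦ (mul_log_sub_mul_log_le (mixDensity_pos_of_bounded μ hR hs w)
      (mul_pos hc (shiftDensity_pos s u w))).trans_eq (by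
        simp only [Pi.add_apply, Pi.sub_apply]; congr 2; field_simp))
  rw [integral_add' i1 (i3.sub i2), integral_sub' i3 i2, integral_const_mul, e1,
    integral_mixDensity μ hs] at this
  have h4 := mul_le_mul_of_nonneg_left h3 (inv_nonneg.2 hc.le)
  have h5 : (μ.real Set.univ)⁻¹ * (μ.real Set.univ ^ 2 * (1 + 16 * R ^ 4 * s ^ 2))
      = μ.real Set.univ + μ.real Set.univ * (16 * R ^ 4 * s ^ 2) := by field_simp
  unfold mixEntropy
  linarith

/-- ‖n‖²/a is a supremum over u of functions linear in (n, a), attained at u = n/a. Integrating one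
of them gives Jensen's inequality for this convex function. -/
lemma two_inner_sub_le_norm_sq_div {a : ℝ} (ha : 0 < a) (n u : E) :
    2 * ⟪u, n⟫ - a * ‖u‖ ^ 2 ≤ ‖n‖ ^ 2 / a := by
  rw [le_div_iff₀ ha]
  have h : 0 ≤ ‖n - a • u‖ ^ 2 := by positivity
  rw [norm_sub_sq_real, norm_smul, inner_smul_right, mul_pow, Real.norm_eq_abs, sq_abs,
    real_inner_comm] at h
  nlinarith

lemma le_mixFisher_of_bounded (μ : Measure E) [IsFiniteMeasure μ] [NeZero μ] {R : ℝ}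
    (hR : ∀ᵐ x ∂μ, ‖x‖ ≤ R) {s : ℝ} (hs : 0 ≤ s) :
    ‖∫ x, x ∂μ‖ ^ 2 / μ.real Set.univ ≤ mixFisher μ s := by
  have hc := measureReal_univ_pos μ
  have hμ := integrable_id_of_bounded μ hR
  set u := (μ.real Set.univ)⁻¹ • ∫ x, x ∂μ with hu
  have iN : Integrable (mixGradient μ s) (scaledGaussian E s) :=
    (integrable_mixGradient μ hs hμ).integral_prod_right
  have i1 := (iN.const_inner (𝕜 := ℝ) u).const_mul 2
  have i2 := (integrable_mixDensity μ hs).mul_const (‖u‖ ^ 2)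
  have := integral_mono (i1.sub i2) (integrable_norm_sq_mixGradient_div_of_bounded μ hR hs)
    (fun w ↦ two_inner_sub_le_norm_sq_div (mixDensity_pos_of_bounded μ hR hs w) _ _)
  simp only [Pi.sub_apply] at this
  rw [integral_sub i1 i2, integral_const_mul, integral_mul_const, integral_mixDensity μ hs,
    integral_inner iN, integral_mixGradient μ hs hμ] at this
  refine le_trans (le_of_eq ?_) this
  rw [hu, norm_smul, inner_smul_left, real_inner_self_eq_norm_sq, norm_inv,
    Real.norm_of_nonneg hc.le]
  simp only [conj_trivial]
  field_simp; ring

/-- The unnormalized posterior law of `X` given `a X + √a N = y`. -/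
noncomputable def posteriorWeight (μ : Measure E) (a : ℝ) (y : E) : Measure E :=
  μ.withDensity (fun x ↦ ENNReal.ofReal (shiftDensity a x y))

lemma integral_posteriorWeight (μ : Measure E) (a : ℝ) (y : E) {G : Type*} [NormedAddCommGroup G]
    [NormedSpace ℝ G] (g : E → G) :
    ∫ x, g x ∂(posteriorWeight μ a y) = ∫ x, shiftDensity a x y • g x ∂μ := by
  rw [posteriorWeight, integral_withDensity_eq_integral_toReal_smul (by fun_prop) (by simp)]
  simp_rw [ENNReal.toReal_ofReal (shiftDensity_pos _ _ _).le]

lemma ae_posteriorWeight {μ : Measure E} (a : ℝ) (y : E) {p : E → Prop} (hp : ∀ᵐ x ∂μ, p x) :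
    ∀ᵐ x ∂(posteriorWeight μ a y), p x :=
  (withDensity_absolutelyContinuous _ _).ae_le hp

lemma isFiniteMeasure_posteriorWeight (μ : Measure E) [IsFiniteMeasure μ] {R : ℝ}
    (hR : ∀ᵐ x ∂μ, ‖x‖ ≤ R) {a : ℝ} (ha : 0 ≤ a) (y : E) :
    IsFiniteMeasure (posteriorWeight μ a y) :=
  isFiniteMeasure_withDensity_ofReal (integrable_shiftDensity_of_bounded μ hR ha y).2

lemma neZero_posteriorWeight (μ : Measure E) [NeZero μ] (a : ℝ) (y : E) :
    NeZero (posteriorWeight μ a y) := by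
  refine ⟨fun h ↦ NeZero.ne μ ?_⟩
  rw [posteriorWeight, withDensity_eq_zero_iff (by fun_prop)] at h
  have : ∀ᵐ x ∂μ, False := h.mono fun x hx ↦ by
    simp only [Pi.zero_apply, ENNReal.ofReal_eq_zero] at hx
    exact absurd hx (not_le.2 (shiftDensity_pos _ _ _))
  simpa using this

lemma real_univ_posteriorWeight (μ : Measure E) (a : ℝ) (y : E) :
    (posteriorWeight μ a y).real Set.univ = mixDensity μ a y := by
  have := integral_posteriorWeight μ a y (fun _ ↦ (1 : ℝ))
  simpa [mixDensity] using this

/-- Markov property: observing w for a further time s under the posterior given y amounts to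
observing y + w up to time a + s. Leaving the posterior unnormalized keeps this exact, which is why
the small-time bounds are stated for finite measures. -/
lemma mixDensity_posteriorWeight (μ : Measure E) (a s : ℝ) (y w : E) :
    mixDensity (posteriorWeight μ a y) s w = mixDensity μ (a + s) (y + w) := by
  rw [mixDensity, integral_posteriorWeight, mixDensity]
  simp_rw [smul_eq_mul, shiftDensity_mul_shiftDensity]

lemma mixGradient_posteriorWeight (μ : Measure E) (a s : ℝ) (y w : E) :
    mixGradient (posteriorWeight μ a y) s w = mixGradient μ (a + s) (y + w) := by
  rw [mixGradient, integral_posteriorWeight, mixGradient]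
  simp_rw [smul_smul, shiftDensity_mul_shiftDensity]

lemma integral_scaledGaussian_add {a s : ℝ} (ha : 0 ≤ a) (hs : 0 ≤ s) {F : E → ℝ}
    (hF : Integrable F (scaledGaussian E (a + s))) :
    Integrable (fun y ↦ ∫ w, F (y + w) ∂(scaledGaussian E s)) (scaledGaussian E a) ∧
    ∫ y, F y ∂(scaledGaussian E (a + s))
      = ∫ y, ∫ w, F (y + w) ∂(scaledGaussian E s) ∂(scaledGaussian E a) := by
  rw [← scaledGaussian_conv ha hs] at hF ⊢
  refine ⟨?_, integral_conv hF⟩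
  have := hF.comp_measurable (f := fun p : E × E ↦ p.1 + p.2)
    (μ := (scaledGaussian E a).prod (scaledGaussian E s)) (by fun_prop)
  exact this.integral_prod_left

/-- Disintegration over the observation at time a: entropy increments from a become averages of
increments from 0. -/
lemma mixEntropy_add_of_bounded (μ : Measure E) [IsFiniteMeasure μ] [NeZero μ] {R : ℝ}
    (hR : ∀ᵐ x ∂μ, ‖x‖ ≤ R) {a s : ℝ} (ha : 0 ≤ a) (hs : 0 ≤ s) :
    Integrable (fun y ↦ mixEntropy (posteriorWeight μ a y) s) (scaledGaussian E a) ∧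
    mixEntropy μ (a + s) = ∫ y, mixEntropy (posteriorWeight μ a y) s ∂(scaledGaussian E a) := by
  simp_rw [mixEntropy, mixDensity_posteriorWeight]
  exact integral_scaledGaussian_add ha hs
    (integrable_mixDensity_mul_log_of_bounded μ hR (add_nonneg ha hs))

lemma mixFisher_add_of_bounded (μ : Measure E) [IsFiniteMeasure μ] [NeZero μ] {R : ℝ}
    (hR : ∀ᵐ x ∂μ, ‖x‖ ≤ R) {a s : ℝ} (ha : 0 ≤ a) (hs : 0 ≤ s) :
    Integrable (fun y ↦ mixFisher (posteriorWeight μ a y) s) (scaledGaussian E a) ∧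
    mixFisher μ (a + s) = ∫ y, mixFisher (posteriorWeight μ a y) s ∂(scaledGaussian E a) := by
  simp_rw [mixFisher, mixDensity_posteriorWeight, mixGradient_posteriorWeight]
  exact integral_scaledGaussian_add ha hs
    (integrable_norm_sq_mixGradient_div_of_bounded μ hR (add_nonneg ha hs))

/-- Jensen for each posterior: a conditional mean given more data has a larger second moment. -/
lemma mixFisher_mono_of_bounded (μ : Measure E) [IsFiniteMeasure μ] [NeZero μ] {R : ℝ}
    (hR : ∀ᵐ x ∂μ, ‖x‖ ≤ R) {a s : ℝ} (ha : 0 ≤ a) (hs : 0 ≤ s) :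
    mixFisher μ a ≤ mixFisher μ (a + s) := by
  obtain ⟨i, e⟩ := mixFisher_add_of_bounded μ hR ha hs
  rw [e, mixFisher]
  refine integral_mono (integrable_norm_sq_mixGradient_div_of_bounded μ hR ha) i fun y ↦ ?_
  have := isFiniteMeasure_posteriorWeight μ hR ha y
  have := neZero_posteriorWeight μ a y
  have h := le_mixFisher_of_bounded _ (ae_posteriorWeight a y hR) hs
  rwa [real_univ_posteriorWeight, integral_posteriorWeight] at h

/-- For the posterior given y, the mass is the mixture density and the mean vector is its gradient.
Integrating the small-time bound over y therefore reproduces the entropy and the Fisher information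
at time a. -/
lemma add_mul_mixFisher_le_mixEntropy_of_bounded (μ : Measure E) [IsFiniteMeasure μ] [NeZero μ]
    {R : ℝ} (hR : ∀ᵐ x ∂μ, ‖x‖ ≤ R) {a s : ℝ} (ha : 0 ≤ a) (hs : 0 ≤ s) :
    mixEntropy μ a + s / 2 * mixFisher μ a ≤ mixEntropy μ (a + s) := by
  obtain ⟨i, e⟩ := mixEntropy_add_of_bounded μ hR ha hs
  have i1 := integrable_mixDensity_mul_log_of_bounded μ hR ha (t := a)
  have i2 := (integrable_norm_sq_mixGradient_div_of_bounded μ hR ha (t := a)).const_mul (s / 2)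
  rw [e, mixFisher, mixEntropy, ← integral_const_mul, ← integral_add i1 i2]
  refine integral_mono (i1.add i2) i fun y ↦ ?_
  have := isFiniteMeasure_posteriorWeight μ hR ha y
  have := neZero_posteriorWeight μ a y
  have h := le_mixEntropy_of_bounded _ (ae_posteriorWeight a y hR) hs
  rwa [real_univ_posteriorWeight, integral_posteriorWeight] at h

lemma mixEntropy_le_add_mul_mixFisher_of_bounded (μ : Measure E) [IsFiniteMeasure μ] [NeZero μ]
    {R : ℝ} (hR : ∀ᵐ x ∂μ, ‖x‖ ≤ R) {a s : ℝ} (ha : 0 ≤ a) (hs : 0 ≤ s)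
    (hsR : 4 * R ^ 2 * s ≤ 1) :
    mixEntropy μ (a + s) ≤ mixEntropy μ a + s / 2 * mixFisher μ a
      + μ.real Set.univ * (16 * R ^ 4 * s ^ 2) := by
  obtain ⟨i, e⟩ := mixEntropy_add_of_bounded μ hR ha hs
  have i1 := integrable_mixDensity_mul_log_of_bounded μ hR ha (t := a)
  have i2 := (integrable_norm_sq_mixGradient_div_of_bounded μ hR ha (t := a)).const_mul (s / 2)
  have i3 := (integrable_mixDensity μ ha).mul_const (16 * R ^ 4 * s ^ 2)
  rw [e, mixFisher, mixEntropy, ← integral_const_mul, ← integral_add' i1 i2,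
    ← integral_mixDensity μ ha, ← integral_mul_const, ← integral_add' (i1.add i2) i3]
  refine integral_mono i ((i1.add i2).add i3) fun y ↦ ?_
  have := isFiniteMeasure_posteriorWeight μ hR ha y
  have := neZero_posteriorWeight μ a y
  have h := mixEntropy_le_of_bounded _ (ae_posteriorWeight a y hR) hs hsR
  rwa [real_univ_posteriorWeight, integral_posteriorWeight] at h

/-- If a function grows at rate at most `q`, with `q` monotone, up to a quadratic error, then its
increments over `[a, b]` are at most `(b - a) q(b)`. -/
lemma sub_le_mul_of_locally_le {g q : ℝ → ℝ} {C η : ℝ} (hη : 0 < η)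
    (hq : ∀ a s, 0 ≤ a → 0 ≤ s → q a ≤ q (a + s))
    (hg : ∀ a s, 0 ≤ a → 0 ≤ s → s ≤ η → g (a + s) ≤ g a + s * q a + C * s ^ 2)
    {a s : ℝ} (ha : 0 ≤ a) (hs : 0 ≤ s) : g (a + s) ≤ g a + s * q (a + s) := by
  -- Cut the interval into n equal pieces. Each contributes an error C(s/n)², in total C s²/n, and
  -- every rate is at most the one at the right end.
  have hn : ∀ᶠ n : ℕ in atTop, g (a + s) ≤ g a + s * q (a + s) + C * s ^ 2 / n := by
    have h1 : Tendsto (fun n : ℕ ↦ s / (n : ℝ)) atTop (𝓝 0) :=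
      tendsto_const_div_atTop_nhds_zero_nat s
    filter_upwards [h1.eventually_le_const hη, eventually_gt_atTop 0] with n hn hn0
    have hn0' : (0 : ℝ) < n := by exact_mod_cast hn0
    have key (k : ℕ) (hk : k ≤ n) : g (a + k * (s / n))
        ≤ g a + k * (s / n * q (a + s) + C * (s / n) ^ 2) := by
      induction k with
      | zero => simp
      | succ k ih =>
        have ih := ih (by omega)
        have hk' : (k : ℝ) ≤ n := by exact_mod_cast (by omega : k ≤ n)
        have h2 := hg (a + k * (s / n)) (s / n) (by positivity) (by positivity) hn
        have h3 : q (a + k * (s / n)) ≤ q (a + s) := by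
          have e : s - k * (s / n) = (n - k) * (s / n) := by field_simp
          have := hq (a + k * (s / n)) (s - k * (s / n)) (by positivity)
            (by rw [e]; exact mul_nonneg (by linarith) (by positivity))
          convert this using 2; ring
        have h4 := mul_le_mul_of_nonneg_left h3 (by positivity : 0 ≤ s / n)
        have e2 : a + ((k + 1 : ℕ) : ℝ) * (s / n) = a + k * (s / n) + s / n := by push_cast; ring
        rw [e2]
        push_cast
        linarith
    have := key n le_rfl
    have e1 : (n : ℝ) * (s / n) = s := by field_simp
    have e2 : (n : ℝ) * (s / n * q (a + s) + C * (s / n) ^ 2)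
        = s * q (a + s) + C * s ^ 2 / n := by field_simp
    rw [e1, e2] at this
    linarith
  have ht : Tendsto (fun n : ℕ ↦ g a + s * q (a + s) + C * s ^ 2 / n) atTop
      (𝓝 (g a + s * q (a + s) + 0)) :=
    tendsto_const_nhds.add (tendsto_const_div_atTop_nhds_zero_nat _)
  rw [add_zero] at ht
  exact ge_of_tendsto ht hn

lemma mixEntropy_le_add_mul_mixFisher_add_of_bounded (μ : Measure E) [IsFiniteMeasure μ] [NeZero μ]
    {R : ℝ} (hR : ∀ᵐ x ∂μ, ‖x‖ ≤ R) {a s : ℝ} (ha : 0 ≤ a) (hs : 0 ≤ s) :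
    mixEntropy μ (a + s) ≤ mixEntropy μ a + s * (mixFisher μ (a + s) / 2) := by
  -- Any positive η with 4R²η ≤ 1 would do; the added 1 covers R = 0.
  have hη : 0 < 1 / (4 * R ^ 2 + 1) := by positivity
  refine sub_le_mul_of_locally_le (g := mixEntropy μ) (q := fun a ↦ mixFisher μ a / 2)
    (C := μ.real Set.univ * (16 * R ^ 4)) hη (fun a s ha hs ↦ ?_) (fun a s ha hs hsη ↦ ?_) ha hs
  · have := mixFisher_mono_of_bounded μ hR ha hs
    linarith
  · rw [le_div_iff₀ (by positivity)] at hsη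
    have := mixEntropy_le_add_mul_mixFisher_of_bounded μ hR ha hs (by nlinarith)
    linarith

end BoundedMixtureEntropy

/-! ### Removing boundedness: signals with finite second moment. -/

section Truncation

open scoped RealInnerProductSpace

variable {E : Type*} [NormedAddCommGroup E] [InnerProductSpace ℝ E] [FiniteDimensional ℝ E]
  [MeasurableSpace E] [BorelSpace E]

/-- The weighted variance about the weighted mean is nonnegative. -/
lemma norm_sq_integral_smul_div_le {ν : Measure E} {e : E → ℝ} (he : ∀ x, 0 ≤ e x)
    (h0 : Integrable e ν) (h1 : Integrable (fun x ↦ e x • x) ν)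
    (h2 : Integrable (fun x ↦ e x * ‖x‖ ^ 2) ν) :
    ‖∫ x, e x • x ∂ν‖ ^ 2 / ∫ x, e x ∂ν ≤ ∫ x, e x * ‖x‖ ^ 2 ∂ν := by
  -- With zero total weight the quotient is 0 by the convention for division.
  rcases (integral_nonneg he : 0 ≤ ∫ x, e x ∂ν).eq_or_lt with hL | hL
  · rw [← hL, div_zero]
    exact integral_nonneg fun x ↦ mul_nonneg (he x) (by positivity)
  set L := ∫ x, e x ∂ν
  set N := ∫ x, e x • x ∂ν
  have hi := h1.const_inner (𝕜 := ℝ) (L⁻¹ • N)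
  have key : ∫ x, (2 * ⟪L⁻¹ • N, e x • x⟫ - e x * ‖L⁻¹ • N‖ ^ 2) ∂ν ≤ ∫ x, e x * ‖x‖ ^ 2 ∂ν := by
    refine integral_mono ((hi.const_mul 2).sub (h0.mul_const _)) h2 fun x ↦ ?_
    have h : 0 ≤ e x * ‖x - L⁻¹ • N‖ ^ 2 := mul_nonneg (he x) (by positivity)
    rw [norm_sub_sq_real, real_inner_comm] at h
    simp only [inner_smul_right]
    linarith
  rw [integral_sub (hi.const_mul 2) (h0.mul_const _), integral_const_mul, integral_mul_const,
    integral_inner h1] at key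
  refine le_trans (le_of_eq ?_) key
  rw [inner_smul_left, real_inner_self_eq_norm_sq, norm_smul, norm_inv, Real.norm_of_nonneg hL.le]
  simp only [conj_trivial]
  change ‖N‖ ^ 2 / L = 2 * (L⁻¹ * ‖N‖ ^ 2) - L * (L⁻¹ * ‖N‖) ^ 2
  field_simp; ring

lemma neg_one_le_mul_log {t : ℝ} (ht : 0 ≤ t) : -1 ≤ t * Real.log t := by
  rcases ht.eq_or_lt with rfl | ht
  · simp
  · have := mul_le_mul_of_nonneg_left (Real.one_sub_inv_le_log_of_pos ht) ht.le
    have e : t * (1 - t⁻¹) = t - 1 := by field_simp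
    linarith

/-- t log t is not monotone on [0, 1], but it is bounded there by 1 in absolute value. The result
dominates the entropy integrands of truncated signals. -/
lemma abs_mul_log_le_of_le {t b : ℝ} (ht : 0 ≤ t) (htb : t ≤ b) :
    |t * Real.log t| ≤ 1 + |b * Real.log b| := by
  rw [abs_le]
  constructor
  · linarith [neg_one_le_mul_log ht, abs_nonneg (b * Real.log b)]
  · rcases le_total t 1 with h | h
    · linarith [Real.mul_log_nonpos ht h, abs_nonneg (b * Real.log b)]
    · have : t * Real.log t ≤ b * Real.log b :=
        mul_le_mul htb (Real.log_le_log (by linarith) htb) (Real.log_nonneg h) (by linarith)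
      linarith [le_abs_self (b * Real.log b)]

lemma mixDensity_nonneg (μ : Measure E) (s : ℝ) (y : E) : 0 ≤ mixDensity μ s y :=
  integral_nonneg fun x ↦ (shiftDensity_pos s x y).le

variable (μ : Measure E) [IsProbabilityMeasure μ]

lemma ae_integrable_shiftDensity {s : ℝ} (hs : 0 ≤ s) :
    ∀ᵐ y ∂(scaledGaussian E s), Integrable (fun x ↦ shiftDensity s x y) μ :=
  (integrable_shiftDensity_prod μ hs).prod_left_ae

/-- At s = 0 the integrand exp⟪x, y⟫ may fail to be integrable for y ≠ 0, and the integral then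
defaults to 0; hence an almost sure statement. -/
lemma ae_mixDensity_pos {s : ℝ} (hs : 0 ≤ s) :
    ∀ᵐ y ∂(scaledGaussian E s), 0 < mixDensity μ s y := by
  filter_upwards [ae_integrable_shiftDensity μ hs] with y hy
  exact integral_exp_pos hy

variable {μ}

lemma integrable_norm_sq_of_memLp (hμ : MemLp id 2 μ) : Integrable (fun x ↦ ‖x‖ ^ 2) μ :=
  (memLp_two_iff_integrable_sq_norm (by fun_prop)).1 hμ

lemma integrable_of_memLp (hμ : MemLp id 2 μ) : Integrable (fun x ↦ x) μ :=
  hμ.integrable (by norm_num)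

lemma integrable_inner_prod (hμ : MemLp id 2 μ) (s : ℝ) :
    Integrable (fun p : E × E ↦ ⟪p.1, p.2⟫) (μ.prod (scaledGaussian E s)) := by
  refine (((integrable_norm_sq_of_memLp hμ).comp_fst (scaledGaussian E s)).add
    ((integrable_norm_sq_scaledGaussian s).comp_snd μ)).mono'
    (Measurable.aestronglyMeasurable (by fun_prop)) (.of_forall fun p ↦ ?_)
  simp only [Real.norm_eq_abs, Pi.add_apply]
  have := abs_real_inner_le_norm p.1 p.2
  nlinarith [sq_nonneg (‖p.1‖ - ‖p.2‖), sq_nonneg (‖p.1‖ + ‖p.2‖)]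

lemma integral_inner_prod (hμ : MemLp id 2 μ) (s : ℝ) :
    ∫ p : E × E, ⟪p.1, p.2⟫ ∂(μ.prod (scaledGaussian E s)) = 0 := by
  rw [integral_prod _ (integrable_inner_prod hμ s)]
  have (x : E) : ∫ y, ⟪x, y⟫ ∂(scaledGaussian E s) = 0 := by
    rw [integral_inner (integrable_id_scaledGaussian s), integral_id_scaledGaussian,
      inner_zero_right]
  simp [this]

lemma integrable_shiftDensity_mul_norm_sq (hμ : MemLp id 2 μ) {s : ℝ} (hs : 0 ≤ s) :
    Integrable (fun p : E × E ↦ shiftDensity s p.1 p.2 * ‖p.1‖ ^ 2)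
      (μ.prod (scaledGaussian E s)) :=
  (integrable_prod_shiftDensity_smul_iff μ hs (F := fun p ↦ ‖p.1‖ ^ 2) (by fun_prop)).2
    ((integrable_norm_sq_of_memLp hμ).comp_fst _)

lemma integral_integral_shiftDensity_mul_norm_sq (hμ : MemLp id 2 μ) {s : ℝ} (hs : 0 ≤ s) :
    ∫ y, ∫ x, shiftDensity s x y * ‖x‖ ^ 2 ∂μ ∂(scaledGaussian E s) = ∫ x, ‖x‖ ^ 2 ∂μ := by
  rw [← integral_prod_symm _ (integrable_shiftDensity_mul_norm_sq hμ hs)]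
  refine (integral_prod_shiftDensity_smul μ hs (F := fun p ↦ ‖p.1‖ ^ 2) (by fun_prop)
    ((integrable_norm_sq_of_memLp hμ).comp_fst _)).trans ?_
  exact (integral_fun_fst (fun x ↦ ‖x‖ ^ 2)).trans (by simp)

lemma ae_integrable_shiftDensity_smul (hμ : MemLp id 2 μ) {s : ℝ} (hs : 0 ≤ s) :
    ∀ᵐ y ∂(scaledGaussian E s), Integrable (fun x ↦ shiftDensity s x y • x) μ :=
  (integrable_mixGradient μ hs (integrable_of_memLp hμ)).prod_left_ae

lemma ae_integrable_shiftDensity_mul_norm_sq (hμ : MemLp id 2 μ) {s : ℝ} (hs : 0 ≤ s) :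
    ∀ᵐ y ∂(scaledGaussian E s), Integrable (fun x ↦ shiftDensity s x y * ‖x‖ ^ 2) μ :=
  (integrable_shiftDensity_mul_norm_sq hμ hs).prod_left_ae

lemma ae_norm_sq_mixGradient_div_le (hμ : MemLp id 2 μ) {s : ℝ} (hs : 0 ≤ s) :
    ∀ᵐ y ∂(scaledGaussian E s), ‖mixGradient μ s y‖ ^ 2 / mixDensity μ s y
      ≤ ∫ x, shiftDensity s x y * ‖x‖ ^ 2 ∂μ := by
  filter_upwards [ae_integrable_shiftDensity μ hs, ae_integrable_shiftDensity_smul hμ hs,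
    ae_integrable_shiftDensity_mul_norm_sq hμ hs] with y h0 h1 h2
  exact norm_sq_integral_smul_div_le (fun x ↦ (shiftDensity_pos s x y).le) h0 h1 h2

lemma integrable_norm_sq_mixGradient_div (hμ : MemLp id 2 μ) {s : ℝ} (hs : 0 ≤ s) :
    Integrable (fun y ↦ ‖mixGradient μ s y‖ ^ 2 / mixDensity μ s y) (scaledGaussian E s) := by
  refine (integrable_shiftDensity_mul_norm_sq hμ hs).integral_prod_right.mono'
    (measurable_norm_sq_mixGradient_div μ s).aestronglyMeasurable ?_
  filter_upwards [ae_norm_sq_mixGradient_div_le hμ hs, ae_mixDensity_pos μ hs] with y h h'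
  rwa [Real.norm_of_nonneg (by positivity)]

lemma mixFisher_le (hμ : MemLp id 2 μ) {s : ℝ} (hs : 0 ≤ s) :
    mixFisher μ s ≤ ∫ x, ‖x‖ ^ 2 ∂μ := by
  rw [← integral_integral_shiftDensity_mul_norm_sq hμ hs]
  exact integral_mono_ae (integrable_norm_sq_mixGradient_div hμ hs)
    (integrable_shiftDensity_mul_norm_sq hμ hs).integral_prod_right
    (ae_norm_sq_mixGradient_div_le hμ hs)

/-- This is mmse(s) ≤ d/s: the estimator Y/s has error N(0, Id/s), and the conditional mean does no
worse. -/
lemma le_mixFisher (hμ : MemLp id 2 μ) {s : ℝ} (hs : 0 < s) :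
    ∫ x, ‖x‖ ^ 2 ∂μ - Module.finrank ℝ E / s ≤ mixFisher μ s := by
  -- With v = y/s this is ‖x‖² - ‖x - v‖². It is affine in x, so averaging over the posterior
  -- produces the supporting function of ‖·‖²/a at v.
  set F : E × E → ℝ := fun p ↦ 2 * ⟪s⁻¹ • p.2, p.1⟫ - ‖s⁻¹ • p.2‖ ^ 2
  have hF : StronglyMeasurable F := by fun_prop
  have e (p : E × E) : F (p.1, s • p.1 + p.2) = ‖p.1‖ ^ 2 - (s ^ 2)⁻¹ * ‖p.2‖ ^ 2 := by
    simp only [F]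
    rw [smul_add, smul_smul, inv_mul_cancel₀ hs.ne', one_smul, norm_add_sq_real, inner_add_left,
      real_inner_self_eq_norm_sq, norm_smul, norm_inv, Real.norm_of_nonneg hs.le,
      real_inner_comm p.1]
    field_simp; ring
  have i1 := (integrable_norm_sq_of_memLp hμ).comp_fst (scaledGaussian E s)
  have i2 := (((integrable_norm_sq_scaledGaussian (E := E) s).comp_snd μ).const_mul (s ^ 2)⁻¹)
  have hi : Integrable (fun p ↦ F (p.1, s • p.1 + p.2)) (μ.prod (scaledGaussian E s)) := by
    simp_rw [e]; exact i1.sub i2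
  have h1 := integral_prod_shiftDensity_smul μ hs.le hF hi
  have hi' := (integrable_prod_shiftDensity_smul_iff μ hs.le hF).2 hi
  simp_rw [e] at h1
  rw [integral_sub i1 i2, integral_const_mul, integral_fun_fst (fun x : E ↦ ‖x‖ ^ 2),
    integral_fun_snd (fun x : E ↦ ‖x‖ ^ 2), integral_norm_sq_scaledGaussian hs.le,
    integral_prod_symm _ hi'] at h1
  have h2 : ∫ x, ‖x‖ ^ 2 ∂μ - Module.finrank ℝ E / s
      = ∫ y, ∫ x, shiftDensity s x y • F (x, y) ∂μ ∂(scaledGaussian E s) := by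
    rw [h1]; simp; field_simp
  rw [h2]
  refine integral_mono_ae hi'.integral_prod_right (integrable_norm_sq_mixGradient_div hμ hs.le) ?_
  filter_upwards [ae_mixDensity_pos μ hs.le, ae_integrable_shiftDensity μ hs.le,
    ae_integrable_shiftDensity_smul hμ hs.le] with y hy h0 h1
  refine le_trans (le_of_eq ?_) (two_inner_sub_le_norm_sq_div hy (mixGradient μ s y) (s⁻¹ • y))
  have hi := h1.const_inner (𝕜 := ℝ) (s⁻¹ • y)
  rw [mixGradient, mixDensity, ← integral_inner h1, ← integral_const_mul, ← integral_mul_const,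
    ← integral_sub (hi.const_mul 2) (h0.mul_const _)]
  congr 1; ext x
  simp only [F, smul_eq_mul, inner_smul_right]
  ring

lemma integrable_shiftDensity_mul_log (hμ : MemLp id 2 μ) {s : ℝ} (hs : 0 ≤ s) :
    Integrable (fun p : E × E ↦ shiftDensity s p.1 p.2 * Real.log (shiftDensity s p.1 p.2))
      (μ.prod (scaledGaussian E s)) := by
  have h := (integrable_prod_shiftDensity_smul_iff μ hs
    (F := fun p ↦ ⟪p.1, p.2⟫ - s / 2 * ‖p.1‖ ^ 2) (by fun_prop)).2 ?_
  · simpa [shiftDensity] using h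
  · refine ((((integrable_norm_sq_of_memLp hμ).comp_fst (scaledGaussian E s)).const_mul
      (s / 2)).add (integrable_inner_prod hμ s)).congr (.of_forall fun p ↦ ?_)
    simp only [Pi.add_apply, inner_add_right, inner_smul_right, real_inner_self_eq_norm_sq]
    ring

/-- Jensen for t log t bounds the integrand by the average of `shiftDensity` times its logarithm,
integrable by the second moment. From below, t log t ≥ -1. -/
lemma integrable_mixDensity_mul_log (hμ : MemLp id 2 μ) {s : ℝ} (hs : 0 ≤ s) :
    Integrable (fun y ↦ mixDensity μ s y * Real.log (mixDensity μ s y)) (scaledGaussian E s) := by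
  refine ((integrable_const (1 : ℝ)).add
    (integrable_shiftDensity_mul_log hμ hs).integral_prod_right.abs).mono'
    ((measurable_mixDensity μ s).mul (measurable_mixDensity μ s).log).aestronglyMeasurable ?_
  filter_upwards [ae_mixDensity_pos μ hs, ae_integrable_shiftDensity μ hs,
    (integrable_shiftDensity_mul_log hμ hs).prod_left_ae] with y hy h0 h1
  have key : mixDensity μ s y * Real.log (mixDensity μ s y)
      ≤ ∫ x, shiftDensity s x y * Real.log (shiftDensity s x y) ∂μ := by
    have := integral_mono ((h0.mul_const (Real.log (mixDensity μ s y))).add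
      (h0.sub (integrable_const (mixDensity μ s y)))) h1
      (fun x ↦ le_mul_log_sub_mul_log (shiftDensity_pos s x y) hy)
    rw [integral_add' (h0.mul_const _) (h0.sub (integrable_const _)), integral_mul_const,
      integral_sub' h0 (integrable_const _)] at this
    simpa [mixDensity] using this
  rw [Real.norm_eq_abs, abs_le]
  simp only [Pi.add_apply]
  set A := ∫ x, shiftDensity s x y * Real.log (shiftDensity s x y) ∂μ
  constructor
  · linarith [neg_one_le_mul_log hy.le, abs_nonneg A]
  · linarith [le_abs_self A]

lemma tendsto_integral_restrict_closedBall {G : Type*} [NormedAddCommGroup G] [NormedSpace ℝ G]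
    {g : E → G} (hg : Integrable g μ) :
    Tendsto (fun n : ℕ ↦ ∫ x, g x ∂(μ.restrict (Metric.closedBall 0 n))) atTop
      (𝓝 (∫ x, g x ∂μ)) := by
  have := tendsto_setIntegral_of_monotone (μ := μ) (f := g)
    (s := fun n : ℕ ↦ Metric.closedBall (0 : E) n) (fun n ↦ measurableSet_closedBall)
    (fun m n h ↦ Metric.closedBall_subset_closedBall (by exact_mod_cast h)) hg.integrableOn
  rwa [Metric.iUnion_closedBall_nat, setIntegral_univ] at this

/-- Restricting to balls without renormalizing keeps the truncated density below the full one, which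
gives an integrable dominating function. -/
lemma tendsto_mixEntropy_restrict (hμ : MemLp id 2 μ) {s : ℝ} (hs : 0 ≤ s) :
    Tendsto (fun n : ℕ ↦ mixEntropy (μ.restrict (Metric.closedBall 0 n)) s) atTop
      (𝓝 (mixEntropy μ s)) := by
  refine tendsto_integral_of_dominated_convergence
    (fun y ↦ 1 + |mixDensity μ s y * Real.log (mixDensity μ s y)|)
    (fun n ↦ ((measurable_mixDensity _ s).mul (measurable_mixDensity _ s).log).aestronglyMeasurable)
    ((integrable_const _).add (integrable_mixDensity_mul_log hμ hs).abs) (fun n ↦ ?_) ?_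
  · filter_upwards [ae_integrable_shiftDensity μ hs] with y h0
    exact abs_mul_log_le_of_le (integral_nonneg fun x ↦ (shiftDensity_pos s x y).le)
      (integral_mono_measure Measure.restrict_le_self
        (.of_forall fun x ↦ (shiftDensity_pos s x y).le) h0)
  · filter_upwards [ae_integrable_shiftDensity μ hs] with y h0
    exact (Real.continuous_mul_log.tendsto _).comp (tendsto_integral_restrict_closedBall h0)

/-- The truncated Fisher integrands are dominated by the unnormalized posterior second moment of the
full signal. -/
lemma tendsto_mixFisher_restrict (hμ : MemLp id 2 μ) {s : ℝ} (hs : 0 ≤ s) :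
    Tendsto (fun n : ℕ ↦ mixFisher (μ.restrict (Metric.closedBall 0 n)) s) atTop
      (𝓝 (mixFisher μ s)) := by
  refine tendsto_integral_of_dominated_convergence
    (fun y ↦ ∫ x, shiftDensity s x y * ‖x‖ ^ 2 ∂μ)
    (fun n ↦ (measurable_norm_sq_mixGradient_div _ s).aestronglyMeasurable)
    (integrable_shiftDensity_mul_norm_sq hμ hs).integral_prod_right (fun n ↦ ?_) ?_
  · filter_upwards [ae_integrable_shiftDensity μ hs, ae_integrable_shiftDensity_smul hμ hs,
      ae_integrable_shiftDensity_mul_norm_sq hμ hs] with y h0 h1 h2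
    rw [Real.norm_of_nonneg (div_nonneg (by positivity) (mixDensity_nonneg _ s y))]
    refine (norm_sq_integral_smul_div_le (fun x ↦ (shiftDensity_pos s x y).le) h0.restrict
      h1.restrict h2.restrict).trans ?_
    exact integral_mono_measure Measure.restrict_le_self
        (.of_forall fun x ↦ mul_nonneg (shiftDensity_pos s x y).le (by positivity)) h2
  · filter_upwards [ae_integrable_shiftDensity μ hs, ae_integrable_shiftDensity_smul hμ hs,
      ae_mixDensity_pos μ hs] with y h0 h1 hy
    exact ((tendsto_integral_restrict_closedBall h1).norm.pow 2).div
      (tendsto_integral_restrict_closedBall h0) hy.ne'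

lemma eventually_neZero_restrict_closedBall :
    ∀ᶠ n : ℕ in atTop, NeZero (μ.restrict (Metric.closedBall 0 n)) := by
  have h := tendsto_integral_restrict_closedBall (integrable_const (μ := μ) (1 : ℝ))
  filter_upwards [h.eventually (lt_mem_nhds (by simp : (0 : ℝ) < ∫ _, 1 ∂μ))] with n hn
  refine ⟨fun h0 ↦ ?_⟩
  rw [h0] at hn
  simp at hn

lemma ae_restrict_closedBall_norm_le (n : ℕ) :
    ∀ᵐ x ∂(μ.restrict (Metric.closedBall 0 n)), ‖x‖ ≤ n := by
  filter_upwards [ae_restrict_mem measurableSet_closedBall] with x hx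
  simpa using hx

/-- The increments of the relative entropy are at least those prescribed by the Fisher
information at the left end point. -/
lemma add_mul_mixFisher_le_mixEntropy (hμ : MemLp id 2 μ) {a s : ℝ} (ha : 0 ≤ a) (hs : 0 ≤ s) :
    mixEntropy μ a + s / 2 * mixFisher μ a ≤ mixEntropy μ (a + s) := by
  refine le_of_tendsto_of_tendsto ((tendsto_mixEntropy_restrict hμ ha).add
    ((tendsto_mixFisher_restrict hμ ha).const_mul (s / 2)))
    (tendsto_mixEntropy_restrict hμ (add_nonneg ha hs)) ?_
  filter_upwards [eventually_neZero_restrict_closedBall (μ := μ)] with n hn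
  exact add_mul_mixFisher_le_mixEntropy_of_bounded _ (ae_restrict_closedBall_norm_le n) ha hs

/-- The increments of the relative entropy are at most those prescribed by the Fisher
information at the right end point. -/
lemma mixEntropy_le_add_mul_mixFisher (hμ : MemLp id 2 μ) {a s : ℝ} (ha : 0 ≤ a) (hs : 0 ≤ s) :
    mixEntropy μ (a + s) ≤ mixEntropy μ a + s / 2 * mixFisher μ (a + s) := by
  refine le_of_tendsto_of_tendsto (tendsto_mixEntropy_restrict hμ (add_nonneg ha hs))
    ((tendsto_mixEntropy_restrict hμ ha).add
      ((tendsto_mixFisher_restrict hμ (add_nonneg ha hs)).const_mul (s / 2))) ?_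
  filter_upwards [eventually_neZero_restrict_closedBall (μ := μ)] with n hn
  have := mixEntropy_le_add_mul_mixFisher_add_of_bounded _
    (ae_restrict_closedBall_norm_le (μ := μ) n) ha hs
  linarith

@[simp]
lemma mixEntropy_zero : mixEntropy μ 0 = 0 := by
  simp [mixEntropy, mixDensity, shiftDensity]

lemma mixFisher_zero : mixFisher μ 0 = ‖∫ x, x ∂μ‖ ^ 2 := by
  simp [mixFisher, mixDensity, mixGradient, shiftDensity]

end Truncation

/-- Positivity of q makes P the measure with density p/q relative to Q, which identifies the
log-likelihood ratio. The mass correction in `klDiv` cancels between probability measures. -/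
lemma klDiv_withDensity_ofReal {α : Type*} [MeasurableSpace α] {ρ : Measure α} [SigmaFinite ρ]
    {p q : α → ℝ} (hp : Measurable p) (hq : Measurable q) (hp0 : ∀ᵐ x ∂ρ, 0 < p x)
    (hq0 : ∀ᵐ x ∂ρ, 0 < q x) {P Q : Measure α} [IsProbabilityMeasure P] [IsProbabilityMeasure Q]
    (hP : P = ρ.withDensity (fun x ↦ ENNReal.ofReal (p x)))
    (hQ : Q = ρ.withDensity (fun x ↦ ENNReal.ofReal (q x)))
    (hi : Integrable (fun x ↦ Real.log (p x) - Real.log (q x)) P) :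
    klDiv P Q = ENNReal.ofReal (∫ x, (Real.log (p x) - Real.log (q x)) ∂P) := by
  have hPQ : P = Q.withDensity (fun x ↦ ENNReal.ofReal (p x / q x)) := by
    rw [hP, hQ, ← withDensity_mul _ (by fun_prop) (by fun_prop)]
    refine withDensity_congr_ae ?_
    filter_upwards [hq0] with x hx
    rw [Pi.mul_apply, ← ENNReal.ofReal_mul hx.le, mul_div_cancel₀ _ hx.ne']
  have hac : P ≪ Q := hPQ ▸ withDensity_absolutelyContinuous _ _
  have hPρ : P ≪ ρ := hP ▸ withDensity_absolutelyContinuous _ _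
  have hllr : llr P Q =ᵐ[P] fun x ↦ Real.log (p x) - Real.log (q x) := by
    have h : P.rnDeriv Q =ᵐ[P] fun x ↦ ENNReal.ofReal (p x / q x) := by
      refine hac.ae_le ?_
      have h := Measure.rnDeriv_withDensity (f := fun x ↦ ENNReal.ofReal (p x / q x)) Q (by fun_prop)
      rwa [← hPQ] at h
    filter_upwards [h, hPρ.ae_le hp0, hPρ.ae_le hq0] with x hx h1 h2
    rw [llr, hx, ENNReal.toReal_ofReal (by positivity), Real.log_div h1.ne' h2.ne']
  rw [klDiv_of_ac_of_integrable hac (hi.congr hllr.symm), integral_congr_ae hllr]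
  simp

/-! ### Mutual information of the Gaussian channel. -/

section ChannelInfo

open scoped RealInnerProductSpace

variable {E : Type*} [NormedAddCommGroup E] [InnerProductSpace ℝ E] [FiniteDimensional ℝ E]
  [MeasurableSpace E] [BorelSpace E]

lemma integrable_shiftDensity_mul_log_mixDensity {μ : Measure E} [IsProbabilityMeasure μ]
    (hμ : MemLp id 2 μ) {s : ℝ} (hs : 0 ≤ s) :
    Integrable (fun p : E × E ↦ shiftDensity s p.1 p.2 • Real.log (mixDensity μ s p.2))
      (μ.prod (scaledGaussian E s)) := by
  have hm := measurable_mixDensity μ s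
  rw [integrable_prod_iff' (Measurable.aestronglyMeasurable (by fun_prop))]
  constructor
  · filter_upwards [ae_integrable_shiftDensity μ hs] with y hy
    exact hy.mul_const _
  · simp_rw [norm_smul, Real.norm_eq_abs, abs_of_pos (shiftDensity_pos s _ _), integral_mul_const]
    refine (integrable_mixDensity_mul_log hμ hs).norm.congr (.of_forall fun y ↦ ?_)
    simp only [Real.norm_eq_abs, abs_mul, abs_of_nonneg (mixDensity_nonneg μ s y)]
    rfl

lemma integrable_log_mixDensity {μ : Measure E} [IsProbabilityMeasure μ]
    (hμ : MemLp id 2 μ) {s : ℝ} (hs : 0 ≤ s) :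
    Integrable (fun p : E × E ↦ Real.log (mixDensity μ s (s • p.1 + p.2)))
      (μ.prod (scaledGaussian E s)) :=
  (integrable_prod_shiftDensity_smul_iff μ hs (F := fun p ↦ Real.log (mixDensity μ s p.2))
    (((measurable_mixDensity μ s).comp measurable_snd).log.stronglyMeasurable)).1
    (integrable_shiftDensity_mul_log_mixDensity hμ hs)

lemma integral_log_mixDensity {μ : Measure E} [IsProbabilityMeasure μ]
    (hμ : MemLp id 2 μ) {s : ℝ} (hs : 0 ≤ s) :
    ∫ p : E × E, Real.log (mixDensity μ s (s • p.1 + p.2)) ∂(μ.prod (scaledGaussian E s))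
      = mixEntropy μ s := by
  rw [← integral_prod_shiftDensity_smul μ hs (F := fun p ↦ Real.log (mixDensity μ s p.2))
    (((measurable_mixDensity μ s).comp measurable_snd).log.stronglyMeasurable)
    (integrable_log_mixDensity hμ hs),
    integral_prod_symm _ (integrable_shiftDensity_mul_log_mixDensity hμ hs)]
  simp_rw [smul_eq_mul, integral_mul_const]
  rfl

lemma prod_scaledGaussian_eq_map (μ : Measure E) [IsProbabilityMeasure μ] (s : ℝ) :
    μ.prod (scaledGaussian E s) = (μ.prod (stdGaussian E)).map (fun p ↦ (p.1, √s • p.2)) := by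
  have := Measure.map_prod_map μ (stdGaussian E) measurable_id
    (by fun_prop : Measurable fun z : E ↦ √s • z)
  rw [Measure.map_id] at this
  exact this

/-- The channel √s X + N and the observation sX + √s N differ by the factor √s; this translates
between their densities. -/
lemma shiftDensity_sqrt_smul {s : ℝ} (hs : 0 ≤ s) (x z : E) :
    shiftDensity 1 (√s • x) z = shiftDensity s x (√s • z) := by
  simp only [inner_smul_left, inner_smul_right, norm_smul, mul_pow, Real.norm_eq_abs, sq_abs,
    Real.sq_sqrt hs, RCLike.conj_to_real, shiftDensity]
  ring_nf

/-- The joint law of `X` and `√s X + N` has density `shiftDensity`. -/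
lemma map_prodMk_channel (μ : Measure E) [IsProbabilityMeasure μ] {s : ℝ} (hs : 0 ≤ s) :
    (μ.prod (stdGaussian E)).map (fun p ↦ (p.1, √s • p.1 + p.2))
      = (μ.prod (stdGaussian E)).withDensity
        (fun p ↦ ENNReal.ofReal (shiftDensity s p.1 (√s • p.2))) := by
  refine Measure.ext_of_lintegral _ fun F hF ↦ ?_
  rw [lintegral_map hF (by fun_prop), lintegral_withDensity_eq_lintegral_mul _ (by fun_prop) hF,
    lintegral_prod _ (by fun_prop), lintegral_prod _ (by fun_prop)]
  congr 1; ext x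
  rw [← lintegral_stdGaussian_mul_shiftDensity (F := fun y ↦ F (x, y)) (by fun_prop) (√s • x)]
  simp_rw [Pi.mul_apply, shiftDensity_sqrt_smul hs, mul_comm]

/-- The law of `√s X + N` has density `mixDensity`. -/
lemma map_channel (μ : Measure E) [IsProbabilityMeasure μ] {s : ℝ} (hs : 0 ≤ s) :
    (μ.prod (stdGaussian E)).map (fun p ↦ √s • p.1 + p.2)
      = (stdGaussian E).withDensity (fun z ↦ ENNReal.ofReal (mixDensity μ s (√s • z))) := by
  have hm := measurable_mixDensity μ s
  refine Measure.ext_of_lintegral _ fun F hF ↦ ?_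
  have h1 : ∫⁻ p : E × E, F (√s • p.1 + p.2) ∂(μ.prod (stdGaussian E))
      = ∫⁻ p : E × E, ENNReal.ofReal (shiftDensity s p.1 (√s • p.2)) * F p.2
        ∂(μ.prod (stdGaussian E)) := by
    have h := congrArg (fun ν ↦ ∫⁻ p, F p.2 ∂ν) (map_prodMk_channel μ hs)
    rwa [lintegral_map (by fun_prop) (by fun_prop),
      lintegral_withDensity_eq_lintegral_mul _ (by fun_prop) (by fun_prop)] at h
  rw [lintegral_map hF (by fun_prop), h1, lintegral_prod_symm _ (by fun_prop),
    lintegral_withDensity_eq_lintegral_mul _ (by fun_prop) hF]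
  refine lintegral_congr_ae ?_
  have hae : ∀ᵐ z ∂(stdGaussian E), Integrable (fun x ↦ shiftDensity s x (√s • z)) μ :=
    ae_of_ae_map (f := fun z ↦ √s • z) (by fun_prop) (ae_integrable_shiftDensity μ hs)
  filter_upwards [hae] with z hz
  simp only [Pi.mul_apply]
  rw [lintegral_mul_const _ (by fun_prop), mixDensity, ofReal_integral_eq_lintegral_ofReal hz
    (.of_forall fun x ↦ (shiftDensity_pos _ _ _).le)]

/-- The joint law has density `shiftDensity` and the product law `mixDensity` relative to the same
reference. Under the joint law the first logarithm averages to (s/2) E‖X‖², its cross term with the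
noise being centred, and the second to the mixture entropy. -/
lemma mutualInfo_channel {μ : Measure E} [IsProbabilityMeasure μ] (hμ : MemLp id 2 μ) {s : ℝ}
    (hs : 0 ≤ s) :
    mutualInfo (μ.prod (stdGaussian E)) (fun p ↦ p.1) (fun p ↦ √s • p.1 + p.2) = ENNReal.ofReal (s / 2 * ∫ x, ‖x‖ ^ 2 ∂μ - mixEntropy μ s) := by
  have hm := measurable_mixDensity μ s
  have hX : (μ.prod (stdGaussian E)).map (fun p ↦ p.1) = μ :=
    Measure.fst_prod
  have pj : IsProbabilityMeasure
      ((μ.prod (stdGaussian E)).map (fun p ↦ (p.1, √s • p.1 + p.2))) :=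
    Measure.isProbabilityMeasure_map (by fun_prop)
  have py : IsProbabilityMeasure ((μ.prod (stdGaussian E)).map (fun p ↦ √s • p.1 + p.2)) :=
    Measure.isProbabilityMeasure_map (by fun_prop)
  have hprod : μ.prod ((μ.prod (stdGaussian E)).map (fun p ↦ √s • p.1 + p.2))
      = (μ.prod (stdGaussian E)).withDensity
        (fun p ↦ ENNReal.ofReal (mixDensity μ s (√s • p.2))) := by
    rw [map_channel μ hs, prod_withDensity_right (by fun_prop)]
  have hpos : ∀ᵐ p ∂(μ.prod (stdGaussian E)), 0 < mixDensity μ s (√s • p.2) :=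
    Measure.quasiMeasurePreserving_snd.ae
      (ae_of_ae_map (f := fun z : E ↦ √s • z) (by fun_prop) (ae_mixDensity_pos μ hs))
  -- the log-likelihood ratio along the channel
  have hL := integrable_log_mixDensity hμ hs
  have eL := integral_log_mixDensity hμ hs
  have mL : AEStronglyMeasurable (fun p : E × E ↦ Real.log (mixDensity μ s (s • p.1 + p.2)))
      ((μ.prod (stdGaussian E)).map (fun p ↦ (p.1, √s • p.2))) :=
    (Measurable.log (by fun_prop)).aestronglyMeasurable
  rw [prod_scaledGaussian_eq_map, integrable_map_measure mL (by fun_prop), Function.comp_def] at hL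
  rw [prod_scaledGaussian_eq_map, integral_map (by fun_prop) mL] at eL
  have i1 := ((integrable_norm_sq_of_memLp hμ).comp_fst (stdGaussian E)).const_mul (s / 2)
  have i2 : Integrable (fun p : E × E ↦ √s * ⟪p.1, p.2⟫) (μ.prod (stdGaussian E)) := by
    have := integrable_inner_prod hμ 1
    simp only [scaledGaussian, Real.sqrt_one, one_smul, Measure.map_id'] at this
    exact this.const_mul _
  have e2 : ∫ p : E × E, √s * ⟪p.1, p.2⟫ ∂(μ.prod (stdGaussian E)) = 0 := by
    have := integral_inner_prod hμ 1
    simp only [scaledGaussian, Real.sqrt_one, one_smul, Measure.map_id'] at this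
    rw [integral_const_mul, this, mul_zero]
  have hpt (p : E × E) : Real.log (shiftDensity s p.1 (√s • (√s • p.1 + p.2)))
      - Real.log (mixDensity μ s (√s • (√s • p.1 + p.2)))
      = (s / 2 * ‖p.1‖ ^ 2 + √s * ⟪p.1, p.2⟫) - Real.log (mixDensity μ s (s • p.1 + √s • p.2)) := by
    rw [shiftDensity, Real.log_exp, smul_add, smul_smul, Real.mul_self_sqrt hs, inner_add_right,
      inner_smul_right, inner_smul_right, real_inner_self_eq_norm_sq]
    ring
  have mm : Measurable (fun p : E × E ↦ Real.log (shiftDensity s p.1 (√s • p.2))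
      - Real.log (mixDensity μ s (√s • p.2))) := by fun_prop
  rw [mutualInfo, hX, klDiv_withDensity_ofReal
    (p := fun p : E × E ↦ shiftDensity s p.1 (√s • p.2))
    (q := fun p : E × E ↦ mixDensity μ s (√s • p.2)) (by fun_prop) (by fun_prop)
    (.of_forall fun p ↦ shiftDensity_pos _ _ _) hpos (map_prodMk_channel μ hs) hprod]
  · rw [integral_map (by fun_prop) mm.aestronglyMeasurable]
    simp_rw [hpt]
    rw [integral_sub (f := fun p : E × E ↦ s / 2 * ‖p.1‖ ^ 2 + √s * ⟪p.1, p.2⟫)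
      (i1.add i2) hL, integral_add i1 i2, e2, integral_const_mul,
      integral_fun_fst (fun x : E ↦ ‖x‖ ^ 2)]
    congr 1
    simp only at eL
    rw [eL]; simp
  · rw [integrable_map_measure mm.aestronglyMeasurable (by fun_prop)]
    exact ((i1.add i2).sub hL).congr (.of_forall fun p ↦ (hpt p).symm)

/-- The mutual information at a single positive time vanishes only for a deterministic signal. -/
lemma integral_norm_sq_eq_of_mutualInfo_channel_eq_zero {μ : Measure E} [IsProbabilityMeasure μ]
    (hμ : MemLp id 2 μ) (h : mutualInfo (μ.prod (stdGaussian E)) (fun p ↦ p.1)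
      (fun p ↦ √1 • p.1 + p.2) = 0) :
    ∫ x, ‖x‖ ^ 2 ∂μ = ‖∫ x, x ∂μ‖ ^ 2 := by
  have hX : (μ.prod (stdGaussian E)).map (fun p ↦ p.1) = μ := Measure.fst_prod
  have pj : IsProbabilityMeasure
      ((μ.prod (stdGaussian E)).map (fun p ↦ (p.1, √1 • p.1 + p.2))) :=
    Measure.isProbabilityMeasure_map (by fun_prop)
  have py : IsProbabilityMeasure ((μ.prod (stdGaussian E)).map (fun p ↦ √1 • p.1 + p.2)) :=
    Measure.isProbabilityMeasure_map (by fun_prop)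
  rw [mutualInfo, hX, klDiv_eq_zero_iff] at h
  -- Test the equality of joint and product law on ⟪x, y⟫: the joint law gives E‖X‖², the product
  -- law ‖E X‖².
  have h1 := congrArg (fun ν ↦ ∫ p : E × E, ⟪p.1, p.2⟫ ∂ν) h
  have i0 := integrable_of_memLp hμ
  have ip : Integrable (fun p : E × E ↦ ⟪p.1, p.2⟫) (μ.prod (stdGaussian E)) := by
    have := integrable_inner_prod hμ 1
    simpa only [scaledGaussian, Real.sqrt_one, one_smul, Measure.map_id'] using this
  have ep : ∫ p : E × E, ⟪p.1, p.2⟫ ∂(μ.prod (stdGaussian E)) = 0 := by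
    have := integral_inner_prod hμ 1
    simpa only [scaledGaussian, Real.sqrt_one, one_smul, Measure.map_id'] using this
  have i1 := (integrable_norm_sq_of_memLp hμ).comp_fst (stdGaussian E)
  have ij : Integrable (fun p : E × E ↦ ⟪p.1, p.2⟫)
      ((μ.prod (stdGaussian E)).map (fun p ↦ (p.1, √1 • p.1 + p.2))) := by
    rw [integrable_map_measure (by fun_prop) (by fun_prop)]
    refine (i1.add ip).congr (.of_forall fun p ↦ ?_)
    simp [inner_add_right]
  have is : Integrable (fun p : E × E ↦ √1 • p.1) (μ.prod (stdGaussian E)) :=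
    (i0.comp_fst _).smul (√1)
  have ig : Integrable (fun p : E × E ↦ p.2) (μ.prod (stdGaussian E)) :=
    (IsGaussian.integrable_fun_id (μ := stdGaussian E)).comp_snd μ
  have hY : Integrable (fun y ↦ y) ((μ.prod (stdGaussian E)).map (fun p ↦ √1 • p.1 + p.2)) := by
    rw [integrable_map_measure (by fun_prop) (by fun_prop)]
    exact is.add ig
  have eY : ∫ y, y ∂((μ.prod (stdGaussian E)).map (fun p ↦ √1 • p.1 + p.2)) = ∫ x, x ∂μ := by
    rw [integral_map (by fun_prop) (by fun_prop), integral_add is ig, integral_smul,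
      integral_fun_fst (fun x : E ↦ x), integral_fun_snd (fun x : E ↦ x), integral_id_stdGaussian]
    simp
  rw [integral_prod _ (h ▸ ij), integral_map (by fun_prop) (by fun_prop)] at h1
  simp_rw [inner_add_right, inner_smul_right, real_inner_self_eq_norm_sq, Real.sqrt_one,
    one_mul] at h1
  rw [integral_add i1 ip, ep, integral_fun_fst (fun x : E ↦ ‖x‖ ^ 2)] at h1
  simp_rw [Real.sqrt_one] at eY hY
  have h2 (x : E) : ∫ y, ⟪x, y⟫ ∂((μ.prod (stdGaussian E)).map (fun p ↦ (1 : ℝ) • p.1 + p.2))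
      = ⟪∫ x, x ∂μ, x⟫ := by
    rw [integral_inner hY, eY, real_inner_comm]
  simp_rw [h2] at h1
  rw [integral_inner i0, real_inner_self_eq_norm_sq] at h1
  simpa using h1

end ChannelInfo

/-! ### The information function in terms of the mixture entropy. -/

section MutualInfo

open scoped RealInnerProductSpace

variable {d : ℕ} {μ : Measure (EuclideanSpace ℝ (Fin d))} [IsProbabilityMeasure μ]

lemma gaussianChannelInfo_eq (hμ : MemLp id 2 μ) {s : ℝ} (hs : 0 ≤ s) :
    gaussianChannelInfo μ s = ENNReal.ofReal (s / 2 * ∫ x, ‖x‖ ^ 2 ∂μ - mixEntropy μ s) :=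
  mutualInfo_channel hμ hs

/-- Nonnegativity of the information, which makes `ENNReal.ofReal` lossless in its formula. -/
lemma mixEntropy_le (hμ : MemLp id 2 μ) {s : ℝ} (hs : 0 ≤ s) :
    mixEntropy μ s ≤ s / 2 * ∫ x, ‖x‖ ^ 2 ∂μ := by
  have h := mixEntropy_le_add_mul_mixFisher hμ le_rfl hs
  rw [mixEntropy_zero, zero_add, zero_add] at h
  exact h.trans (mul_le_mul_of_nonneg_left (mixFisher_le hμ hs) (by positivity))

lemma toReal_gaussianChannelInfo (hμ : MemLp id 2 μ) {s : ℝ} (hs : 0 ≤ s) :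
    (gaussianChannelInfo μ s).toReal = s / 2 * ∫ x, ‖x‖ ^ 2 ∂μ - mixEntropy μ s := by
  rw [gaussianChannelInfo_eq hμ hs, ENNReal.toReal_ofReal (by linarith [mixEntropy_le hμ hs])]

end MutualInfo

/-! ### Discrete Girsanov formula on the noise space. -/

section SamplingPath

open scoped RealInnerProductSpace

variable {d : ℕ}

/-- The law of a sequence of independent standard Gaussian vectors. -/
noncomputable def noiseMeasure (d : ℕ) : Measure (ℕ → EuclideanSpace ℝ (Fin d)) :=
  Measure.infinitePi fun _ ↦ stdGaussian (EuclideanSpace ℝ (Fin d))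

instance : IsProbabilityMeasure (noiseMeasure d) := by
  unfold noiseMeasure; infer_instance

/-- The sampling process as a function of the noise sequence. -/
noncomputable def noisePath (δ : ℕ → ℝ)
    (f : ℕ → EuclideanSpace ℝ (Fin d) → EuclideanSpace ℝ (Fin d)) (k : ℕ)
    (w : ℕ → EuclideanSpace ℝ (Fin d)) : EuclideanSpace ℝ (Fin d) :=
  samplingProcess δ f (fun j w ↦ w j) k w

variable {δ : ℕ → ℝ} {f : ℕ → EuclideanSpace ℝ (Fin d) → EuclideanSpace ℝ (Fin d)}

@[simp]
lemma noisePath_zero (δ : ℕ → ℝ) (f : ℕ → EuclideanSpace ℝ (Fin d) → EuclideanSpace ℝ (Fin d))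
    (w : ℕ → EuclideanSpace ℝ (Fin d)) : noisePath δ f 0 w = 0 := rfl

lemma noisePath_succ (δ : ℕ → ℝ) (f : ℕ → EuclideanSpace ℝ (Fin d) → EuclideanSpace ℝ (Fin d))
    (k : ℕ) (w : ℕ → EuclideanSpace ℝ (Fin d)) :
    noisePath δ f (k + 1) w = noisePath δ f k w + δ (k + 1) • f (k + 1) (noisePath δ f k w)
      + √(δ (k + 1)) • w (k + 1) := rfl

lemma samplingProcess_eq_noisePath {Ω : Type*} (δ : ℕ → ℝ)
    (f : ℕ → EuclideanSpace ℝ (Fin d) → EuclideanSpace ℝ (Fin d))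
    (N : ℕ → Ω → EuclideanSpace ℝ (Fin d)) (k : ℕ) (ω : Ω) :
    samplingProcess δ f N k ω = noisePath δ f k (fun j ↦ N j ω) := by
  induction k with
  | zero => rfl
  | succ k ih => rw [samplingProcess, noisePath_succ, ih]

/-- Given X = x, the comparison process is a sampling process with constant drift x, so one Girsanov
formula serves both processes. -/
lemma comparisonProcess_eq_noisePath {Ω : Type*} (δ : ℕ → ℝ) (X : Ω → EuclideanSpace ℝ (Fin d))
    (N : ℕ → Ω → EuclideanSpace ℝ (Fin d)) (k : ℕ) (ω : Ω) :
    comparisonProcess δ X N k ω = noisePath δ (fun _ _ ↦ X ω) k (fun j ↦ N j ω) := by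
  induction k with
  | zero => rfl
  | succ k ih => rw [comparisonProcess, noisePath_succ, ih]

lemma noisePath_const (δ : ℕ → ℝ) (x : EuclideanSpace ℝ (Fin d)) (k : ℕ)
    (w : ℕ → EuclideanSpace ℝ (Fin d)) :
    noisePath δ (fun _ _ ↦ x) k w
      = (∑ j ∈ Finset.range k, δ (j + 1)) • x + noisePath δ (fun _ _ ↦ 0) k w := by
  induction k with
  | zero => simp
  | succ k ih =>
    rw [noisePath_succ, noisePath_succ, ih, Finset.sum_range_succ, add_smul, smul_zero]
    abel

lemma noisePath_congr_left {f g : ℕ → EuclideanSpace ℝ (Fin d) → EuclideanSpace ℝ (Fin d)} {k : ℕ}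
    (h : ∀ j ∈ Finset.Icc 1 k, f j = g j) (w : ℕ → EuclideanSpace ℝ (Fin d)) :
    noisePath δ f k w = noisePath δ g k w := by
  induction k with
  | zero => rfl
  | succ k ih =>
    rw [noisePath_succ, noisePath_succ, h (k + 1) (by simp),
      ih fun j hj ↦ h j (by simp at hj ⊢; omega)]

lemma noisePath_congr_right {k : ℕ} {w w' : ℕ → EuclideanSpace ℝ (Fin d)}
    (h : ∀ j ∈ Finset.Icc 1 k, w j = w' j) : noisePath δ f k w = noisePath δ f k w' := by
  induction k with
  | zero => rfl
  | succ k ih =>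
    rw [noisePath_succ, noisePath_succ, h (k + 1) (by simp),
      ih fun j hj ↦ h j (by simp at hj ⊢; omega)]

lemma measurable_noisePath (hf : ∀ k, Measurable (f k)) (k : ℕ) :
    Measurable (noisePath δ f k) := by
  induction k with
  | zero => exact measurable_const
  | succ k ih =>
    have := hf (k + 1)
    simp_rw [funext (noisePath_succ δ f k)]
    fun_prop

/-- The path stopped after `n` steps. -/
noncomputable def stoppedNoisePath (δ : ℕ → ℝ)
    (f : ℕ → EuclideanSpace ℝ (Fin d) → EuclideanSpace ℝ (Fin d)) (n : ℕ)
    (w : ℕ → EuclideanSpace ℝ (Fin d)) : ℕ → EuclideanSpace ℝ (Fin d) :=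
  fun k ↦ noisePath δ f (min k n) w

@[fun_prop]
lemma measurable_stoppedNoisePath (hf : ∀ k, Measurable (f k)) (n : ℕ) :
    Measurable (stoppedNoisePath δ f n) :=
  measurable_pi_lambda _ fun k ↦ measurable_noisePath hf (min k n)

lemma noiseMeasure_map_eval (k : ℕ) :
    (noiseMeasure d).map (fun w ↦ w k) = stdGaussian (EuclideanSpace ℝ (Fin d)) :=
  Measure.infinitePi_map_eval _ k

lemma iIndepFun_noiseMeasure :
    iIndepFun (fun k (w : ℕ → EuclideanSpace ℝ (Fin d)) ↦ w k) (noiseMeasure d) :=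
  iIndepFun_infinitePi (X := fun _ x ↦ x) (fun _ ↦ measurable_id)

/-- The path up to time n depends only on the noise coordinates 1, …, n. -/
lemma indepFun_stoppedNoisePath (hf : ∀ k, Measurable (f k)) (n : ℕ) :
    IndepFun (stoppedNoisePath δ f n) (fun w ↦ w (n + 1)) (noiseMeasure d) := by
  have h := (iIndepFun_noiseMeasure (d := d)).indepFun_finset (Finset.Icc 1 n) {n + 1}
    (by simp) (fun k ↦ by fun_prop)
  -- The padding by 0 is harmless: the stopped path never reads the other coordinates, not even
  -- coordinate 0.
  let e : (Finset.Icc 1 n → EuclideanSpace ℝ (Fin d)) → ℕ → EuclideanSpace ℝ (Fin d) :=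
    fun u j ↦ if h : j ∈ Finset.Icc 1 n then u ⟨j, h⟩ else 0
  have he : Measurable e := measurable_pi_lambda _ fun j ↦ by
    by_cases h : j ∈ Finset.Icc 1 n
    · simp only [e, h, dite_true]; fun_prop
    · simp only [e, h, dite_false]; fun_prop
  have h2 := h.comp ((measurable_stoppedNoisePath (δ := δ) hf n).comp he)
    (measurable_pi_apply (⟨n + 1, by simp⟩ : ({n + 1} : Finset ℕ)))
  have e1 : stoppedNoisePath δ f n = (stoppedNoisePath δ f n ∘ e) ∘ fun w i ↦ w i := by
    ext1 w
    refine funext fun k ↦ noisePath_congr_right fun j hj ↦ ?_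
    have hj' : j ∈ Finset.Icc 1 n := by simp at hj ⊢; omega
    simp only [e, hj', dite_true]
  rw [e1]
  exact h2

lemma lintegral_stoppedNoisePath_prod (hf : ∀ k, Measurable (f k)) (n : ℕ)
    {H : (ℕ → EuclideanSpace ℝ (Fin d)) × EuclideanSpace ℝ (Fin d) → ℝ≥0∞} (hH : Measurable H) :
    ∫⁻ w, H (stoppedNoisePath δ f n w, w (n + 1)) ∂(noiseMeasure d)
      = ∫⁻ w, ∫⁻ z, H (stoppedNoisePath δ f n w, z) ∂(stdGaussian (EuclideanSpace ℝ (Fin d)))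
        ∂(noiseMeasure d) := by
  have h := (indepFun_iff_map_prod_eq_prod_map_map
    (measurable_stoppedNoisePath hf n).aemeasurable (measurable_pi_apply _).aemeasurable).1
    (indepFun_stoppedNoisePath (δ := δ) hf n)
  have h1 := congrArg (fun ν ↦ ∫⁻ p, H p ∂ν) h
  rw [noiseMeasure_map_eval, lintegral_prod _ hH.aemeasurable,
    lintegral_map hH ((measurable_stoppedNoisePath hf n).prodMk (by fun_prop)),
    lintegral_map hH.lintegral_prod_right' (measurable_stoppedNoisePath hf n)] at h1
  exact h1

/-- The density of the path of the sampling process with respect to the driftless path. -/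
noncomputable def pathDensity (δ : ℕ → ℝ)
    (f : ℕ → EuclideanSpace ℝ (Fin d) → EuclideanSpace ℝ (Fin d)) (n : ℕ)
    (p : ℕ → EuclideanSpace ℝ (Fin d)) : ℝ :=
  ∏ k ∈ Finset.range n, shiftDensity (δ (k + 1)) (f (k + 1) (p k)) (p (k + 1) - p k)

lemma pathDensity_pos (n : ℕ) (p : ℕ → EuclideanSpace ℝ (Fin d)) : 0 < pathDensity δ f n p :=
  Finset.prod_pos fun _ _ ↦ shiftDensity_pos _ _ _

lemma measurable_pathDensity (hf : ∀ k, Measurable (f k)) (n : ℕ) :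
    Measurable (pathDensity δ f n) := by
  refine Finset.measurable_prod _ fun k _ ↦ ?_
  have := hf (k + 1)
  fun_prop

lemma pathDensity_congr {n : ℕ} {p q : ℕ → EuclideanSpace ℝ (Fin d)} (h : ∀ k ≤ n, p k = q k) :
    pathDensity δ f n p = pathDensity δ f n q := by
  refine Finset.prod_congr rfl fun k hk ↦ ?_
  have hk := Finset.mem_range.1 hk
  rw [h k hk.le, h (k + 1) hk]

/-- Replace the path from time `n + 1` on by `v`. -/
def gluePath (n : ℕ) (p : ℕ → EuclideanSpace ℝ (Fin d)) (v : EuclideanSpace ℝ (Fin d)) :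
    ℕ → EuclideanSpace ℝ (Fin d) := fun k ↦ if k ≤ n then p k else v

lemma measurable_gluePath (n : ℕ) : Measurable
    (fun q : (ℕ → EuclideanSpace ℝ (Fin d)) × EuclideanSpace ℝ (Fin d) ↦
      gluePath n q.1 q.2) := by
  refine measurable_pi_lambda _ fun k ↦ ?_
  by_cases h : k ≤ n
  · simp only [gluePath, h, if_true]; fun_prop
  · simp only [gluePath, h, if_false]; fun_prop

lemma stoppedNoisePath_succ (n : ℕ) (w : ℕ → EuclideanSpace ℝ (Fin d)) :
    stoppedNoisePath δ f (n + 1) w = gluePath n (stoppedNoisePath δ f n w)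
      (noisePath δ f n w + (δ (n + 1) • f (n + 1) (noisePath δ f n w)
        + √(δ (n + 1)) • w (n + 1))) := by
  ext1 k
  by_cases h : k ≤ n
  · simp [stoppedNoisePath, gluePath, h, h.trans (Nat.le_succ n)]
  · rw [stoppedNoisePath, gluePath, if_neg h, min_eq_right (by omega), noisePath_succ, add_assoc]

lemma pathDensity_glue (n : ℕ) (p : ℕ → EuclideanSpace ℝ (Fin d)) (v : EuclideanSpace ℝ (Fin d)) :
    pathDensity δ f (n + 1) (gluePath n p (p n + v))
      = pathDensity δ f n p * shiftDensity (δ (n + 1)) (f (n + 1) (p n)) v := by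
  rw [pathDensity, Finset.prod_range_succ]
  congr 1
  · exact pathDensity_congr fun k hk ↦ by simp [gluePath, hk]
  · simp [gluePath]

@[simp]
lemma stoppedNoisePath_self (n : ℕ) (w : ℕ → EuclideanSpace ℝ (Fin d)) :
    stoppedNoisePath δ f n w n = noisePath δ f n w := by simp [stoppedNoisePath]

/-- A discrete Girsanov formula. -/
lemma lintegral_stoppedNoisePath (hδ : ∀ k, 0 ≤ δ k) (hf : ∀ k, Measurable (f k)) (n : ℕ)
    {F : (ℕ → EuclideanSpace ℝ (Fin d)) → ℝ≥0∞} (hF : Measurable F) :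
    ∫⁻ w, F (stoppedNoisePath δ f n w) ∂(noiseMeasure d)
      = ∫⁻ w, F (stoppedNoisePath δ (fun _ _ ↦ 0) n w)
        * ENNReal.ofReal (pathDensity δ f n (stoppedNoisePath δ (fun _ _ ↦ 0) n w))
        ∂(noiseMeasure d) := by
  induction n generalizing F with
  | zero =>
    have (w : ℕ → EuclideanSpace ℝ (Fin d)) : stoppedNoisePath δ f 0 w
        = stoppedNoisePath δ (fun _ _ ↦ 0) 0 w := by ext1 k; simp [stoppedNoisePath]
    simp [this, pathDensity]
  | succ n ih =>
    have hg := measurable_gluePath (d := d) n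
    have hf0 : ∀ k, Measurable ((fun _ _ ↦ 0 : ℕ → EuclideanSpace ℝ (Fin d) →
      EuclideanSpace ℝ (Fin d)) k) := fun k ↦ measurable_const
    have hfn := hf (n + 1)
    have hD := measurable_pathDensity (δ := δ) hf n
    have hD1 := measurable_pathDensity (δ := δ) hf (n + 1)
    have hFg : Measurable (fun q : (ℕ → EuclideanSpace ℝ (Fin d)) × EuclideanSpace ℝ (Fin d) ↦
        F (gluePath n q.1 (q.1 n + q.2))) :=
      hF.comp (hg.comp (by fun_prop : Measurable
        (fun q : (ℕ → EuclideanSpace ℝ (Fin d)) × EuclideanSpace ℝ (Fin d) ↦ (q.1, q.1 n + q.2))))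
    have hDg : Measurable (fun q : (ℕ → EuclideanSpace ℝ (Fin d)) × EuclideanSpace ℝ (Fin d) ↦
        pathDensity δ f (n + 1) (gluePath n q.1 (q.1 n + q.2))) :=
      hD1.comp (hg.comp (by fun_prop : Measurable
        (fun q : (ℕ → EuclideanSpace ℝ (Fin d)) × EuclideanSpace ℝ (Fin d) ↦ (q.1, q.1 n + q.2))))
    -- Cameron-Martin for the last increment with the past `p` frozen; its drift then depends on `p`
    -- only.
    have hmul (p : ℕ → EuclideanSpace ℝ (Fin d)) :
        ∫⁻ z, F (gluePath n p (p n + (δ (n + 1) • f (n + 1) (p n) + √(δ (n + 1)) • z)))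
          ∂(stdGaussian (EuclideanSpace ℝ (Fin d)))
        = ∫⁻ z, F (gluePath n p (p n + √(δ (n + 1)) • z)) * ENNReal.ofReal
          (shiftDensity (δ (n + 1)) (f (n + 1) (p n)) (√(δ (n + 1)) • z))
          ∂(stdGaussian (EuclideanSpace ℝ (Fin d))) :=
      (lintegral_stdGaussian_mul_shiftDensity_sqrt (hδ (n + 1))
        (F := fun v ↦ F (gluePath n p (p n + v))) (hFg.comp measurable_prodMk_left) _).symm
    have hl := lintegral_stoppedNoisePath_prod (δ := δ) hf n
      (H := fun q ↦ F (gluePath n q.1 (q.1 n + (δ (n + 1) • f (n + 1) (q.1 n)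
        + √(δ (n + 1)) • q.2)))) (hFg.comp (by fun_prop : Measurable
        (fun q : (ℕ → EuclideanSpace ℝ (Fin d)) × EuclideanSpace ℝ (Fin d) ↦
          (q.1, δ (n + 1) • f (n + 1) (q.1 n) + √(δ (n + 1)) • q.2))))
    have hr := lintegral_stoppedNoisePath_prod (δ := δ) hf0 n
      (H := fun q ↦ F (gluePath n q.1 (q.1 n + √(δ (n + 1)) • q.2)) * ENNReal.ofReal
        (pathDensity δ f (n + 1) (gluePath n q.1 (q.1 n + √(δ (n + 1)) • q.2))))
      ((hFg.mul hDg.ennreal_ofReal).comp (by fun_prop : Measurable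
        (fun q : (ℕ → EuclideanSpace ℝ (Fin d)) × EuclideanSpace ℝ (Fin d) ↦
          (q.1, √(δ (n + 1)) • q.2))))
    simp only [stoppedNoisePath_self] at hl hr
    simp_rw [stoppedNoisePath_succ, smul_zero, zero_add]
    rw [hl, hr]
    have hm := fun w ↦ hmul (stoppedNoisePath δ f n w)
    simp only [stoppedNoisePath_self] at hm
    simp_rw [hm]
    -- The induction hypothesis is applied to the functional in which the last increment has already
    -- been integrated out.
    have hih := ih (F := fun p ↦ ∫⁻ z, F (gluePath n p (p n + √(δ (n + 1)) • z)) * ENNReal.ofReal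
      (shiftDensity (δ (n + 1)) (f (n + 1) (p n)) (√(δ (n + 1)) • z))
      ∂(stdGaussian (EuclideanSpace ℝ (Fin d)))) (Measurable.lintegral_prod_right'
        (f := fun q : (ℕ → EuclideanSpace ℝ (Fin d)) × EuclideanSpace ℝ (Fin d) ↦
        F (gluePath n q.1 (q.1 n + √(δ (n + 1)) • q.2)) * ENNReal.ofReal
      (shiftDensity (δ (n + 1)) (f (n + 1) (q.1 n)) (√(δ (n + 1)) • q.2)))
        ((hFg.comp (by fun_prop : Measurable
        (fun q : (ℕ → EuclideanSpace ℝ (Fin d)) × EuclideanSpace ℝ (Fin d) ↦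
          (q.1, √(δ (n + 1)) • q.2)))).mul (by fun_prop)))
    simp only [stoppedNoisePath_self] at hih
    rw [hih]
    congr 1; ext1 w
    rw [← lintegral_mul_const' _ _ ENNReal.ofReal_ne_top]
    congr 1; ext1 z
    have hpd := pathDensity_glue (δ := δ) (f := f) n (stoppedNoisePath δ (fun _ _ ↦ 0) n w)
      (√(δ (n + 1)) • z)
    rw [stoppedNoisePath_self] at hpd
    rw [hpd, ENNReal.ofReal_mul (pathDensity_pos _ _).le, mul_assoc]
    congr 1; rw [mul_comm]

lemma map_noisePath_zero (hδ : ∀ k, 0 ≤ δ k) (k : ℕ) :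
    (noiseMeasure d).map (noisePath δ (fun _ _ ↦ 0) k)
      = scaledGaussian (EuclideanSpace ℝ (Fin d)) (∑ j ∈ Finset.range k, δ (j + 1)) := by
  have hf0 : ∀ k, Measurable ((fun _ _ ↦ 0 : ℕ → EuclideanSpace ℝ (Fin d) →
      EuclideanSpace ℝ (Fin d)) k) := fun k ↦ measurable_const
  induction k with
  | zero => simp [funext (noisePath_zero δ (fun _ _ ↦ (0 : EuclideanSpace ℝ (Fin d)))),
      Measure.map_const]
  | succ k ih =>
    have hm := measurable_noisePath (δ := δ) hf0 k
    have hind := (indepFun_stoppedNoisePath (δ := δ) hf0 k).comp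
      (measurable_pi_apply k) (by fun_prop : Measurable
        (fun z : EuclideanSpace ℝ (Fin d) ↦ √(δ (k + 1)) • z))
    have e1 : (fun p : ℕ → EuclideanSpace ℝ (Fin d) ↦ p k) ∘ stoppedNoisePath δ (fun _ _ ↦ 0) k
        = noisePath δ (fun _ _ ↦ 0) k := by ext1 w; simp
    rw [e1] at hind
    have h := hind.map_add_eq_map_conv_map hm (by fun_prop)
    have e2 : noisePath δ (fun _ _ ↦ 0) (k + 1) = noisePath δ (fun _ _ ↦ 0) k
        + (fun z : EuclideanSpace ℝ (Fin d) ↦ √(δ (k + 1)) • z) ∘ fun w ↦ w (k + 1) := by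
      ext1 w; simp [noisePath_succ]
    rw [e2, h, ih, ← Measure.map_map (by fun_prop) (by fun_prop), noiseMeasure_map_eval,
      Finset.sum_range_succ, ← scaledGaussian_conv (Finset.sum_nonneg fun j _ ↦ hδ _) (hδ _)]
    rfl

end SamplingPath

/-! ### The conditional mean and the expected one-step log-likelihood. -/

section PosteriorMean

open scoped RealInnerProductSpace

variable {E : Type*} [NormedAddCommGroup E] [InnerProductSpace ℝ E] [FiniteDimensional ℝ E]
  [MeasurableSpace E] [BorelSpace E]

/-- The conditional mean of `X` given `s X + √s N = y`. -/
noncomputable def postMean (μ : Measure E) (s : ℝ) (y : E) : E :=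
  (mixDensity μ s y)⁻¹ • mixGradient μ s y

lemma measurable_postMean (μ : Measure E) [SFinite μ] (s : ℝ) : Measurable (postMean μ s) :=
  (measurable_mixDensity μ s).inv.smul (measurable_mixGradient μ s)

variable {μ : Measure E} [IsProbabilityMeasure μ]

/-- The score ∇L/L of the mixture is the conditional mean (Tweedie), which gives the Fisher
information its statistical meaning. -/
lemma integral_norm_sq_postMean (hμ : MemLp id 2 μ) {s : ℝ} (hs : 0 ≤ s) :
    Integrable (fun p : E × E ↦ ‖postMean μ s (s • p.1 + p.2)‖ ^ 2) (μ.prod (scaledGaussian E s)) ∧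
    ∫ p : E × E, ‖postMean μ s (s • p.1 + p.2)‖ ^ 2 ∂(μ.prod (scaledGaussian E s))
      = mixFisher μ s := by
  have hm := measurable_postMean μ s
  have hF : StronglyMeasurable (fun p : E × E ↦ ‖postMean μ s p.2‖ ^ 2) :=
    (hm.comp measurable_snd).norm.pow_const 2 |>.stronglyMeasurable
  have e : ∀ᵐ y ∂(scaledGaussian E s), mixDensity μ s y * ‖postMean μ s y‖ ^ 2
      = ‖mixGradient μ s y‖ ^ 2 / mixDensity μ s y := by
    filter_upwards [ae_mixDensity_pos μ hs] with y hy
    rw [postMean, norm_smul, norm_inv, Real.norm_of_nonneg hy.le]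
    field_simp
  have hi : Integrable (fun p : E × E ↦ shiftDensity s p.1 p.2 • ‖postMean μ s p.2‖ ^ 2)
      (μ.prod (scaledGaussian E s)) := by
    rw [integrable_prod_iff' (Measurable.aestronglyMeasurable (by fun_prop))]
    constructor
    · filter_upwards [ae_integrable_shiftDensity μ hs] with y hy using hy.mul_const _
    · simp_rw [norm_smul, norm_pow, norm_norm, Real.norm_eq_abs,
        abs_of_pos (shiftDensity_pos s _ _), integral_mul_const]
      refine (integrable_norm_sq_mixGradient_div hμ hs).congr ?_
      filter_upwards [e] with y hy using hy.symm
  have hi' := (integrable_prod_shiftDensity_smul_iff μ hs hF).1 hi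
  refine ⟨hi', ?_⟩
  rw [← integral_prod_shiftDensity_smul μ hs hF hi', integral_prod_symm _ hi]
  simp_rw [smul_eq_mul, integral_mul_const]
  exact integral_congr_ae e

lemma memLp_postMean (hμ : MemLp id 2 μ) {s : ℝ} (hs : 0 ≤ s) :
    MemLp (fun p : E × E ↦ postMean μ s (s • p.1 + p.2)) 2 (μ.prod (scaledGaussian E s)) := by
  have hm := measurable_postMean μ s
  exact (memLp_two_iff_integrable_sq_norm
    (Measurable.aestronglyMeasurable (by fun_prop))).2 (integral_norm_sq_postMean hμ hs).1

lemma integrable_inner_of_memLp_two {Ω : Type*} [MeasurableSpace Ω] {P : Measure Ω} {f g : Ω → E}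
    (hf : MemLp f 2 P) (hg : MemLp g 2 P) : Integrable (fun ω ↦ ⟪f ω, g ω⟫) P := by
  refine (hf.norm.integrable_sq.add hg.norm.integrable_sq).mono'
    (hf.aestronglyMeasurable.inner hg.aestronglyMeasurable) (.of_forall fun ω ↦ ?_)
  simp only [Real.norm_eq_abs, Pi.add_apply]
  have := abs_real_inner_le_norm (f ω) (g ω)
  nlinarith [sq_nonneg (‖f ω‖ - ‖g ω‖), sq_nonneg (‖f ω‖ + ‖g ω‖)]

/-- Orthogonality of the conditional mean to its error. -/
lemma integral_inner_postMean (hμ : MemLp id 2 μ) {s : ℝ} (hs : 0 ≤ s) :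
    Integrable (fun p : E × E ↦ ⟪postMean μ s (s • p.1 + p.2), p.1⟫)
      (μ.prod (scaledGaussian E s)) ∧
    ∫ p : E × E, ⟪postMean μ s (s • p.1 + p.2), p.1⟫ ∂(μ.prod (scaledGaussian E s))
      = mixFisher μ s := by
  have hm := measurable_postMean μ s
  have hi : Integrable (fun p : E × E ↦ ⟪postMean μ s (s • p.1 + p.2), p.1⟫)
      (μ.prod (scaledGaussian E s)) :=
    integrable_inner_of_memLp_two (memLp_postMean hμ hs) (MemLp.comp_fst hμ _)
  have hF : StronglyMeasurable (fun p : E × E ↦ ⟪postMean μ s p.2, p.1⟫) :=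
    Measurable.stronglyMeasurable (by fun_prop)
  refine ⟨hi, ?_⟩
  rw [← integral_prod_shiftDensity_smul μ hs hF hi,
    integral_prod_symm _ ((integrable_prod_shiftDensity_smul_iff μ hs hF).2 hi)]
  refine integral_congr_ae ?_
  filter_upwards [ae_mixDensity_pos μ hs, ae_integrable_shiftDensity_smul hμ hs] with y hy h1
  simp_rw [smul_eq_mul, ← real_inner_smul_right]
  rw [integral_inner h1]
  change ⟪postMean μ s y, mixGradient μ s y⟫ = _
  rw [postMean, real_inner_smul_left, real_inner_self_eq_norm_sq, div_eq_inv_mul]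

/-- `postMean` is a version of the conditional mean. -/
lemma integral_indicator_postMean (hμ : MemLp id 2 μ) {s : ℝ} (hs : 0 ≤ s) {A : Set E}
    (hA : MeasurableSet A) :
    ∫ p : E × E, A.indicator (postMean μ s) (s • p.1 + p.2) ∂(μ.prod (scaledGaussian E s))
      = ∫ p : E × E, A.indicator (fun _ ↦ p.1) (s • p.1 + p.2)
        ∂(μ.prod (scaledGaussian E s)) := by
  have hm := measurable_postMean μ s
  have mA : MeasurableSet ((fun p : E × E ↦ p.2) ⁻¹' A) := measurable_snd hA
  have mA' : MeasurableSet ((fun p : E × E ↦ s • p.1 + p.2) ⁻¹' A) :=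
    (by fun_prop : Measurable fun p : E × E ↦ s • p.1 + p.2) hA
  have hF1 : StronglyMeasurable (fun p : E × E ↦ A.indicator (postMean μ s) p.2) :=
    ((hm.indicator hA).comp measurable_snd).stronglyMeasurable
  have hF2 : StronglyMeasurable (fun p : E × E ↦ A.indicator (fun _ ↦ p.1) p.2) :=
    (measurable_fst.indicator mA).stronglyMeasurable
  have i1 : Integrable (fun p : E × E ↦ A.indicator (postMean μ s) (s • p.1 + p.2))
      (μ.prod (scaledGaussian E s)) :=
    ((memLp_postMean hμ hs).integrable (by norm_num)).indicator mA'
  have i2 : Integrable (fun p : E × E ↦ A.indicator (fun _ ↦ p.1) (s • p.1 + p.2))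
      (μ.prod (scaledGaussian E s)) :=
    ((integrable_of_memLp hμ).comp_fst _).indicator mA'
  rw [← integral_prod_shiftDensity_smul μ hs hF1 i1, ← integral_prod_shiftDensity_smul μ hs hF2 i2,
    integral_prod_symm _ ((integrable_prod_shiftDensity_smul_iff μ hs hF1).2 i1),
    integral_prod_symm _ ((integrable_prod_shiftDensity_smul_iff μ hs hF2).2 i2)]
  refine integral_congr_ae ?_
  filter_upwards [ae_mixDensity_pos μ hs] with y hy
  simp_rw [integral_smul_const]
  change mixDensity μ s y • _ = _
  by_cases hyA : y ∈ A
  · simp only [hyA, Set.indicator_of_mem]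
    rw [postMean, smul_smul, mul_inv_cancel₀ hy.ne', one_smul]
    rfl
  · simp [hyA]

/-- With m the conditional mean, the log-likelihood is η⟪m, X⟫ plus centred noise minus (η/2)‖m‖².
Both quadratic terms average to multiples of the Fisher information, leaving η - η/2. -/
lemma integral_log_shiftDensity_postMean (hμ : MemLp id 2 μ) {s : ℝ} (hs : 0 ≤ s) (η : ℝ) :
    Integrable (fun q : (E × E) × E ↦ Real.log (shiftDensity η (postMean μ s (s • q.1.1 + q.1.2))
      (η • q.1.1 + √η • q.2))) ((μ.prod (scaledGaussian E s)).prod (stdGaussian E)) ∧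
    ∫ q : (E × E) × E, Real.log (shiftDensity η (postMean μ s (s • q.1.1 + q.1.2))
        (η • q.1.1 + √η • q.2)) ∂((μ.prod (scaledGaussian E s)).prod (stdGaussian E))
      = η / 2 * mixFisher μ s := by
  obtain ⟨i1, e1⟩ := integral_inner_postMean hμ hs
  obtain ⟨i2, e2⟩ := integral_norm_sq_postMean hμ hs
  have j1 := (i1.comp_fst (stdGaussian E)).const_mul η
  have j2 := (i2.comp_fst (stdGaussian E)).const_mul (η / 2)
  have j3 : Integrable (fun q : (E × E) × E ↦ √η * ⟪postMean μ s (s • q.1.1 + q.1.2), q.2⟫)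
      ((μ.prod (scaledGaussian E s)).prod (stdGaussian E)) :=
    (integrable_inner_of_memLp_two ((memLp_postMean hμ hs).comp_fst _)
      ((IsGaussian.memLp_two_id (μ := stdGaussian E)).comp_snd _)).const_mul _
  have e3 : ∫ q : (E × E) × E, √η * ⟪postMean μ s (s • q.1.1 + q.1.2), q.2⟫
      ∂((μ.prod (scaledGaussian E s)).prod (stdGaussian E)) = 0 := by
    rw [integral_prod _ j3]
    simp_rw [integral_const_mul, integral_inner (IsGaussian.integrable_fun_id (μ := stdGaussian E)),
      integral_id_stdGaussian]
    simp
  have e (q : (E × E) × E) : Real.log (shiftDensity η (postMean μ s (s • q.1.1 + q.1.2))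
      (η • q.1.1 + √η • q.2)) = η * ⟪postMean μ s (s • q.1.1 + q.1.2), q.1.1⟫
        + √η * ⟪postMean μ s (s • q.1.1 + q.1.2), q.2⟫
        - η / 2 * ‖postMean μ s (s • q.1.1 + q.1.2)‖ ^ 2 := by
    rw [shiftDensity, Real.log_exp, inner_add_right, real_inner_smul_right, real_inner_smul_right]
  simp_rw [e]
  refine ⟨(j1.add j3).sub j2, ?_⟩
  rw [integral_sub (f := fun q : (E × E) × E ↦ η * ⟪postMean μ s (s • q.1.1 + q.1.2), q.1.1⟫
        + √η * ⟪postMean μ s (s • q.1.1 + q.1.2), q.2⟫) (j1.add j3) j2,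
    integral_add j1 j3, e3, integral_const_mul, integral_const_mul,
    integral_fun_fst (fun p : E × E ↦ ⟪postMean μ s (s • p.1 + p.2), p.1⟫),
    integral_fun_fst (fun p : E × E ↦ ‖postMean μ s (s • p.1 + p.2)‖ ^ 2), e1, e2]
  simp; ring

end PosteriorMean

/-! ### Path laws and their densities relative to the driftless path. -/

section PathDivergence

open scoped RealInnerProductSpace

variable {d : ℕ} {δ : ℕ → ℝ} {f : ℕ → EuclideanSpace ℝ (Fin d) → EuclideanSpace ℝ (Fin d)}

/-- The partial sums of the step sizes. -/
noncomputable def stepTime (δ : ℕ → ℝ) (k : ℕ) : ℝ := ∑ j ∈ Finset.range k, δ (j + 1)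

lemma stepTime_nonneg (hδ : ∀ k, 0 ≤ δ k) (k : ℕ) : 0 ≤ stepTime δ k :=
  Finset.sum_nonneg fun _ _ ↦ hδ _

lemma noisePath_const_eq (x : EuclideanSpace ℝ (Fin d)) (k : ℕ)
    (w : ℕ → EuclideanSpace ℝ (Fin d)) :
    noisePath δ (fun _ _ ↦ x) k w = stepTime δ k • x + noisePath δ (fun _ _ ↦ 0) k w :=
  noisePath_const δ x k w

lemma measurable_noisePath_zero (k : ℕ) :
    Measurable (noisePath δ (fun _ _ ↦ (0 : EuclideanSpace ℝ (Fin d))) k) :=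
  measurable_noisePath (fun _ ↦ measurable_const) k

lemma map_noisePath_zero_eq (hδ : ∀ k, 0 ≤ δ k) (k : ℕ) :
    (noiseMeasure d).map (noisePath δ (fun _ _ ↦ 0) k)
      = scaledGaussian (EuclideanSpace ℝ (Fin d)) (stepTime δ k) :=
  map_noisePath_zero hδ k

lemma map_prod_noisePath {Ω : Type*} [MeasurableSpace Ω] {P : Measure Ω} [IsProbabilityMeasure P]
    {X : Ω → EuclideanSpace ℝ (Fin d)} {N : ℕ → Ω → EuclideanSpace ℝ (Fin d)}
    {μ : Measure (EuclideanSpace ℝ (Fin d))} (hX : Measurable X) (hN : ∀ k, Measurable (N k))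
    (hXlaw : P.map X = μ) (hNlaw : ∀ k, P.map (N k) = stdGaussian (EuclideanSpace ℝ (Fin d)))
    (hNindep : iIndepFun N P) (hXN : IndepFun X (fun ω k ↦ N k ω) P) :
    P.map (fun ω ↦ (X ω, fun k ↦ N k ω)) = μ.prod (noiseMeasure d) := by
  rw [(indepFun_iff_map_prod_eq_prod_map_map hX.aemeasurable
    (measurable_pi_lambda _ hN).aemeasurable).1 hXN, hXlaw, hNindep.map_fun_eq_infinitePi_map hN]
  simp_rw [hNlaw]
  rfl

lemma pathLaw_samplingProcess {Ω : Type*} [MeasurableSpace Ω] {P : Measure Ω}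
    [IsProbabilityMeasure P] {N : ℕ → Ω → EuclideanSpace ℝ (Fin d)} (hN : ∀ k, Measurable (N k))
    (hNlaw : ∀ k, P.map (N k) = stdGaussian (EuclideanSpace ℝ (Fin d))) (hNindep : iIndepFun N P)
    (hf : ∀ k, Measurable (f k)) (n : ℕ) :
    pathLaw P (samplingProcess δ f N) n
      = (noiseMeasure d).map (fun w (i : Fin n) ↦ noisePath δ f (i + 1) w) := by
  have h : P.map (fun ω k ↦ N k ω) = noiseMeasure d := by
    rw [hNindep.map_fun_eq_infinitePi_map hN]; simp_rw [hNlaw]; rfl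
  rw [← h, Measure.map_map (measurable_pi_lambda _ fun i ↦ measurable_noisePath hf _)
    (measurable_pi_lambda _ hN), pathLaw]
  congr 1
  ext1 ω; ext1 i
  exact samplingProcess_eq_noisePath δ f N _ ω

lemma measurable_uncurry_noisePath_const (k : ℕ) :
    Measurable (fun q : EuclideanSpace ℝ (Fin d) × (ℕ → EuclideanSpace ℝ (Fin d)) ↦
      noisePath δ (fun _ _ ↦ q.1) k q.2) := by
  have := measurable_noisePath_zero (d := d) (δ := δ) k
  rw [funext fun q : EuclideanSpace ℝ (Fin d) × (ℕ → EuclideanSpace ℝ (Fin d)) ↦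
    noisePath_const_eq q.1 k q.2]
  fun_prop

lemma pathLaw_comparisonProcess {Ω : Type*} [MeasurableSpace Ω] {P : Measure Ω}
    {X : Ω → EuclideanSpace ℝ (Fin d)} {N : ℕ → Ω → EuclideanSpace ℝ (Fin d)}
    {μ : Measure (EuclideanSpace ℝ (Fin d))} (hX : Measurable X) (hN : ∀ k, Measurable (N k))
    (hlaw : P.map (fun ω ↦ (X ω, fun k ↦ N k ω)) = μ.prod (noiseMeasure d)) (n : ℕ) :
    pathLaw P (comparisonProcess δ X N) n
      = (μ.prod (noiseMeasure d)).map (fun q (i : Fin n) ↦ noisePath δ (fun _ _ ↦ q.1) (i + 1) q.2) := by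
  rw [← hlaw, Measure.map_map
    (measurable_pi_lambda _ fun i ↦ measurable_uncurry_noisePath_const _)
    (hX.prodMk (measurable_pi_lambda _ hN)), pathLaw]
  congr 1
  ext1 ω; ext1 i
  exact comparisonProcess_eq_noisePath δ X N _ ω

/-- Extend a finite path by `0` at time `0`. -/
noncomputable def extendPath {n : ℕ} (q : Fin n → EuclideanSpace ℝ (Fin d)) :
    ℕ → EuclideanSpace ℝ (Fin d) :=
  fun k ↦ if h : 1 ≤ k ∧ k ≤ n then q ⟨k - 1, by omega⟩ else 0

lemma measurable_extendPath (n : ℕ) :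
    Measurable (extendPath (d := d) (n := n)) := by
  refine measurable_pi_lambda _ fun k ↦ ?_
  by_cases h : 1 ≤ k ∧ k ≤ n
  · simp only [extendPath, h, and_self, dite_true]; fun_prop
  · simp only [extendPath, h, dite_false]; fun_prop

lemma extendPath_noisePath {n k : ℕ} (hk : k ≤ n) (w : ℕ → EuclideanSpace ℝ (Fin d)) :
    extendPath (fun i : Fin n ↦ noisePath δ f (i + 1) w) k = noisePath δ f k w := by
  rcases Nat.eq_zero_or_pos k with rfl | h
  · simp [extendPath]
  · have h2 : 1 ≤ k ∧ k ≤ n := ⟨h, hk⟩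
    simp only [extendPath, h2, and_self, dite_true]
    congr 1; omega

/-- For constant drift the increments telescope: the end point is a sufficient statistic for x. -/
lemma pathDensity_const (x : EuclideanSpace ℝ (Fin d)) (n : ℕ)
    (p : ℕ → EuclideanSpace ℝ (Fin d)) :
    pathDensity δ (fun _ _ ↦ x) n p = shiftDensity (stepTime δ n) x (p n - p 0) := by
  induction n with
  | zero => simp [pathDensity, stepTime, shiftDensity]
  | succ n ih =>
    have h : pathDensity δ (fun _ _ ↦ x) (n + 1) p = pathDensity δ (fun _ _ ↦ x) n p
        * shiftDensity (δ (n + 1)) x (p (n + 1) - p n) := Finset.prod_range_succ _ _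
    rw [h, ih, shiftDensity_mul_shiftDensity,
      stepTime, stepTime, Finset.sum_range_succ]
    congr 1; abel

lemma lintegral_noisePath (hδ : ∀ k, 0 ≤ δ k) (hf : ∀ k, Measurable (f k)) (n : ℕ)
    {F : (Fin n → EuclideanSpace ℝ (Fin d)) → ℝ≥0∞} (hF : Measurable F) :
    ∫⁻ w, F (fun i ↦ noisePath δ f (i + 1) w) ∂(noiseMeasure d)
      = ∫⁻ w, F (fun i ↦ noisePath δ (fun _ _ ↦ 0) (i + 1) w)
        * ENNReal.ofReal (pathDensity δ f n (fun k ↦ noisePath δ (fun _ _ ↦ 0) k w))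
        ∂(noiseMeasure d) := by
  have h := lintegral_stoppedNoisePath hδ hf n
    (F := fun p ↦ F (fun i ↦ p (i + 1))) (hF.comp (by fun_prop))
  have e (g : ℕ → EuclideanSpace ℝ (Fin d) → EuclideanSpace ℝ (Fin d)) (w) :
      (fun i : Fin n ↦ stoppedNoisePath δ g n w (i + 1)) = fun i : Fin n ↦ noisePath δ g (i + 1) w := by
    ext1 i
    rw [stoppedNoisePath, min_eq_left (by omega)]
  simp_rw [e] at h
  rw [h]
  congr 1; ext1 w
  congr 2
  exact pathDensity_congr fun k hk ↦ by rw [stoppedNoisePath, min_eq_left hk]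

lemma map_noisePath_eq_withDensity (hδ : ∀ k, 0 ≤ δ k) (hf : ∀ k, Measurable (f k)) (n : ℕ) :
    (noiseMeasure d).map (fun w (i : Fin n) ↦ noisePath δ f (i + 1) w)
      = ((noiseMeasure d).map (fun w (i : Fin n) ↦ noisePath δ (fun _ _ ↦ 0) (i + 1) w)).withDensity
        (fun q ↦ ENNReal.ofReal (pathDensity δ f n (extendPath q))) := by
  have hm := measurable_pi_lambda (fun w (i : Fin n) ↦ noisePath δ f (i + 1) w)
    fun i ↦ measurable_noisePath hf _
  have hm0 := measurable_pi_lambda (fun w (i : Fin n) ↦ noisePath δ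
    (fun _ _ ↦ (0 : EuclideanSpace ℝ (Fin d))) (i + 1) w) fun i ↦ measurable_noisePath_zero _
  have hD : Measurable (fun q : Fin n → EuclideanSpace ℝ (Fin d) ↦
      ENNReal.ofReal (pathDensity δ f n (extendPath q))) :=
    ((measurable_pathDensity hf n).comp (measurable_extendPath n)).ennreal_ofReal
  refine Measure.ext_of_lintegral _ fun F hF ↦ ?_
  rw [lintegral_map hF hm, lintegral_withDensity_eq_lintegral_mul _ hD hF,
    lintegral_map (hD.mul hF) hm0, lintegral_noisePath hδ hf n hF]
  congr 1; ext1 w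
  rw [Pi.mul_apply, mul_comm]
  congr 2
  exact pathDensity_congr fun k hk ↦ (extendPath_noisePath hk w).symm

lemma ae_extendPath {p : EuclideanSpace ℝ (Fin d) → Prop} (hp : MeasurableSet {y | p y})
    (hδ : ∀ k, 0 ≤ δ k) (n : ℕ)
    (h : ∀ᵐ y ∂(scaledGaussian (EuclideanSpace ℝ (Fin d)) (stepTime δ n)), p y) :
    ∀ᵐ q ∂((noiseMeasure d).map (fun w (i : Fin n) ↦ noisePath δ (fun _ _ ↦ 0) (i + 1) w)),
      p (extendPath q n) := by
  have hm0 := measurable_pi_lambda (fun w (i : Fin n) ↦ noisePath δ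
    (fun _ _ ↦ (0 : EuclideanSpace ℝ (Fin d))) (i + 1) w) fun i ↦ measurable_noisePath_zero _
  have hs : MeasurableSet {q : Fin n → EuclideanSpace ℝ (Fin d) | p (extendPath q n)} :=
    ((measurable_pi_apply n).comp (measurable_extendPath n)) hp
  rw [ae_map_iff hm0.aemeasurable hs]
  rw [← map_noisePath_zero_eq hδ, ae_map_iff (measurable_noisePath_zero n).aemeasurable hp]
    at h
  filter_upwards [h] with w hw
  rwa [extendPath_noisePath le_rfl]

/-- Girsanov for each fixed drift x, then Fubini in x. Since each density sees only the end point,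
so does the mixture. -/
lemma map_prod_noisePath_eq_withDensity (μ : Measure (EuclideanSpace ℝ (Fin d)))
    [IsProbabilityMeasure μ] (hδ : ∀ k, 0 ≤ δ k) (n : ℕ) :
    (μ.prod (noiseMeasure d)).map (fun q (i : Fin n) ↦ noisePath δ (fun _ _ ↦ q.1) (i + 1) q.2)
      = ((noiseMeasure d).map (fun w (i : Fin n) ↦ noisePath δ (fun _ _ ↦ 0) (i + 1) w)).withDensity
        (fun q ↦ ENNReal.ofReal (mixDensity μ (stepTime δ n) (extendPath q n))) := by
  have hm := measurable_pi_lambda (fun (q : EuclideanSpace ℝ (Fin d) ×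
    (ℕ → EuclideanSpace ℝ (Fin d))) (i : Fin n) ↦ noisePath δ (fun _ _ ↦ q.1) (i + 1) q.2)
    fun i ↦ measurable_uncurry_noisePath_const _
  have hm0 := measurable_pi_lambda (fun w (i : Fin n) ↦ noisePath δ
    (fun _ _ ↦ (0 : EuclideanSpace ℝ (Fin d))) (i + 1) w) fun i ↦ measurable_noisePath_zero _
  have hB := measurable_noisePath_zero (d := d) (δ := δ) n
  have hD : Measurable (fun q : Fin n → EuclideanSpace ℝ (Fin d) ↦
      ENNReal.ofReal (mixDensity μ (stepTime δ n) (extendPath q n))) :=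
    ((measurable_mixDensity μ _).comp
      ((measurable_pi_apply n).comp (measurable_extendPath n))).ennreal_ofReal
  refine Measure.ext_of_lintegral _ fun F hF ↦ ?_
  have hFm : Measurable (fun q : EuclideanSpace ℝ (Fin d) × (ℕ → EuclideanSpace ℝ (Fin d)) ↦
      F (fun i : Fin n ↦ noisePath δ (fun _ _ ↦ q.1) (i + 1) q.2)) := hF.comp hm
  rw [lintegral_map hF hm, lintegral_withDensity_eq_lintegral_mul _ hD hF,
    lintegral_map (hD.mul hF) hm0, lintegral_prod _ hFm.aemeasurable]
  have h1 (x : EuclideanSpace ℝ (Fin d)) := lintegral_noisePath (f := fun _ _ ↦ x) hδ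
    (fun _ ↦ measurable_const) n hF
  simp_rw [h1, pathDensity_const, noisePath_zero, sub_zero]
  rw [lintegral_lintegral_swap (Measurable.aemeasurable
    (((hF.comp hm0).comp measurable_snd).mul (by fun_prop)))]
  refine lintegral_congr_ae ?_
  have hae := ae_integrable_shiftDensity μ (stepTime_nonneg hδ n)
  rw [← map_noisePath_zero_eq hδ] at hae
  filter_upwards [ae_of_ae_map hB.aemeasurable hae] with w hw
  rw [lintegral_const_mul _ (by fun_prop), Pi.mul_apply, extendPath_noisePath le_rfl, mixDensity,
    ofReal_integral_eq_lintegral_ofReal hw (.of_forall fun x ↦ (shiftDensity_pos _ _ _).le),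
    mul_comm]

/-- The signal, the past noise and the next noise are independent; one step of the path thus reduces
to a three-fold product measure. -/
lemma map_prod_noisePath_increment (μ : Measure (EuclideanSpace ℝ (Fin d)))
    [IsProbabilityMeasure μ] (hδ : ∀ k, 0 ≤ δ k) (k : ℕ) :
    (μ.prod (noiseMeasure d)).map (fun q ↦ ((q.1, noisePath δ (fun _ _ ↦ 0) k q.2), q.2 (k + 1)))
      = (μ.prod (scaledGaussian (EuclideanSpace ℝ (Fin d)) (stepTime δ k))).prod
        (stdGaussian (EuclideanSpace ℝ (Fin d))) := by
  have hB := measurable_noisePath_zero (d := d) (δ := δ) k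
  have hf0 : ∀ k, Measurable ((fun _ _ ↦ 0 : ℕ → EuclideanSpace ℝ (Fin d) →
      EuclideanSpace ℝ (Fin d)) k) := fun k ↦ measurable_const
  refine Measure.ext_of_lintegral _ fun F hF ↦ ?_
  have h1 (x : EuclideanSpace ℝ (Fin d)) := lintegral_stoppedNoisePath_prod (δ := δ) hf0 k
    (H := fun r ↦ F ((x, r.1 k), r.2)) (hF.comp (by fun_prop))
  simp only [stoppedNoisePath_self] at h1
  have hFi : Measurable fun p ↦ ∫⁻ z, F (p, z) ∂(stdGaussian (EuclideanSpace ℝ (Fin d))) :=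
    hF.lintegral_prod_right'
  have hFm : Measurable (fun q : EuclideanSpace ℝ (Fin d) × (ℕ → EuclideanSpace ℝ (Fin d)) ↦
      F ((q.1, noisePath δ (fun _ _ ↦ 0) k q.2), q.2 (k + 1))) := hF.comp (by fun_prop)
  rw [lintegral_map hF (by fun_prop), lintegral_prod _ hFm.aemeasurable, lintegral_prod _ hF.aemeasurable,
    lintegral_prod _ hFi.aemeasurable]
  congr 1; ext1 x
  rw [h1 x, ← map_noisePath_zero_eq hδ]
  exact (lintegral_map (hFi.comp measurable_prodMk_left) hB).symm

lemma map_prod_noisePath_pair (μ : Measure (EuclideanSpace ℝ (Fin d)))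
    [IsProbabilityMeasure μ] (hδ : ∀ k, 0 ≤ δ k) (k : ℕ) :
    (μ.prod (noiseMeasure d)).map (fun q ↦ (q.1, noisePath δ (fun _ _ ↦ 0) k q.2))
      = μ.prod (scaledGaussian (EuclideanSpace ℝ (Fin d)) (stepTime δ k)) := by
  have h := Measure.map_prod_map μ (noiseMeasure d) measurable_id
    (measurable_noisePath_zero (d := d) (δ := δ) k)
  rw [map_noisePath_zero_eq hδ, Measure.map_id] at h
  exact h.symm

end PathDivergence

/-! ### The exact formula for the path divergence. -/

section PathKL

open scoped RealInnerProductSpace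

variable {d : ℕ} {δ : ℕ → ℝ} {f : ℕ → EuclideanSpace ℝ (Fin d) → EuclideanSpace ℝ (Fin d)}
  {Ω : Type*} [MeasurableSpace Ω] {P : Measure Ω} [IsProbabilityMeasure P]
  {X : Ω → EuclideanSpace ℝ (Fin d)} {N : ℕ → Ω → EuclideanSpace ℝ (Fin d)}
  {μ : Measure (EuclideanSpace ℝ (Fin d))} [IsProbabilityMeasure μ]

/-- Conditional mean estimators agree with `postMean`. -/
lemma ae_eq_postMean (hμ : MemLp id 2 μ) (hδ : ∀ k, 0 ≤ δ k) (hX : Measurable X)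
    (hN : ∀ k, Measurable (N k))
    (hlaw : P.map (fun ω ↦ (X ω, fun k ↦ N k ω)) = μ.prod (noiseMeasure d)) (k : ℕ)
    {g : EuclideanSpace ℝ (Fin d) → EuclideanSpace ℝ (Fin d)}
    (hg : IsCondMeanEstimator P X (comparisonProcess δ X N k) g) :
    ∀ᵐ p ∂(μ.prod (scaledGaussian (EuclideanSpace ℝ (Fin d)) (stepTime δ k))),
      g (stepTime δ k • p.1 + p.2) = postMean μ (stepTime δ k) (stepTime δ k • p.1 + p.2) := by
  obtain ⟨hgm, hg⟩ := hg
  have ht := stepTime_nonneg hδ k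
  have hpm := measurable_postMean μ (stepTime δ k)
  have hB := measurable_noisePath_zero (d := d) (δ := δ) k
  have hNm : Measurable (fun ω k ↦ N k ω) := measurable_pi_lambda _ hN
  set V : Ω → EuclideanSpace ℝ (Fin d) × EuclideanSpace ℝ (Fin d) :=
    fun ω ↦ (X ω, noisePath δ (fun _ _ ↦ 0) k (fun k ↦ N k ω)) with hVdef
  have hV : Measurable V := hX.prodMk (hB.comp hNm)
  have hVlaw : P.map V = μ.prod (scaledGaussian (EuclideanSpace ℝ (Fin d)) (stepTime δ k)) := by
    rw [← map_prod_noisePath_pair μ hδ k, ← hlaw, Measure.map_map (by fun_prop) (by fun_prop)]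
    rfl
  have hY : comparisonProcess δ X N k = fun ω ↦ stepTime δ k • (V ω).1 + (V ω).2 := by
    ext1 ω
    rw [comparisonProcess_eq_noisePath, noisePath_const_eq]
  have hYm : Measurable (comparisonProcess δ X N k) := by rw [hY]; fun_prop
  have hXV : Integrable X P := by
    have h := (integrable_of_memLp hμ).comp_fst
      (scaledGaussian (EuclideanSpace ℝ (Fin d)) (stepTime δ k))
    rw [← hVlaw] at h
    exact (integrable_map_measure (by fun_prop) hV.aemeasurable).1 h
  have hpV : Integrable (fun ω ↦ postMean μ (stepTime δ k) (comparisonProcess δ X N k ω)) P := by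
    have h := (memLp_postMean hμ ht).integrable (by norm_num)
    rw [← hVlaw] at h
    rw [hY]
    exact (integrable_map_measure (Measurable.aestronglyMeasurable (by fun_prop))
      hV.aemeasurable).1 h
  -- Almost sure uniqueness of conditional expectations turns this into agreement of `g` and
  -- `postMean` along the process.
  have hce : (fun ω ↦ postMean μ (stepTime δ k) (comparisonProcess δ X N k ω))
      =ᵐ[P] P[X | MeasurableSpace.comap (comparisonProcess δ X N k) inferInstance] := by
    refine ae_eq_condExp_of_forall_setIntegral_eq hYm.comap_le hXV
      (fun s _ _ ↦ hpV.integrableOn) ?_ ?_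
    · rintro s ⟨A, hA, rfl⟩ -
      have hF1 : Measurable (fun p : EuclideanSpace ℝ (Fin d) × EuclideanSpace ℝ (Fin d) ↦
          A.indicator (postMean μ (stepTime δ k)) (stepTime δ k • p.1 + p.2)) :=
        (hpm.indicator hA).comp (by fun_prop)
      have hF2 : Measurable (fun p : EuclideanSpace ℝ (Fin d) × EuclideanSpace ℝ (Fin d) ↦
          A.indicator (fun _ ↦ p.1) (stepTime δ k • p.1 + p.2)) :=
        measurable_fst.indicator ((by fun_prop : Measurable fun p : EuclideanSpace ℝ (Fin d) ×
          EuclideanSpace ℝ (Fin d) ↦ stepTime δ k • p.1 + p.2) hA)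
      have h := integral_indicator_postMean hμ ht hA
      rw [← hVlaw, integral_map hV.aemeasurable hF1.aestronglyMeasurable,
        integral_map hV.aemeasurable hF2.aestronglyMeasurable] at h
      rw [← integral_indicator (hYm hA), ← integral_indicator (hYm hA)]
      convert h using 2
      · ext1 ω
        rw [hY]; rfl
      · ext1 ω
        rw [hY]; rfl
    · exact (hpm.comp (comap_measurable _)).stronglyMeasurable.aestronglyMeasurable
  have hae := hg.trans hce.symm
  rw [← hVlaw, ae_map_iff hV.aemeasurable (measurableSet_eq_fun (by fun_prop) (by fun_prop))]
  filter_upwards [hae] with ω hω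
  rwa [hY] at hω

lemma integral_log_shiftDensity_estimator (hμ : MemLp id 2 μ) (hδ : ∀ k, 0 ≤ δ k)
    (k : ℕ) {g : EuclideanSpace ℝ (Fin d) → EuclideanSpace ℝ (Fin d)} (hgm : Measurable g)
    (hg : ∀ᵐ p ∂(μ.prod (scaledGaussian (EuclideanSpace ℝ (Fin d)) (stepTime δ k))),
      g (stepTime δ k • p.1 + p.2) = postMean μ (stepTime δ k) (stepTime δ k • p.1 + p.2)) :
    Integrable (fun q : EuclideanSpace ℝ (Fin d) × (ℕ → EuclideanSpace ℝ (Fin d)) ↦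
      Real.log (shiftDensity (δ (k + 1)) (g (noisePath δ (fun _ _ ↦ q.1) k q.2))
        (noisePath δ (fun _ _ ↦ q.1) (k + 1) q.2 - noisePath δ (fun _ _ ↦ q.1) k q.2)))
      (μ.prod (noiseMeasure d)) ∧
    ∫ q : EuclideanSpace ℝ (Fin d) × (ℕ → EuclideanSpace ℝ (Fin d)),
      Real.log (shiftDensity (δ (k + 1)) (g (noisePath δ (fun _ _ ↦ q.1) k q.2))
        (noisePath δ (fun _ _ ↦ q.1) (k + 1) q.2 - noisePath δ (fun _ _ ↦ q.1) k q.2))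
      ∂(μ.prod (noiseMeasure d)) = δ (k + 1) / 2 * mixFisher μ (stepTime δ k) := by
  have hB := measurable_noisePath_zero (d := d) (δ := δ) k
  obtain ⟨i, e⟩ := integral_log_shiftDensity_postMean hμ (stepTime_nonneg hδ k) (δ (k + 1))
  set H : (EuclideanSpace ℝ (Fin d) × EuclideanSpace ℝ (Fin d)) × EuclideanSpace ℝ (Fin d) → ℝ :=
    fun q ↦ Real.log (shiftDensity (δ (k + 1)) (g (stepTime δ k • q.1.1 + q.1.2))
      (δ (k + 1) • q.1.1 + √(δ (k + 1)) • q.2)) with hH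
  have hHm : Measurable H := by fun_prop
  have hae := (Measure.quasiMeasurePreserving_fst
    (μ := μ.prod (scaledGaussian (EuclideanSpace ℝ (Fin d)) (stepTime δ k)))
    (ν := stdGaussian (EuclideanSpace ℝ (Fin d)))).ae hg
  have hHae := hae.mono fun q hq ↦ (by simp only [hH, hq] : H q = Real.log (shiftDensity (δ (k + 1))
    (postMean μ (stepTime δ k) (stepTime δ k • q.1.1 + q.1.2))
      (δ (k + 1) • q.1.1 + √(δ (k + 1)) • q.2)))
  replace i : Integrable H _ := i.congr (Filter.EventuallyEq.symm hHae)
  rw [← integral_congr_ae hHae] at e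
  have hT : Measurable (fun q : EuclideanSpace ℝ (Fin d) × (ℕ → EuclideanSpace ℝ (Fin d)) ↦
    ((q.1, noisePath δ (fun _ _ ↦ 0) k q.2), q.2 (k + 1))) := by fun_prop
  rw [← map_prod_noisePath_increment μ hδ k] at i e
  rw [integrable_map_measure hHm.aestronglyMeasurable hT.aemeasurable] at i
  rw [integral_map hT.aemeasurable hHm.aestronglyMeasurable] at e
  have heq (q : EuclideanSpace ℝ (Fin d) × (ℕ → EuclideanSpace ℝ (Fin d))) :
      H ((q.1, noisePath δ (fun _ _ ↦ 0) k q.2), q.2 (k + 1)) =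
      Real.log (shiftDensity (δ (k + 1)) (g (noisePath δ (fun _ _ ↦ q.1) k q.2))
        (noisePath δ (fun _ _ ↦ q.1) (k + 1) q.2 - noisePath δ (fun _ _ ↦ q.1) k q.2)) := by
    have : noisePath δ (fun _ _ ↦ q.1) (k + 1) q.2 - noisePath δ (fun _ _ ↦ q.1) k q.2
        = δ (k + 1) • q.1 + √(δ (k + 1)) • q.2 (k + 1) := by
      rw [noisePath_succ]; abel
    rw [this, noisePath_const_eq q.1 k q.2]
  simp_rw [heq] at e
  exact ⟨i.congr (.of_forall heq), e⟩

lemma integral_log_mixDensity_noisePath (hμ : MemLp id 2 μ) (hδ : ∀ k, 0 ≤ δ k) (n : ℕ) :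
    Integrable (fun q : EuclideanSpace ℝ (Fin d) × (ℕ → EuclideanSpace ℝ (Fin d)) ↦
      Real.log (mixDensity μ (stepTime δ n) (noisePath δ (fun _ _ ↦ q.1) n q.2)))
      (μ.prod (noiseMeasure d)) ∧
    ∫ q : EuclideanSpace ℝ (Fin d) × (ℕ → EuclideanSpace ℝ (Fin d)),
      Real.log (mixDensity μ (stepTime δ n) (noisePath δ (fun _ _ ↦ q.1) n q.2))
      ∂(μ.prod (noiseMeasure d)) = mixEntropy μ (stepTime δ n) := by
  have hB := measurable_noisePath_zero (d := d) (δ := δ) n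
  have hm := measurable_mixDensity μ (stepTime δ n)
  have i := integrable_log_mixDensity hμ (stepTime_nonneg hδ n)
  have e := integral_log_mixDensity hμ (stepTime_nonneg hδ n)
  have hT : Measurable (fun q : EuclideanSpace ℝ (Fin d) × (ℕ → EuclideanSpace ℝ (Fin d)) ↦
    (q.1, noisePath δ (fun _ _ ↦ 0) n q.2)) := by fun_prop
  have hHm : Measurable (fun p : EuclideanSpace ℝ (Fin d) × EuclideanSpace ℝ (Fin d) ↦
      Real.log (mixDensity μ (stepTime δ n) (stepTime δ n • p.1 + p.2))) :=
    Measurable.log (by fun_prop)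
  rw [← map_prod_noisePath_pair μ hδ n] at i e
  rw [integrable_map_measure hHm.aestronglyMeasurable hT.aemeasurable] at i
  rw [integral_map hT.aemeasurable hHm.aestronglyMeasurable] at e
  simp_rw [fun q : EuclideanSpace ℝ (Fin d) × (ℕ → EuclideanSpace ℝ (Fin d)) ↦
    noisePath_const_eq (δ := δ) q.1 n q.2]
  exact ⟨i, e⟩

lemma pathLaw_samplingProcess_congr {g : ℕ → EuclideanSpace ℝ (Fin d) → EuclideanSpace ℝ (Fin d)}
    {n : ℕ} (h : ∀ k ∈ Finset.Icc 1 n, f k = g k) :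
    pathLaw P (samplingProcess δ f N) n = pathLaw P (samplingProcess δ g N) n := by
  rw [pathLaw, pathLaw]
  congr 1
  ext1 ω; ext1 i
  rw [samplingProcess_eq_noisePath, samplingProcess_eq_noisePath]
  exact noisePath_congr_left (fun j hj ↦ h j (by simp at hj ⊢; omega)) _

/-- The divergence between the comparison process and the sampling process. -/
lemma klDiv_pathLaw (hμ : MemLp id 2 μ) (hδ : ∀ k, 0 ≤ δ k)
    (hX : Measurable X) (hN : ∀ k, Measurable (N k))
    (hXlaw : P.map X = μ) (hNlaw : ∀ k, P.map (N k) = stdGaussian (EuclideanSpace ℝ (Fin d)))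
    (hNindep : iIndepFun N P) (hXN : IndepFun X (fun ω k ↦ N k ω) P)
    {Ω' : Type*} [MeasurableSpace Ω'] {P' : Measure Ω'} [IsProbabilityMeasure P']
    {N' : ℕ → Ω' → EuclideanSpace ℝ (Fin d)} (hN' : ∀ k, Measurable (N' k))
    (hN'law : ∀ k, P'.map (N' k) = stdGaussian (EuclideanSpace ℝ (Fin d)))
    (hN'indep : iIndepFun N' P') (n : ℕ)
    (hf : ∀ k ∈ Finset.Icc 1 n, IsCondMeanEstimator P X (comparisonProcess δ X N (k - 1)) (f k)) :
    klDiv (pathLaw P (comparisonProcess δ X N) n) (pathLaw P' (samplingProcess δ f N') n)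
      = ENNReal.ofReal (mixEntropy μ (stepTime δ n)
        - ∑ k ∈ Finset.range n, δ (k + 1) / 2 * mixFisher μ (stepTime δ k)) := by
  have hlaw := map_prod_noisePath hX hN hXlaw hNlaw hNindep hXN
  -- Outside 1, …, n nothing is known about `f`; replacing it there by 0 gives measurability at
  -- every index without changing the path law.
  set g : ℕ → EuclideanSpace ℝ (Fin d) → EuclideanSpace ℝ (Fin d) :=
    fun k ↦ if k ∈ Finset.Icc 1 n then f k else 0 with hgdef
  have hfg : ∀ k ∈ Finset.Icc 1 n, f k = g k := fun k hk ↦ by simp only [hgdef, hk, if_true]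
  have hg : ∀ k, Measurable (g k) := fun k ↦ by
    by_cases hk : k ∈ Finset.Icc 1 n
    · rw [← hfg k hk]; exact (hf k hk).1
    · simp only [hgdef, hk, if_false]; exact measurable_const
  have hgpost (k : ℕ) (hk : k < n) := ae_eq_postMean hμ hδ hX hN hlaw k
    (hfg (k + 1) (by simp; omega) ▸ hf (k + 1) (by simp; omega))
  rw [pathLaw_samplingProcess_congr hfg]
  have hPl := pathLaw_comparisonProcess (δ := δ) hX hN hlaw n
  have hQl := pathLaw_samplingProcess (δ := δ) hN' hN'law hN'indep hg n
  have hm := measurable_pi_lambda (fun (q : EuclideanSpace ℝ (Fin d) ×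
    (ℕ → EuclideanSpace ℝ (Fin d))) (i : Fin n) ↦ noisePath δ (fun _ _ ↦ q.1) (i + 1) q.2)
    fun i ↦ measurable_uncurry_noisePath_const _
  have hmg := measurable_pi_lambda (fun w (i : Fin n) ↦ noisePath δ g (i + 1) w)
    fun i ↦ measurable_noisePath hg _
  have hm0 := measurable_pi_lambda (fun w (i : Fin n) ↦ noisePath δ
    (fun _ _ ↦ (0 : EuclideanSpace ℝ (Fin d))) (i + 1) w) fun i ↦ measurable_noisePath_zero _
  have : IsProbabilityMeasure ((noiseMeasure d).map (fun w (i : Fin n) ↦ noisePath δ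
    (fun _ _ ↦ (0 : EuclideanSpace ℝ (Fin d))) (i + 1) w)) :=
    Measure.isProbabilityMeasure_map hm0.aemeasurable
  have : IsProbabilityMeasure (pathLaw P (comparisonProcess δ X N) n) := by
    rw [hPl]; exact Measure.isProbabilityMeasure_map hm.aemeasurable
  have : IsProbabilityMeasure (pathLaw P' (samplingProcess δ g N') n) := by
    rw [hQl]; exact Measure.isProbabilityMeasure_map hmg.aemeasurable
  have hpm : Measurable (fun q : Fin n → EuclideanSpace ℝ (Fin d) ↦
      mixDensity μ (stepTime δ n) (extendPath q n)) :=
    (measurable_mixDensity μ _).comp ((measurable_pi_apply n).comp (measurable_extendPath n))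
  have hqm : Measurable (fun q : Fin n → EuclideanSpace ℝ (Fin d) ↦
      pathDensity δ g n (extendPath q)) :=
    (measurable_pathDensity hg n).comp (measurable_extendPath n)
  have hlm : Measurable (fun q : Fin n → EuclideanSpace ℝ (Fin d) ↦
      Real.log (mixDensity μ (stepTime δ n) (extendPath q n))
        - Real.log (pathDensity δ g n (extendPath q))) := hpm.log.sub hqm.log
  have hpos := ae_extendPath (measurableSet_lt measurable_const
    (measurable_mixDensity μ (stepTime δ n))) hδ n (ae_mixDensity_pos μ (stepTime_nonneg hδ n))
  obtain ⟨iL, eL⟩ := integral_log_mixDensity_noisePath hμ hδ n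
  have hstep (k : ℕ) (hk : k ∈ Finset.range n) := integral_log_shiftDensity_estimator hμ hδ k
    (hg (k + 1)) (hgpost k (Finset.mem_range.1 hk))
  -- The log-likelihood ratio along the comparison path is an end-point term minus a sum of one-step
  -- terms, each with known expectation.
  have hpt (q : EuclideanSpace ℝ (Fin d) × (ℕ → EuclideanSpace ℝ (Fin d))) :
      Real.log (mixDensity μ (stepTime δ n)
        (extendPath (fun i : Fin n ↦ noisePath δ (fun _ _ ↦ q.1) (i + 1) q.2) n))
      - Real.log (pathDensity δ g n
        (extendPath (fun i : Fin n ↦ noisePath δ (fun _ _ ↦ q.1) (i + 1) q.2)))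
      = Real.log (mixDensity μ (stepTime δ n) (noisePath δ (fun _ _ ↦ q.1) n q.2))
        - ∑ k ∈ Finset.range n, Real.log (shiftDensity (δ (k + 1))
          (g (k + 1) (noisePath δ (fun _ _ ↦ q.1) k q.2))
          (noisePath δ (fun _ _ ↦ q.1) (k + 1) q.2 - noisePath δ (fun _ _ ↦ q.1) k q.2)) := by
    rw [extendPath_noisePath le_rfl, pathDensity_congr (q := fun k ↦ noisePath δ (fun _ _ ↦ q.1) k q.2)
      (fun k hk ↦ extendPath_noisePath hk q.2), pathDensity,
      Real.log_prod (fun k _ ↦ (shiftDensity_pos _ _ _).ne')]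
  have iS := integrable_finsetSum (Finset.range n) fun k hk ↦ (hstep k hk).1
  rw [klDiv_withDensity_ofReal hpm hqm hpos (.of_forall fun q ↦ pathDensity_pos _ _)
    (hPl.trans (map_prod_noisePath_eq_withDensity μ hδ n))
    (hQl.trans (map_noisePath_eq_withDensity hδ hg n)), hPl,
    integral_map hm.aemeasurable hlm.aestronglyMeasurable]
  · simp_rw [hpt]
    rw [integral_sub iL iS, eL, integral_finsetSum _ fun k hk ↦ (hstep k hk).1,
      Finset.sum_congr rfl fun k hk ↦ (hstep k hk).2]
  · rw [hPl, integrable_map_measure hlm.aestronglyMeasurable hm.aemeasurable]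
    exact (iL.sub iS).congr (.of_forall fun q ↦ (hpt q).symm)

end PathKL

/-! ### The geometric time grid. -/

section Grid

variable {α T : ℝ} {n : ℕ}

lemma gridTime_zero (α T : ℝ) (n : ℕ) : gridTime α T n 0 = 0 := by
  simp [gridTime]

lemma stepTime_gridStep (α T : ℝ) (n k : ℕ) : stepTime (gridStep α T n) k = gridTime α T n k := by
  simp only [stepTime, gridStep, Nat.add_sub_cancel]
  rw [Finset.sum_range_sub, gridTime_zero, sub_zero]

lemma gridTime_self (hα : 1 < α) (hn : n ≠ 0) : gridTime α T n n = T := by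
  have : α ^ n - 1 ≠ 0 := (sub_pos.2 (one_lt_pow₀ hα hn)).ne'
  rw [gridTime, if_neg hα.ne', div_self this, one_mul]

lemma gridStep_succ (hα : 1 < α) (k : ℕ) :
    gridStep α T n (k + 1) = α ^ k * ((α - 1) / (α ^ n - 1) * T) := by
  rw [gridStep, gridTime, gridTime, if_neg hα.ne', if_neg hα.ne', Nat.add_sub_cancel]
  ring

lemma gridStep_nonneg (hα : 1 < α) (hT : 0 ≤ T) (k : ℕ) : 0 ≤ gridStep α T n k := by
  cases k with
  | zero => simp [gridStep]
  | succ k =>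
    rw [gridStep_succ hα]
    have h1 : 0 ≤ α ^ n - 1 := sub_nonneg.2 (one_le_pow₀ hα.le)
    have h2 : 0 ≤ α - 1 := by linarith
    positivity

lemma gridTime_nonneg (hα : 1 < α) (hT : 0 ≤ T) (k : ℕ) : 0 ≤ gridTime α T n k := by
  rw [← stepTime_gridStep]
  exact stepTime_nonneg (gridStep_nonneg hα hT) k

end Grid

/-! ### Discretization loss and growth of the information. -/

section Information

variable {d : ℕ} {μ : Measure (EuclideanSpace ℝ (Fin d))} [IsProbabilityMeasure μ]

/-- Along a geometric grid, the discretization loss is controlled by the information. -/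
lemma mixEntropy_gridTime_le (hμ : MemLp id 2 μ) {α T : ℝ} {n : ℕ} (hα : 1 < α) (hT : 0 ≤ T)
    (hn : n ≠ 0) :
    mixEntropy μ T
        - ∑ k ∈ Finset.range n, gridStep α T n (k + 1) / 2 * mixFisher μ (gridTime α T n k)
      ≤ (α - 1) * (gaussianChannelInfo μ T).toReal
        + (α - 1) / (α ^ n - 1) * T / 2 * (∫ x, ‖x‖ ^ 2 ∂μ - mixFisher μ 0) := by
  obtain ⟨m, rfl⟩ := Nat.exists_eq_succ_of_ne_zero hn
  set M := ∫ x, ‖x‖ ^ 2 ∂μ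
  set t := gridTime α T (m + 1) with ht
  set δ := gridStep α T (m + 1) with hδ
  set I : ℝ → ℝ := fun s ↦ s / 2 * M - mixEntropy μ s with hI
  have ht0 : ∀ k, 0 ≤ t k := gridTime_nonneg hα hT
  have hδ0 : ∀ k, 0 ≤ δ k := gridStep_nonneg hα hT
  have htT : t (m + 1) = T := gridTime_self hα hn
  have hsucc : ∀ k, t (k + 1) = t k + δ (k + 1) := fun k ↦ by simp [hδ, ht, gridStep]
  -- The error M - F is decreasing in time, so its value at the right end bounds the information
  -- increment from below.
  have hinc : ∀ k, δ (k + 1) / 2 * (M - mixFisher μ (t (k + 1))) ≤ I (t (k + 1)) - I (t k) := by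
    intro k
    have := mixEntropy_le_add_mul_mixFisher hμ (ht0 k) (hδ0 (k + 1))
    rw [← hsucc] at this
    simp only [hI]
    have h2 := hsucc k
    rw [show t (k + 1) / 2 * M = t k / 2 * M + δ (k + 1) / 2 * M by rw [h2]; ring]
    linarith
  have hI0 : I (t 0) = 0 := by simp [hI, ht, gridTime_zero, mixEntropy_zero]
  have hsum : ∑ k ∈ Finset.range (m + 1), δ (k + 1) / 2 * M = T / 2 * M := by
    rw [← Finset.sum_mul, ← Finset.sum_div, ← htT, ht, ← stepTime_gridStep]; rfl
  have hIT : (gaussianChannelInfo μ T).toReal = I T := toReal_gaussianChannelInfo hμ hT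
  have hratio : ∀ k, δ (k + 2) = α * δ (k + 1) := fun k ↦ by
    rw [hδ, gridStep_succ hα, gridStep_succ hα]; ring
  -- The loss uses the error at the left end of step k + 2, which is the right end of step k + 1;
  -- shifting by one step costs exactly the factor α.
  have hterm : ∀ k ∈ Finset.range m, δ (k + 2) / 2 * (M - mixFisher μ (t (k + 1)))
      ≤ α * (I (t (k + 1)) - I (t k)) := fun k _ ↦ by
    have := mul_le_mul_of_nonneg_left (hinc k) (zero_le_one.trans hα.le)
    rw [hratio]
    linarith
  have hlast : I (t m) ≤ I T := by
    have := hinc m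
    have h2 : 0 ≤ δ (m + 1) / 2 * (M - mixFisher μ (t (m + 1))) :=
      mul_nonneg (by have := hδ0 (m + 1); positivity)
        (sub_nonneg.2 (mixFisher_le hμ (ht0 _)))
    rw [htT] at this h2
    linarith
  have htot : ∑ k ∈ Finset.range (m + 1), δ (k + 1) / 2 * (M - mixFisher μ (t k))
      ≤ α * I T + δ 1 / 2 * (M - mixFisher μ 0) := by
    -- The first step has no predecessor to be compared with; its contribution is kept separately.
    rw [Finset.sum_range_succ']
    have h0 : t 0 = 0 := gridTime_zero _ _ _
    rw [h0]
    gcongr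
    calc _ ≤ ∑ k ∈ Finset.range m, α * (I (t (k + 1)) - I (t k)) := Finset.sum_le_sum hterm
      _ = α * I (t m) := by
        rw [← Finset.mul_sum, Finset.sum_range_sub (fun k ↦ I (t k)), hI0, sub_zero]
      _ ≤ α * I T := by gcongr
  have hδ1 : δ 1 = (α - 1) / (α ^ (m + 1) - 1) * T := by
    have := gridStep_succ (T := T) (n := m + 1) hα 0
    rw [hδ]; simpa using this
  rw [hIT, ← hδ1]
  simp only [mul_sub (δ _ / 2), Finset.sum_sub_distrib, hsum] at htot
  have : I T = T / 2 * M - mixEntropy μ T := rfl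
  linarith

lemma toReal_gaussianChannelInfo_mono (hμ : MemLp id 2 μ) {a b : ℝ} (ha : 0 ≤ a) (hab : a ≤ b) :
    (gaussianChannelInfo μ a).toReal ≤ (gaussianChannelInfo μ b).toReal := by
  rw [toReal_gaussianChannelInfo hμ ha, toReal_gaussianChannelInfo hμ (ha.trans hab)]
  have h := mixEntropy_le_add_mul_mixFisher hμ ha (sub_nonneg.2 hab)
  rw [add_sub_cancel] at h
  have h2 := mul_le_mul_of_nonneg_left (mixFisher_le hμ (ha.trans hab))
    (show 0 ≤ (b - a) / 2 by linarith)
  linarith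

/-- On [a, ar] the increment is at most half its length a(r - 1) times the error at a, which is at
most d/a. -/
lemma toReal_gaussianChannelInfo_mul_le (hμ : MemLp id 2 μ) {a r : ℝ} (ha : 0 < a) (hr : 1 ≤ r) :
    (gaussianChannelInfo μ (a * r)).toReal ≤ (gaussianChannelInfo μ a).toReal + d / 2 * (r - 1) := by
  have hs : 0 ≤ a * (r - 1) := mul_nonneg ha.le (by linarith)
  have hr' : a * r = a + a * (r - 1) := by ring
  rw [toReal_gaussianChannelInfo hμ ha.le, toReal_gaussianChannelInfo hμ (by positivity), hr']
  have h := add_mul_mixFisher_le_mixEntropy hμ ha.le hs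
  have h2 := mul_le_mul_of_nonneg_left (le_mixFisher hμ ha) (show 0 ≤ a * (r - 1) / 2 by linarith)
  rw [finrank_euclideanSpace_fin] at h2
  have : a * (r - 1) / 2 * (∫ x, ‖x‖ ^ 2 ∂μ - d / a)
      = a * (r - 1) / 2 * ∫ x, ‖x‖ ^ 2 ∂μ - d / 2 * (r - 1) := by field_simp
  linarith

/-- Iterating over m multiplicative steps of ratio s^(1/m) costs (d/2) m (s^(1/m) - 1), which tends
to (d/2) log s. -/
lemma toReal_gaussianChannelInfo_le (hμ : MemLp id 2 μ) {s : ℝ} (hs : 1 ≤ s) :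
    (gaussianChannelInfo μ s).toReal ≤ (gaussianChannelInfo μ 1).toReal + d / 2 * Real.log s := by
  have hs0 : 0 < s := by linarith
  have hl := Real.log_nonneg hs
  have key (m : ℕ) (hm : m ≠ 0) : (gaussianChannelInfo μ s).toReal
      ≤ (gaussianChannelInfo μ 1).toReal + d / 2 * (m * (Real.exp (Real.log s / m) - 1)) := by
    set r := Real.exp (Real.log s / m)
    have hr : 1 ≤ r := Real.one_le_exp (by positivity)
    have hstep (j : ℕ) : (gaussianChannelInfo μ (r ^ j)).toReal
        ≤ (gaussianChannelInfo μ 1).toReal + d / 2 * (j * (r - 1)) := by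
      induction j with
      | zero => simp
      | succ j ih =>
        have := toReal_gaussianChannelInfo_mul_le hμ (a := r ^ j) (by positivity) hr
        rw [pow_succ]
        push_cast
        linarith
    have hrm : r ^ m = s := by
      rw [← Real.exp_nat_mul, mul_div_cancel₀ _ (by positivity), Real.exp_log hs0]
    simpa only [hrm] using hstep m
  have hlim : Tendsto (fun m : ℕ ↦ (gaussianChannelInfo μ 1).toReal
      + d / 2 * (m * (Real.exp (Real.log s / m) - 1))) atTop
      (𝓝 ((gaussianChannelInfo μ 1).toReal + d / 2 * Real.log s)) := by
    refine tendsto_const_nhds.add (tendsto_const_nhds.mul ?_)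
    -- The limit is the derivative at 0 of u ↦ s^u, sampled along u = 1/m.
    have hd : HasDerivAt (fun u : ℝ ↦ Real.exp (Real.log s * u)) (Real.log s) 0 := by
      simpa using ((hasDerivAt_id (0 : ℝ)).const_mul (Real.log s)).exp
    have := hd.tendsto_slope_zero.comp (f := fun m : ℕ ↦ ((m : ℝ))⁻¹) (x := atTop) ?_
    · refine this.congr fun m ↦ ?_
      simp [div_eq_mul_inv]
    · refine tendsto_nhdsWithin_iff.2 ⟨tendsto_inv_atTop_nhds_zero_nat, ?_⟩
      filter_upwards [eventually_ne_atTop 0] with m hm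
      simpa using hm
  exact ge_of_tendsto hlim ((eventually_ne_atTop 0).mono key)

/-- The error at time 0 is the total variance of X. A bound by it, rather than by an arbitrary
constant, vanishes when d = 0. -/
lemma toReal_gaussianChannelInfo_one_le (hμ : MemLp id 2 μ) :
    (gaussianChannelInfo μ 1).toReal ≤ (∫ x, ‖x‖ ^ 2 ∂μ - mixFisher μ 0) / 2 := by
  have h := add_mul_mixFisher_le_mixEntropy hμ le_rfl zero_le_one
  rw [mixEntropy_zero, zero_add] at h
  rw [toReal_gaussianChannelInfo hμ zero_le_one]
  linarith

/-- A non-degenerate input carries positive information. -/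
lemma toReal_gaussianChannelInfo_one_pos (hμ : MemLp id 2 μ)
    (h : mixFisher μ 0 ≠ ∫ x, ‖x‖ ^ 2 ∂μ) : 0 < (gaussianChannelInfo μ 1).toReal := by
  refine ENNReal.toReal_nonneg.lt_of_ne' fun h0 ↦ h ?_
  have hne : gaussianChannelInfo μ 1 ≠ ∞ := by
    rw [gaussianChannelInfo_eq hμ zero_le_one]; exact ENNReal.ofReal_ne_top
  have hz := (ENNReal.toReal_eq_zero_iff _).1 h0 |>.resolve_right hne
  rw [mixFisher_zero, integral_norm_sq_eq_of_mutualInfo_channel_eq_zero hμ hz]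

end Information

/-! ### Asymptotics of the grid parameters. -/

section Asymptotics

/-- The growth ratio of the grid satisfies `α_n - 1 ∼ log T_n / n`. -/
lemma tendsto_gridRatio {T α : ℕ → ℝ} (hT : Tendsto T atTop atTop)
    (hT' : Tendsto (fun n : ℕ ↦ Real.log (T n) / (n : ℝ)) atTop (𝓝 0))
    (hα : ∀ n : ℕ, α n = (T n * Real.log (T n)) ^ (1 / (n : ℝ))) :
    Tendsto (fun n : ℕ ↦ (α n - 1) * n / Real.log (T n)) atTop (𝓝 1) := by
  have hlog : Tendsto (fun n ↦ Real.log (T n)) atTop atTop := Real.tendsto_log_atTop.comp hT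
  -- Eventually α_n = exp(x_n/n) with x_n = log(T_n log T_n) ∼ log T_n. Since x_n/n → 0, the
  -- derivative of exp at 0 gives the claim.
  set x : ℕ → ℝ := fun n ↦ Real.log (T n) + Real.log (Real.log (T n)) with hx
  have hxl : Tendsto (fun n ↦ x n / Real.log (T n)) atTop (𝓝 1) := by
    have h1 : Tendsto (fun n ↦ 1 + Real.log (Real.log (T n)) / Real.log (T n)) atTop
        (𝓝 (1 + 0)) := by
      refine tendsto_const_nhds.add ?_
      have := Real.isLittleO_log_id_atTop.tendsto_div_nhds_zero
      exact this.comp hlog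
    rw [add_zero] at h1
    refine h1.congr' ?_
    filter_upwards [hlog.eventually_gt_atTop 0] with n hn
    rw [hx, add_div, div_self hn.ne']
  have hxn : Tendsto (fun n : ℕ ↦ x n / n) atTop (𝓝 0) := by
    have := hxl.mul hT'
    rw [mul_zero] at this
    refine this.congr' ?_
    filter_upwards [hlog.eventually_gt_atTop 0] with n hn
    field_simp
  have hd : Tendsto (fun u : ℝ ↦ (Real.exp u - 1) / u) (𝓝[≠] 0) (𝓝 1) := by
    have h : HasDerivAt Real.exp 1 0 := by simpa using Real.hasDerivAt_exp 0
    refine h.tendsto_slope_zero.congr fun u ↦ ?_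
    simp [div_eq_inv_mul]
  have hpos : ∀ᶠ n : ℕ in atTop, 0 < x n ∧ 0 < Real.log (T n) ∧ 0 < T n ∧ n ≠ 0 := by
    filter_upwards [hlog.eventually_gt_atTop 1, hT.eventually_gt_atTop 0,
      eventually_ne_atTop 0] with n h1 h2 h3
    exact ⟨add_pos (by linarith) (Real.log_pos h1), by linarith, h2, h3⟩
  have hc := hd.comp (tendsto_nhdsWithin_iff.2 ⟨hxn, by
    filter_upwards [hpos] with n ⟨h1, _, _, h4⟩
    have : (0 : ℝ) < n := by positivity
    exact (div_pos h1 this).ne'⟩)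
  have := hc.mul hxl
  rw [mul_one] at this
  refine this.congr' ?_
  filter_upwards [hpos] with n ⟨h1, h2, h3, h4⟩
  have hn : (n : ℝ) ≠ 0 := by positivity
  have hαx : α n = Real.exp (x n / n) := by
    rw [hα, Real.rpow_def_of_pos (mul_pos h3 h2), Real.log_mul h3.ne' h2.ne', mul_one_div]
  simp only [Function.comp, hαx]
  field_simp

lemma eventually_gridRatio {T α : ℕ → ℝ} (hT : Tendsto T atTop atTop)
    (hα : ∀ n : ℕ, α n = (T n * Real.log (T n)) ^ (1 / (n : ℝ))) :
    ∀ᶠ n : ℕ in atTop, n ≠ 0 ∧ 1 < T n ∧ 1 < Real.log (T n) ∧ 1 < α n ∧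
      α n ^ n = T n * Real.log (T n) := by
  filter_upwards [eventually_ne_atTop 0, hT.eventually_gt_atTop 1,
    (Real.tendsto_log_atTop.comp hT).eventually_gt_atTop 1] with n hn h1 h2
  have h2' : 1 < Real.log (T n) := h2
  have h : 1 < T n * Real.log (T n) := by nlinarith
  refine ⟨hn, h1, h2, ?_, ?_⟩
  · rw [hα]
    exact Real.one_lt_rpow h (by positivity)
  · rw [hα, one_div, Real.rpow_inv_natCast_pow (by linarith) hn]

/-- The contribution of the first step is negligible. -/
lemma tendsto_firstStep {T : ℕ → ℝ} (hT : Tendsto T atTop atTop) :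
    Tendsto (fun n ↦ T n / (T n * Real.log (T n) - 1)) atTop (𝓝 0) := by
  have hlog : Tendsto (fun n ↦ Real.log (T n)) atTop atTop := Real.tendsto_log_atTop.comp hT
  have h : Tendsto (fun n ↦ (Real.log (T n) + -(T n)⁻¹)⁻¹) atTop (𝓝 0) :=
    (hlog.atTop_add hT.inv_tendsto_atTop.neg).inv_tendsto_atTop
  refine h.congr' ?_
  filter_upwards [hT.eventually_gt_atTop 0] with n hn
  rw [show Real.log (T n) + -(T n)⁻¹ = (T n * Real.log (T n) - 1) / T n by field_simp; ring,
    inv_div]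

end Asymptotics
-- Assembly of the two asymptotic bounds.
theorem mainTheorem4 {d : ℕ} (μ : Measure (EuclideanSpace ℝ (Fin d))) [IsProbabilityMeasure μ]
    (hμ : MemLp id 2 μ)
    (T α : ℕ → ℝ) (hT : Tendsto T atTop atTop)
    (hT' : Tendsto (fun n : ℕ ↦ Real.log (T n) / (n : ℝ)) atTop (𝓝 0))
    (hα : ∀ n : ℕ, α n = (T n * Real.log (T n)) ^ (1 / (n : ℝ)))
    -- the comparison process is built from `X ∼ μ` and independent standard Gaussian `N_k`
    {Ω : Type*} [MeasurableSpace Ω] (P : Measure Ω) [IsProbabilityMeasure P]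
    (X : Ω → EuclideanSpace ℝ (Fin d)) (N : ℕ → Ω → EuclideanSpace ℝ (Fin d))
    (hX : Measurable X) (hN : ∀ k, Measurable (N k))
    (hXlaw : P.map X = μ) (hNlaw : ∀ k, P.map (N k) = stdGaussian (EuclideanSpace ℝ (Fin d)))
    (hNindep : iIndepFun N P) (hXN : IndepFun X (fun ω k ↦ N k ω) P)
    -- the sampling process is built from independent standard Gaussian `N'_k`
    {Ω' : Type*} [MeasurableSpace Ω'] (P' : Measure Ω') [IsProbabilityMeasure P']
    (N' : ℕ → Ω' → EuclideanSpace ℝ (Fin d)) (hN' : ∀ k, Measurable (N' k))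
    (hN'law : ∀ k, P'.map (N' k) = stdGaussian (EuclideanSpace ℝ (Fin d)))
    (hN'indep : iIndepFun N' P')
    -- `f n k` is the conditional mean estimator of `X` given `Y_{k-1}` in the `n`-step process
    (f : ℕ → ℕ → EuclideanSpace ℝ (Fin d) → EuclideanSpace ℝ (Fin d))
    (hf : ∀ n : ℕ, ∀ k ∈ Finset.Icc 1 n,
      IsCondMeanEstimator P X
        (comparisonProcess (gridStep (α n) (T n) n) X N (k - 1)) (f n k))
    (Δ : ℕ → ℝ≥0∞)
    (hΔ : ∀ n : ℕ, Δ n = klDiv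
      (pathLaw P (comparisonProcess (gridStep (α n) (T n) n) X N) n)
      (pathLaw P' (samplingProcess (gridStep (α n) (T n) n) (f n) N') n)) :
    (∀ s : ℝ, 0 ≤ s → gaussianChannelInfo μ s ≠ ∞) ∧
    (∃ ε : ℕ → ℝ, Tendsto ε atTop (𝓝 0) ∧ ∀ᶠ n : ℕ in atTop,
      Δ n ≤ ENNReal.ofReal
        (Real.log (T n) * (gaussianChannelInfo μ (T n)).toReal / (n : ℝ) * (1 + ε n))) ∧
    (∃ ε : ℕ → ℝ, Tendsto ε atTop (𝓝 0) ∧ ∀ᶠ n : ℕ in atTop,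
      Δ n ≤ ENNReal.ofReal
        ((d : ℝ) * Real.log (T n) ^ 2 / (2 * (n : ℝ)) * (1 + ε n))) := by
  set M := ∫ x, ‖x‖ ^ 2 ∂μ - mixFisher μ 0 with hM
  set J : ℝ → ℝ := fun s ↦ (gaussianChannelInfo μ s).toReal with hJ
  set w : ℕ → ℝ := fun n ↦ T n / (T n * Real.log (T n) - 1) with hw
  have hM0 : 0 ≤ M := sub_nonneg.2 (mixFisher_le hμ le_rfl)
  have hev := eventually_gridRatio hT hα
  have hratio := tendsto_gridRatio hT hT' hα
  have hfirst : Tendsto w atTop (𝓝 0) := tendsto_firstStep hT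
  have hloginv : Tendsto (fun n ↦ (Real.log (T n))⁻¹) atTop (𝓝 0) :=
    (Real.tendsto_log_atTop.comp hT).inv_tendsto_atTop
  -- Both conclusions follow from this bound: `w n` tends to 0 and carries the first step, whose
  -- weight M is the total variance of X.
  have hbound : ∀ᶠ n : ℕ in atTop,
      Δ n ≤ ENNReal.ofReal ((α n - 1) * (J (T n) + w n * (M / 2))) := by
    filter_upwards [hev] with n ⟨hn, hT1, _, hα1, hpow⟩
    have hTn : 0 ≤ T n := by linarith
    rw [hΔ, klDiv_pathLaw hμ (gridStep_nonneg hα1 hTn) hX hN hXlaw hNlaw hNindep hXN hN' hN'law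
      hN'indep n (hf n)]
    refine ENNReal.ofReal_le_ofReal ?_
    have h := mixEntropy_gridTime_le hμ hα1 hTn hn
    simp only [stepTime_gridStep, gridTime_self hα1 hn]
    refine h.trans_eq ?_
    rw [hpow]
    simp only [hJ, hw]
    ring
  refine ⟨fun s hs ↦ ?_, ?_, ?_⟩
  · rw [gaussianChannelInfo_eq hμ hs]
    exact ENNReal.ofReal_ne_top
  -- The first-step term is absorbed into K J(T_n) by monotonicity of the information. If J 1 = 0
  -- then M = 0, and K is 0 by the convention for division.
  · set K := M / 2 / J 1
    refine ⟨fun n ↦ (α n - 1) * n / Real.log (T n) * (1 + w n * K) - 1, ?_, ?_⟩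
    · simpa using (hratio.mul ((hfirst.mul_const K).const_add 1)).sub_const 1
    filter_upwards [hbound, hev] with n hb ⟨hn, hT1, hlog, hα1, _⟩
    refine hb.trans (ENNReal.ofReal_le_ofReal ?_)
    have hK : M / 2 ≤ K * J (T n) := by
      rcases eq_or_ne M 0 with h0 | h0
      · simp [K, h0]
      · have hpos : 0 < J 1 := toReal_gaussianChannelInfo_one_pos hμ fun h ↦ h0 (by rw [hM, h, sub_self])
        rw [div_mul_eq_mul_div, le_div_iff₀ hpos]
        exact mul_le_mul_of_nonneg_left (toReal_gaussianChannelInfo_mono hμ zero_le_one hT1.le)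
          (by linarith)
    have hw0 : 0 ≤ w n := div_nonneg (by linarith) (by nlinarith)
    have hn' : (n : ℝ) ≠ 0 := by positivity
    calc (α n - 1) * (J (T n) + w n * (M / 2))
        ≤ (α n - 1) * (J (T n) + w n * (K * J (T n))) := by
          have : 0 ≤ α n - 1 := by linarith
          gcongr
      _ = _ := by
          have : Real.log (T n) ≠ 0 := by positivity
          simp only [hJ]
          field_simp
          ring
  · refine ⟨fun n ↦ (α n - 1) * n / Real.log (T n)
      * (1 + M / d * (1 + w n) * (Real.log (T n))⁻¹) - 1, ?_, ?_⟩
    · simpa using (hratio.mul ((((hfirst.const_add 1).const_mul (M / d)).mul hloginv).const_add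
        1)).sub_const 1
    filter_upwards [hbound, hev] with n hb ⟨hn, hT1, hlog, hα1, _⟩
    refine hb.trans (ENNReal.ofReal_le_ofReal ?_)
    -- Factoring out d lets the remainder be written relative to the main term d (log T_n)²/(2n),
    -- even for d = 0, where M vanishes.
    have hMd : M = d * (M / d) := by
      rcases Nat.eq_zero_or_pos d with rfl | hd
      · have h0 : ∀ x : EuclideanSpace ℝ (Fin 0), ‖x‖ = 0 := fun x ↦ by
          rw [Subsingleton.elim x 0, norm_zero]
        simp [hM, mixFisher_zero, h0]
      · field_simp
    have hJle : J (T n) ≤ M / 2 + d / 2 * Real.log (T n) :=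
      (toReal_gaussianChannelInfo_le hμ hT1.le).trans
        (by gcongr; exact toReal_gaussianChannelInfo_one_le hμ)
    have hn' : (n : ℝ) ≠ 0 := by positivity
    have hlog0 : Real.log (T n) ≠ 0 := by positivity
    calc (α n - 1) * (J (T n) + w n * (M / 2))
        ≤ (α n - 1) * (M / 2 + d / 2 * Real.log (T n) + w n * (M / 2)) := by
          have : 0 ≤ α n - 1 := by linarith
          gcongr
      _ = (α n - 1) * (d / 2 * Real.log (T n) + (1 + w n) * (d * (M / d)) / 2) := by
          rw [← hMd]; ring
      _ = _ := by
          generalize M / d = c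
          field_simp
          ring
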